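/- **Setting.** Let $(Z_t)_{t\in\mathbb R}$ be a two-sided Lévy process with $Z_0=0$, without Gaussian part, with drift $b(\eta^*)$ and Lévy measure $\nu(dx,\eta^*)$, where $\nu(\cdot,\eta)$, $\eta\in D_\eta\subset\mathbb R^r$, is a family of Lévy measures with $\int\min(|x|,1)\,\nu(dx,\eta)<\infty$, and $\eta^*\in D_\eta$. Fix $h>0$, let $\Delta Z_n=Z_{nh}-Z_{(n-1)h}$, $n\in\mathbb Z$, and let $\varphi(u,\eta)=\exp\big(h(ib(\eta)u+\int(e^{iux}-1)\,\nu(dx,\eta))\big)$. Let $G_\theta\subset\mathbb R^p$ be open, let $D_\theta\subset G_\theta$ and $D_\theta^*\subset\operatorname{int}D_\theta$ be compact, and let $\theta^*\in D_\theta^*$. Let $H(\theta)\in\mathbb R^{d\times d}$, $K_0(\theta)\in\mathbb R^{d\times 1}$, $L(\theta)\in\mathbb R^{1\times d}$ be three times continuously differentiable on $G_\theta$. The observed process is the stationary output $\Delta y=A(\theta^*,q^{-1})\Delta Z$ of $\Delta X_{n+1}=H(\theta^*)\Delta X_n+K_0(\theta^*)\Delta Z_n$, $\Delta y_n=L(\theta^*)\Delta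 X_n+\Delta Z_n$, that is, $\Delta y_n=\Delta Z_n+\sum_{j\ge0}L(\theta^*)H(\theta^*)^jK_0(\theta^*)\Delta Z_{n-1-j}$. For $n\ge1$ let $\varepsilon_n(\theta)=\Delta y_n-L(\theta)x_{n-1}(\theta)$ be the output of the inverse filter $x_n=(H(\theta)-K_0(\theta)L(\theta))x_{n-1}+K_0(\theta)\Delta y_n$ started at time $0$ from an arbitrary fixed $x_0=\xi\in\mathbb R^d$, and let $\varepsilon^{(s)}_n(\theta)=\Delta y_n-\sum_{j\ge 0}L(\theta)(H(\theta)-K_0(\theta)L(\theta))^jK_0(\theta)\Delta y_{n-1-j}$ be its stationary version. The subscript $\theta$ denotes the derivative with respect to $\theta$. Fix $u_1,\dots,u_M\in\mathbb R$ and a Hermitian positive definite $Mp\times Mp$ matrix $K$. Let $h_n(\theta,\eta)\in\mathbb C^{Mp}$ have the blocks $(e^{iu_k\varepsilon_n(\theta)}-\varphi(u_k,\eta))\,\varepsilon_{n\theta}(\theta)$, $k=1,\dots,M$, let $h^{(s)}_n$ be the same with $\varepsilon^{(s)}_n$ in place of $\varepsilon_n$, and put $$\overline h_N=\frac1N\sum_{n=1}^Nh_n,\quad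 V_N(\theta,\eta)=|K^{-1/2}\overline h_N(\theta,\eta)|^2,\quad g=\mathbb E\,h^{(s)}_n,\quad W(\theta,\eta)=g^*(\theta,\eta)K^{-1}g(\theta,\eta).$$ $V_{N\theta}$ and $W_\theta$ are the (real) gradients in $\theta$, and $R^*(\eta)=W_{\theta\theta}(\theta^*,\eta)$ is the Hessian of $W$ at $\theta^*$. **Assumptions.** (1) $H(\theta)$ and $H(\theta)-K_0(\theta)L(\theta)$ are stable (all eigenvalues in the open unit disc) for all $\theta\in G_\theta$. (2) $\int_{|x|\ge1}|x|^q\,\nu(dx,\eta^*)<\infty$ for all $q\ge1$, and $\mathbb E[\Delta Z_n]=0$. (4) For each $\eta\in D_\eta$ the equation $W_\theta(\theta,\eta)=0$ has a unique solution $\theta$ in $D_\theta$, and this solution lies in $D^*_\theta$. Moreover, $R^*(\eta)$ is nonsingular for each $\eta\in D_\eta$. **Theorem.** For each $\eta\in D_\eta$ we have $R^*(\eta)=2\,\mathrm{Re}\big(g_\theta^*(\theta^*,\eta)K^{-1}g_\theta(\theta^*,\eta)\big)$. Further, let $\hat{\hat\theta}_N(\eta)$, $N\ge1$, be any $D_\theta$-valued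 random vectors such that, almost surely, $V_{N\theta}(\hat{\hat\theta}_N(\eta),\eta)=0$ whenever the equation $V_{N\theta}(\theta,\eta)=0$ has exactly one solution in $D_\theta$. Then $$\hat{\hat\theta}_N(\eta)-\theta^*=-(R^*(\eta))^{-1}V_{N\theta}(\theta^*,\eta)+O_M(N^{-1}),$$ that is, the difference $r_N$ of $\hat{\hat\theta}_N(\eta)-\theta^*$ and $-(R^*(\eta))^{-1}V_{N\theta}(\theta^*,\eta)$ satisfies $\sup_{N\ge1}N\,\mathbb E^{1/q}|r_N|^q<\infty$ for all $q\ge1$. -/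

import Mathlib

open MeasureTheory ProbabilityTheory Filter Topology
open scoped Matrix ENNReal ComplexOrder

noncomputable section

/-! ### Levy processes of finite variation and their increments -/

/-- The Levy measures considered: no mass at the origin and `∫ min(|x|, 1) ν(dx) < ∞`. -/
def IsFiniteVariationLevyMeasure (ν : Measure ℝ) : Prop :=
  ν {0} = 0 ∧ ∫⁻ x, ENNReal.ofReal (min |x| 1) ∂ν < ∞

/-- The characteristic exponent `ψ(u) = i b u + ∫ (e^{iux} - 1) ν(dx)`. -/
def levyExponent (b : ℝ) (ν : Measure ℝ) (u : ℝ) : ℂ :=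
  Complex.I * b * u + ∫ x, (Complex.exp (Complex.I * u * x) - 1) ∂ν

/-- The characteristic function `e^{t ψ(u)}` of an increment over a time interval of length `t`. -/
def levyCharFun (b : ℝ) (ν : Measure ℝ) (t u : ℝ) : ℂ :=
  Complex.exp (t * levyExponent b ν u)

/-- `Z` is a two-sided Levy process with `Z_0 = 0`, drift `b` and Levy measure `ν`, without
Gaussian part: it has cadlag paths, independent increments, and stationary increments whose law
is given by the Levy-Khintchine formula. -/
structure IsLevyProcess {Ω : Type*} [MeasurableSpace Ω] (μ : Measure Ω)
    (b : ℝ) (ν : Measure ℝ) (Z : ℝ → Ω → ℝ) : Prop where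
  measurable : ∀ t, Measurable (Z t)
  zero : ∀ᵐ ω ∂μ, Z 0 ω = 0
  cadlag : ∀ᵐ ω ∂μ, ∀ t, ContinuousWithinAt (fun s => Z s ω) (Set.Ici t) t ∧
    ∃ l, Tendsto (fun s => Z s ω) (𝓝[<] t) (𝓝 l)
  indep : HasIndepIncrements Z μ
  charFun_increment : ∀ s t : ℝ, s ≤ t → ∀ u : ℝ,
    ∫ ω, Complex.exp (Complex.I * u * ((Z t ω - Z s ω : ℝ) : ℂ)) ∂μ = levyCharFun b ν (t - s) u

/-- All moments of order `q ≥ 1` of the large jumps are finite. -/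
def HasLargeJumpMoments (ν : Measure ℝ) : Prop :=
  ∀ q : ℝ, 1 ≤ q → ∫⁻ x in {x : ℝ | 1 ≤ |x|}, ENNReal.ofReal (|x| ^ q) ∂ν < ∞

/-! ### The linear system and its inverse -/

/-- A real square matrix is stable: all its complex eigenvalues lie in the open unit disc. -/
def IsStableMatrix {d : ℕ} (A : Matrix (Fin d) (Fin d) ℝ) : Prop :=
  ∀ z ∈ spectrum ℂ (A.map (fun a : ℝ => (a : ℂ))), ‖z‖ < 1

/-- A parametrized family of SISO systems in innovation form,
`X_{n+1} = H(θ) X_n + K(θ) e_n`, `y_n = L(θ) X_n + e_n`, with state dimension `d`. -/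
structure InnovationSystem (p d : ℕ) where
  H : EuclideanSpace ℝ (Fin p) → Matrix (Fin d) (Fin d) ℝ
  K : EuclideanSpace ℝ (Fin p) → Fin d → ℝ
  L : EuclideanSpace ℝ (Fin p) → Fin d → ℝ

namespace InnovationSystem

variable {p d : ℕ} {Ω : Type*}

/-- The state matrix `H(θ) - K(θ) L(θ)` of the inverse system. -/
def invH (S : InnovationSystem p d) (θ : EuclideanSpace ℝ (Fin p)) : Matrix (Fin d) (Fin d) ℝ :=
  S.H θ - Matrix.vecMulVec (S.K θ) (S.L θ)

/-- The system is stable and inverse stable for every parameter in `G`. -/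
def IsStableOn (S : InnovationSystem p d) (G : Set (EuclideanSpace ℝ (Fin p))) : Prop :=
  ∀ θ ∈ G, IsStableMatrix (S.H θ) ∧ IsStableMatrix (S.invH θ)

/-- The system matrices are three times continuously differentiable on `G`. -/
def IsSmoothOn (S : InnovationSystem p d) (G : Set (EuclideanSpace ℝ (Fin p))) : Prop :=
  (∀ i j, ContDiffOn ℝ 3 (fun θ => S.H θ i j) G) ∧
  (∀ i, ContDiffOn ℝ 3 (fun θ => S.K θ i) G) ∧
  (∀ i, ContDiffOn ℝ 3 (fun θ => S.L θ i) G)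

/-- The stationary output `A(θ, q⁻¹) e`, that is
`y_n = e_n + ∑_{j ≥ 0} L(θ) H(θ)^j K(θ) e_{n-1-j}`, for `-∞ < n < ∞`. -/
def output (S : InnovationSystem p d) (θ : EuclideanSpace ℝ (Fin p)) (e : ℤ → Ω → ℝ)
    (n : ℤ) (ω : Ω) : ℝ :=
  e n ω + ∑' j : ℕ, (S.L θ ⬝ᵥ ((S.H θ) ^ j *ᵥ S.K θ)) * e (n - 1 - j) ω

/-- The state of the inverse filter after the observations `y_1, …, y_n`, started from the state
`ξ`: `x_n = (H(θ) - K(θ) L(θ)) x_{n-1} + K(θ) y_n`. -/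
def filterState (S : InnovationSystem p d) (ξ : Fin d → ℝ) (y : ℤ → Ω → ℝ)
    (θ : EuclideanSpace ℝ (Fin p)) (ω : Ω) : ℕ → Fin d → ℝ
  | 0 => ξ
  | n + 1 => S.invH θ *ᵥ filterState S ξ y θ ω n + y ((n : ℤ) + 1) ω • S.K θ

/-- The estimated innovation `ε_n(θ) = y_n - L(θ) x_{n-1}`, used for `n ≥ 1`. -/
def innovation (S : InnovationSystem p d) (ξ : Fin d → ℝ) (y : ℤ → Ω → ℝ) (ω : Ω) (n : ℕ)
    (θ : EuclideanSpace ℝ (Fin p)) : ℝ :=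
  y n ω - S.L θ ⬝ᵥ S.filterState ξ y θ ω (n - 1)

/-- The stationary innovation `ε_n^{(s)}(θ) = A⁻¹(θ, q⁻¹) y`, with the filter started at `-∞`:
`ε_n^{(s)}(θ) = y_n - ∑_{j ≥ 0} L(θ) (H(θ) - K(θ) L(θ))^j K(θ) y_{n-1-j}`. -/
def statInnovation (S : InnovationSystem p d) (y : ℤ → Ω → ℝ) (ω : Ω) (n : ℤ)
    (θ : EuclideanSpace ℝ (Fin p)) : ℝ :=
  y n ω - ∑' j : ℕ, (S.L θ ⬝ᵥ ((S.invH θ) ^ j *ᵥ S.K θ)) * y (n - 1 - j) ω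

end InnovationSystem

/-! ### Scores and cost functions -/

section Scores

variable {p d M : ℕ} {Ω : Type*}

/-- The stacked score vector with blocks `(e^{i u_k ε(θ)} - c_k) ε_θ(θ)`, `k = 1, …, M`, where
`c_k` is to be `φ(u_k, η)` and `ε` is one innovation as a function of the parameter. -/
def scoreVec (u : Fin M → ℝ) (c : Fin M → ℂ) (ε : EuclideanSpace ℝ (Fin p) → ℝ)
    (θ : EuclideanSpace ℝ (Fin p)) : Fin M × Fin p → ℂ :=
  fun ki => (Complex.exp (Complex.I * u ki.1 * ε θ) - c ki.1) * ((gradient ε θ ki.2 : ℝ) : ℂ)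

/-- The weighted squared length `v^* Q⁻¹ v = |Q^{-1/2} v|^2` for a positive definite `Q`. -/
def weightedSq {ι : Type*} [Fintype ι] [DecidableEq ι] (Q : Matrix ι ι ℂ) (v : ι → ℂ) : ℝ :=
  (star v ⬝ᵥ (Q⁻¹ *ᵥ v)).re

/-- The sample mean `N⁻¹ ∑_{n=1}^N h_n(θ)` of the score vectors. -/
def scoreMean (S : InnovationSystem p d) (ξ : Fin d → ℝ) (y : ℤ → Ω → ℝ) (u : Fin M → ℝ)
    (c : Fin M → ℂ) (N : ℕ) (ω : Ω) (θ : EuclideanSpace ℝ (Fin p)) : Fin M × Fin p → ℂ :=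
  (N : ℂ)⁻¹ • ∑ n ∈ Finset.Icc 1 N, scoreVec u c (S.innovation ξ y ω n) θ

/-- The empirical cost function `V_N`. -/
def costV (S : InnovationSystem p d) (ξ : Fin d → ℝ) (y : ℤ → Ω → ℝ) (u : Fin M → ℝ)
    (c : Fin M → ℂ) (Q : Matrix (Fin M × Fin p) (Fin M × Fin p) ℂ) (N : ℕ) (ω : Ω)
    (θ : EuclideanSpace ℝ (Fin p)) : ℝ :=
  weightedSq Q (scoreMean S ξ y u c N ω θ)

/-- The expectation `g` of the stationary score vector (taken at `n = 0`). -/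
def asymScore [MeasurableSpace Ω] (μ : Measure Ω) (S : InnovationSystem p d) (y : ℤ → Ω → ℝ)
    (u : Fin M → ℝ) (c : Fin M → ℂ) (θ : EuclideanSpace ℝ (Fin p)) : Fin M × Fin p → ℂ :=
  fun ki => ∫ ω, scoreVec u c (S.statInnovation y ω 0) θ ki ∂μ

/-- The asymptotic cost function `W = g^* Q⁻¹ g`. -/
def costW [MeasurableSpace Ω] (μ : Measure Ω) (S : InnovationSystem p d) (y : ℤ → Ω → ℝ)
    (u : Fin M → ℝ) (c : Fin M → ℂ) (Q : Matrix (Fin M × Fin p) (Fin M × Fin p) ℂ)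
    (θ : EuclideanSpace ℝ (Fin p)) : ℝ :=
  weightedSq Q (asymScore μ S y u c θ)

/-- The Hessian matrix of a real function: the Jacobian matrix of its gradient. -/
def hessianMatrix (f : EuclideanSpace ℝ (Fin p) → ℝ) (θ : EuclideanSpace ℝ (Fin p)) :
    Matrix (Fin p) (Fin p) ℝ :=
  Matrix.of fun i j => fderiv ℝ (fun θ' => gradient f θ' i) θ (EuclideanSpace.single j 1)

/-- The Jacobian matrix of a complex vector-valued function of a real parameter. -/
def jacobianMatrix {ι : Type*} (g : EuclideanSpace ℝ (Fin p) → ι → ℂ)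
    (θ : EuclideanSpace ℝ (Fin p)) : Matrix ι (Fin p) ℂ :=
  Matrix.of fun a j => fderiv ℝ (fun θ' => g θ' a) θ (EuclideanSpace.single j 1)

/-- `That` is an estimator of the parameter obtained by solving `V_{Nθ}(θ) = 0` in `D`: it is a
`D`-valued random vector that solves the equation on the event that the equation has exactly one
solution in `D` (elsewhere its value in `D` is arbitrary). -/
def IsScoreRoot [MeasurableSpace Ω] (μ : Measure Ω) (D : Set (EuclideanSpace ℝ (Fin p)))
    (V : Ω → EuclideanSpace ℝ (Fin p) → ℝ) (That : Ω → EuclideanSpace ℝ (Fin p)) : Prop :=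
  Measurable That ∧ (∀ ω, That ω ∈ D) ∧
    ∀ᵐ ω ∂μ, (∃! θ, θ ∈ D ∧ gradient (V ω) θ = 0) → gradient (V ω) (That ω) = 0

/-- `X_N = O_M(f(N))`: for all `q ≥ 1`, `sup_{N ≥ 1} E^{1/q} |X_N|^q / f(N) < ∞`. -/
def IsOM {E : Type*} [NormedAddCommGroup E] [MeasurableSpace Ω] (μ : Measure Ω)
    (X : ℕ → Ω → E) (f : ℕ → ℝ) : Prop :=
  ∀ q : ℝ, 1 ≤ q → ∃ C : ℝ, ∀ N : ℕ, 1 ≤ N →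
    eLpNorm (X N) (ENNReal.ofReal q) μ ≤ ENNReal.ofReal (C * f N)

end Scores

end

/-! At the true parameter the stationary innovation is the noise `ΔZ_n` itself, because the inverse
filter undoes the output filter. The gradient of the innovation is a linear process in the strictly
earlier noise, hence centred and independent of `ΔZ_n`. So `g(θ*, η) = 0` for every `η`, whatever
the constants `φ(u_k, η)` are (`IsNoise.integral_scoreFun_eq_zero`). In `W_θ = 2 Re (g^* K⁻¹ g_θ)`
one factor vanishes at `θ*`, so only that factor has to be differentiated there, and this is the
formula for `R*`. It also follows that `θ*` is the unique critical point of `W` in `D`.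

For the expansion, let `f` and `f'` be the sample means of the scores and of their derivatives, so
that `V_{Nθ}` is `costDeriv` of `(f, f')`. Let `Y` bound the deviations of `f` and `f'` from `g` and
`g_θ` at finitely many points of `D`, and the deviation of one further sample mean that controls the
Lipschitz constant of `f'`. If `Y` is small, `V_{Nθ}` has no zero in `D` away from `θ*`. Near `θ*`
it is a small Lipschitz perturbation of the linear map `R*`, so it has exactly one zero there, and a
Newton step from `θ*` finds that zero up to `C Y²` (`exists_finset_unique_costDeriv_eq_zero`). If
`Y` is not small, the error is at most a multiple of the size of `D` plus the Newton step, and this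
is again at most `C Y²` for a larger `C`. Hence no exceptional event has to be estimated: everything
reduces to `Y = O_M(N^{-1/2})` (`IsNoise.exists_quadratic_bound`).

Finitely many points suffice because randomness and parameter are separated: `ε_n(θ) = Λ_n (B θ)`,
where `B` is a deterministic `C³` map into a Banach space of coefficient sequences and `Λ_n` is a
random functional. Up to a geometrically small transient, `Λ_n` is a linear process in the noise.
Derivatives in `θ` touch only `B`; scores are locally Lipschitz in `Λ_n` with polynomial growth, and
their Lipschitz constants in `θ` are polynomial in `‖Λ_n‖`.

The rate `N^{-1/2}` in all moments comes from cutting linear processes off at every lag and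
telescoping. The differences are centred, depend on finite windows of the noise and decay
geometrically (`IsNoise.momentBounded_sum_linProc`). The noise has moments of all orders because its
characteristic function is smooth (`memLp_of_contDiff_charFun`). -/

noncomputable section

/-! ### Quantities of a given order in every `L^k` -/

section MomentBounds

variable {Ω : Type*} [MeasurableSpace Ω] {μ : Measure Ω} {ι κ : Type*}

/-- The variables `X i` are dominated by measurable functions whose `L^k` norms are, for every `k`,
at most a constant times `f i`. -/
def MomentBounded (μ : Measure Ω) (X : ι → Ω → ℝ) (f : ι → ℝ) : Prop :=
  ∀ k : ℕ, 1 ≤ k → ∃ C : ℝ, 0 ≤ C ∧ ∀ i, ∃ g : Ω → ℝ, AEStronglyMeasurable g μ ∧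
    (∀ᵐ ω ∂μ, |X i ω| ≤ g ω) ∧ eLpNorm g k μ ≤ ENNReal.ofReal (C * f i)

namespace MomentBounded

variable {X Y : ι → Ω → ℝ} {f g : ι → ℝ}

lemma eLpNorm_le (h : MomentBounded μ X f) {k : ℕ} (hk : 1 ≤ k) :
    ∃ C : ℝ, 0 ≤ C ∧ ∀ i, eLpNorm (X i) k μ ≤ ENNReal.ofReal (C * f i) := by
  obtain ⟨C, hC, H⟩ := h k hk
  refine ⟨C, hC, fun i => ?_⟩
  obtain ⟨g, -, hg, hle⟩ := H i
  refine (eLpNorm_mono_ae ?_).trans hle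
  filter_upwards [hg] with ω hω
  rw [Real.norm_eq_abs, Real.norm_eq_abs]
  exact hω.trans (le_abs_self _)

lemma of_eLpNorm_le (hX : ∀ i, AEStronglyMeasurable (X i) μ)
    (h : ∀ k : ℕ, 1 ≤ k → ∃ C : ℝ, 0 ≤ C ∧ ∀ i, eLpNorm (X i) k μ ≤ ENNReal.ofReal (C * f i)) :
    MomentBounded μ X f := by
  intro k hk
  obtain ⟨C, hC, H⟩ := h k hk
  refine ⟨C, hC, fun i => ⟨fun ω => |X i ω|, (hX i).norm, ae_of_all _ fun ω => le_rfl, ?_⟩⟩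
  exact (eLpNorm_norm (X i)).le.trans (H i)

/-- `Y` needs no measurability: this is what the dominating functions in the definition are for,
since estimates are proved path by path. -/
lemma mono_ae (h : MomentBounded μ X f) (hle : ∀ i, ∀ᵐ ω ∂μ, |Y i ω| ≤ |X i ω|) :
    MomentBounded μ Y f := by
  intro k hk
  obtain ⟨C, hC, H⟩ := h k hk
  refine ⟨C, hC, fun i => ?_⟩
  obtain ⟨g, hm, hg, hn⟩ := H i
  refine ⟨g, hm, ?_, hn⟩
  filter_upwards [hg, hle i] with ω h1 h2
  exact h2.trans h1

lemma mono (h : MomentBounded μ X f) (hle : ∀ i ω, |Y i ω| ≤ |X i ω|) :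
    MomentBounded μ Y f := h.mono_ae fun i => ae_of_all _ (hle i)

lemma mono_right (h : MomentBounded μ X f) {c : ℝ} (hc : 0 ≤ c) (hfg : ∀ i, f i ≤ c * g i) :
    MomentBounded μ X g := by
  intro k hk
  obtain ⟨C, hC, H⟩ := h k hk
  refine ⟨C * c, by positivity, fun i => ?_⟩
  obtain ⟨g, hm, hg, hn⟩ := H i
  refine ⟨g, hm, hg, hn.trans (ENNReal.ofReal_le_ofReal ?_)⟩
  rw [mul_assoc]
  exact mul_le_mul_of_nonneg_left (hfg i) hC

lemma comp (h : MomentBounded μ X f) (φ : κ → ι) :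
    MomentBounded μ (fun k => X (φ k)) (fun k => f (φ k)) := by
  intro k hk
  obtain ⟨C, hC, H⟩ := h k hk
  exact ⟨C, hC, fun i => H (φ i)⟩

lemma const [IsProbabilityMeasure μ] (c : ℝ) :
    MomentBounded μ (fun (_ : ι) (_ : Ω) => c) (fun _ => 1) := by
  intro k hk
  refine ⟨|c|, abs_nonneg _, fun i => ⟨fun _ => |c|, aestronglyMeasurable_const,
    ae_of_all _ fun _ => le_rfl, ?_⟩⟩
  rw [eLpNorm_const _ (by positivity) (IsProbabilityMeasure.ne_zero μ)]
  simp [Real.enorm_eq_ofReal_abs]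

lemma const_mul (h : MomentBounded μ X f) (c : ℝ) :
    MomentBounded μ (fun i ω => c * X i ω) f := by
  intro k hk
  obtain ⟨C, hC, H⟩ := h k hk
  refine ⟨|c| * C, by positivity, fun i => ?_⟩
  obtain ⟨g, hm, hg, hn⟩ := H i
  refine ⟨fun ω => |c| * g ω, hm.const_mul _, ?_, ?_⟩
  · filter_upwards [hg] with ω h1
    rw [abs_mul]
    exact mul_le_mul_of_nonneg_left h1 (abs_nonneg _)
  · have := eLpNorm_const_smul (|c|) g (k : ℝ≥0∞) μ
    simp only [Pi.smul_def, smul_eq_mul] at this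
    rw [this, mul_assoc, ENNReal.ofReal_mul (abs_nonneg _), Real.enorm_eq_ofReal_abs, abs_abs]
    gcongr

lemma add (hX : MomentBounded μ X f) (hY : MomentBounded μ Y f) (hf : ∀ i, 0 ≤ f i) :
    MomentBounded μ (fun i ω => X i ω + Y i ω) f := by
  intro k hk
  obtain ⟨C, hC, H⟩ := hX k hk
  obtain ⟨C', hC', H'⟩ := hY k hk
  refine ⟨C + C', by positivity, fun i => ?_⟩
  obtain ⟨g, hm, hg, hn⟩ := H i
  obtain ⟨g', hm', hg', hn'⟩ := H' i
  refine ⟨fun ω => g ω + g' ω, hm.add hm', ?_, ?_⟩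
  · filter_upwards [hg, hg'] with ω h1 h2
    exact (abs_add_le _ _).trans (add_le_add h1 h2)
  · refine (eLpNorm_add_le hm hm' (by exact_mod_cast hk)).trans ?_
    rw [add_mul, ENNReal.ofReal_add (by have := hf i; positivity) (by have := hf i; positivity)]
    exact add_le_add hn hn'

/-- Cauchy–Schwarz costs a doubling of the order, which is harmless because all orders are
controlled at once. -/
lemma mul (hX : MomentBounded μ X f) (hY : MomentBounded μ Y g) (hf : ∀ i, 0 ≤ f i) :
    MomentBounded μ (fun i ω => X i ω * Y i ω) (fun i => f i * g i) := by
  intro k hk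
  obtain ⟨C, hC, H⟩ := hX (2 * k) (by omega)
  obtain ⟨C', hC', H'⟩ := hY (2 * k) (by omega)
  refine ⟨C * C', by positivity, fun i => ?_⟩
  obtain ⟨u, hm, hu, hn⟩ := H i
  obtain ⟨v, hm', hv, hn'⟩ := H' i
  refine ⟨fun ω => u ω * v ω, hm.mul hm', ?_, ?_⟩
  · filter_upwards [hu, hv] with ω h1 h2
    rw [abs_mul]
    exact mul_le_mul h1 h2 (abs_nonneg _) ((abs_nonneg _).trans h1)
  · have hH : ENNReal.HolderTriple ((2 * k : ℕ) : ℝ≥0∞) ((2 * k : ℕ) : ℝ≥0∞) (k : ℝ≥0∞) := by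
      constructor
      push_cast
      rw [ENNReal.mul_inv (by simp) (by simp), ← two_mul, ← mul_assoc,
        ENNReal.mul_inv_cancel (by simp) (by simp), one_mul]
    have := eLpNorm_smul_le_mul_eLpNorm (μ := μ) (p := ((2 * k : ℕ) : ℝ≥0∞))
      (q := ((2 * k : ℕ) : ℝ≥0∞)) (r := (k : ℝ≥0∞)) hm' hm
    refine this.trans ((mul_le_mul' hn hn').trans ?_)
    rw [← ENNReal.ofReal_mul (by have := hf i; positivity)]
    exact ENNReal.ofReal_le_ofReal (by ring_nf; exact le_rfl)

lemma pow [IsProbabilityMeasure μ] (hX : MomentBounded μ X f) (hf : ∀ i, 0 ≤ f i) (n : ℕ) :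
    MomentBounded μ (fun i ω => X i ω ^ n) (fun i => f i ^ n) := by
  induction n with
  | zero => simpa using const (μ := μ) (ι := ι) 1
  | succ n ih => simpa [pow_succ] using ih.mul hX (fun i => pow_nonneg (hf i) n)

lemma sum (hX : MomentBounded μ X f) (hf : ∀ i, 0 ≤ f i) (s : κ → Finset ι) :
    MomentBounded μ (fun k ω => ∑ i ∈ s k, X i ω) (fun k => ∑ i ∈ s k, f i) := by
  intro k hk
  obtain ⟨C, hC, H⟩ := hX k hk
  choose g hm hg hn using H
  refine ⟨C, hC, fun j => ⟨fun ω => ∑ i ∈ s j, g i ω, ?_, ?_, ?_⟩⟩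
  · exact Finset.aestronglyMeasurable_fun_sum _ fun i _ => hm i
  · have : ∀ᵐ ω ∂μ, ∀ i ∈ s j, |X i ω| ≤ g i ω :=
      (Finset.eventually_all (s j)).2 fun i _ => hg i
    filter_upwards [this] with ω h
    exact (Finset.abs_sum_le_sum_abs _ _).trans (Finset.sum_le_sum h)
  · have h1 : (fun ω => ∑ i ∈ s j, g i ω) = ∑ i ∈ s j, g i := by ext; simp
    rw [h1]
    refine (eLpNorm_sum_le (fun i _ => hm i) (by exact_mod_cast hk)).trans ?_
    rw [Finset.mul_sum, ENNReal.ofReal_sum_of_nonneg fun i _ => mul_nonneg hC (hf i)]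
    exact Finset.sum_le_sum fun i _ => hn i

lemma memLp [IsProbabilityMeasure μ] (h : MomentBounded μ X f) {i : ι}
    (hi : AEStronglyMeasurable (X i) μ) (k : ℕ) : MemLp (X i) k μ := by
  obtain ⟨C, -, H⟩ := h.eLpNorm_le (k := k + 1) (by omega)
  have : MemLp (X i) ((k + 1 : ℕ) : ℝ≥0∞) μ := ⟨hi, (H i).trans_lt ENNReal.ofReal_lt_top⟩
  exact this.mono_exponent (by exact_mod_cast Nat.le_succ k)

lemma integrable [IsProbabilityMeasure μ] (h : MomentBounded μ X f) {i : ι}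
    (hi : AEStronglyMeasurable (X i) μ) : Integrable (X i) μ := by
  simpa [memLp_one_iff_integrable] using h.memLp hi 1

lemma integral_abs_le (h : MomentBounded μ X f) (hf : ∀ i, 0 ≤ f i) :
    ∃ C : ℝ, 0 ≤ C ∧ ∀ i, ∫ ω, |X i ω| ∂μ ≤ C * f i := by
  obtain ⟨C, hC, H⟩ := h.eLpNorm_le le_rfl
  refine ⟨C, hC, fun i => ?_⟩
  have hCf : 0 ≤ C * f i := mul_nonneg hC (hf i)
  by_cases hi : Integrable (X i) μ
  · have h1 := H i
    simp only [Nat.cast_one, eLpNorm_one_eq_lintegral_enorm] at h1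
    have h2 := integral_norm_eq_lintegral_enorm (μ := μ) hi.1
    simp only [Real.norm_eq_abs] at h2
    rw [h2]
    exact ENNReal.toReal_le_of_le_ofReal hCf h1
  -- `X i` need not be measurable, so `|X i|` may be integrable although `X i` is not. If neither is
  -- integrable, the integral is `0` by convention.
  · by_cases h' : Integrable (fun ω => |X i ω|) μ
    · have h1 := H i
      simp only [Nat.cast_one, eLpNorm_one_eq_lintegral_enorm] at h1
      rw [integral_eq_lintegral_of_nonneg_ae (ae_of_all _ fun ω => abs_nonneg _) h'.1]
      refine ENNReal.toReal_le_of_le_ofReal hCf (le_trans (le_of_eq ?_) h1)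
      exact lintegral_congr fun ω => (Real.enorm_eq_ofReal_abs _).symm
    · rw [integral_undef h']; exact hCf

/-- Infinite sums with summable bounds converge almost surely, with bounded moments. -/
lemma tsum {X : κ → ℕ → Ω → ℝ} {a : ℕ → ℝ} (ha : ∀ j, 0 ≤ a j) (hs : Summable a)
    (h : MomentBounded μ (fun p : κ × ℕ => X p.1 p.2) (fun p => a p.2)) :
    (∀ k, ∀ᵐ ω ∂μ, Summable fun j => |X k j ω|) ∧
      MomentBounded μ (fun k ω => ∑' j, |X k j ω|) (fun _ => 1) := by
  have hsum : ∀ (C : ℝ) (g : ℕ → Ω → ℝ), (∀ j, AEStronglyMeasurable (g j) μ) → 0 ≤ C →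
      (∀ j, eLpNorm (g j) 1 μ ≤ ENNReal.ofReal (C * a j)) →
      ∀ᵐ ω ∂μ, Summable fun j => |g j ω| := by
    intro C g hm hC hn
    have h1 : ∫⁻ ω, ∑' j, ‖g j ω‖ₑ ∂μ ≠ ∞ := by
      rw [lintegral_tsum fun j => (hm j).enorm]
      refine ne_top_of_le_ne_top (b := ∑' j, ENNReal.ofReal (C * a j)) ?_ ?_
      · exact (hs.mul_left C).tsum_ofReal_ne_top
      · refine ENNReal.tsum_le_tsum fun j => ?_
        rw [← eLpNorm_one_eq_lintegral_enorm]; exact hn j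
    have h2 := ae_lt_top' (AEMeasurable.tsum fun j => (hm j).enorm) h1
    filter_upwards [h2] with ω hω
    have h3 := ENNReal.summable_toReal hω.ne
    simpa [Real.norm_eq_abs] using h3
  have hdom : ∀ k : ℕ, 1 ≤ k → ∃ C : ℝ, 0 ≤ C ∧ ∀ i, ∃ G : Ω → ℝ, AEStronglyMeasurable G μ ∧
    (∀ᵐ ω ∂μ, (k = 1 → Summable fun j => |X i j ω|) ∧ ∑' j, |X i j ω| ≤ G ω) ∧
      eLpNorm G k μ ≤ ENNReal.ofReal (C * 1) := by
    intro k hk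
    obtain ⟨C, hC, H⟩ := h k hk
    obtain ⟨C1, hC1, H1⟩ := h 1 le_rfl
    choose g hm hg hn using H
    choose g1 hm1 hg1 hn1 using H1
    refine ⟨C * ∑' j, a j, mul_nonneg hC (tsum_nonneg ha), fun i => ?_⟩
    -- The dominating functions depend on the order. Their minimum inherits the `L^k` bound from
    -- order `k` and almost sure summability from order `1`; the measure is not assumed finite here,
    -- so the latter does not follow from the former.
    let w : ℕ → Ω → ℝ := fun j ω => min (|g (i, j) ω|) (|g1 (i, j) ω|)
    have hwm : ∀ j, AEStronglyMeasurable (w j) μ := fun j => (hm (i, j)).norm.inf (hm1 (i, j)).norm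
    have hwk : ∀ j, eLpNorm (w j) k μ ≤ ENNReal.ofReal (C * a j) := by
      intro j
      refine (eLpNorm_mono_real (g := fun ω => |g (i, j) ω|) fun ω => ?_).trans
        ((eLpNorm_norm (g (i, j))).le.trans (hn (i, j)))
      rw [Real.norm_eq_abs, abs_of_nonneg (by positivity)]
      exact min_le_left _ _
    have hw1 : ∀ j, eLpNorm (w j) 1 μ ≤ ENNReal.ofReal (C1 * a j) := by
      intro j
      refine (eLpNorm_mono_real (g := fun ω => |g1 (i, j) ω|) fun ω => ?_).trans
        ((eLpNorm_norm (g1 (i, j))).le.trans (by simpa using hn1 (i, j)))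
      rw [Real.norm_eq_abs, abs_of_nonneg (by positivity)]
      exact min_le_right _ _
    have hws := hsum C1 w hwm hC1 hw1
    have hlim : ∀ᵐ ω ∂μ, Tendsto (fun n => ∑ j ∈ Finset.range n, w j ω) atTop
        (𝓝 (∑' j, w j ω)) := by
      filter_upwards [hws] with ω hω
      exact (summable_abs_iff.1 hω).hasSum.tendsto_sum_nat
    have hXw : ∀ᵐ ω ∂μ, ∀ j, |X i j ω| ≤ w j ω := by
      rw [ae_all_iff]
      intro j
      filter_upwards [hg (i, j), hg1 (i, j)] with ω h1 h2
      exact le_min (h1.trans (le_abs_self _)) (h2.trans (le_abs_self _))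
    refine ⟨fun ω => ∑' j, w j ω, ?_, ?_, ?_⟩
    · exact aestronglyMeasurable_of_tendsto_ae atTop
        (fun n => Finset.aestronglyMeasurable_fun_sum _ fun j _ => hwm j) hlim
    · filter_upwards [hws, hXw] with ω h1 h2
      have h3 : Summable fun j => |X i j ω| :=
        Summable.of_nonneg_of_le (fun j => abs_nonneg _) h2 (summable_abs_iff.1 h1)
      exact ⟨fun _ => h3, h3.tsum_le_tsum h2 (summable_abs_iff.1 h1)⟩
    · refine (Lp.eLpNorm_lim_le_liminf_eLpNorm
        (fun n => Finset.aestronglyMeasurable_fun_sum _ fun j _ => hwm j) _ hlim).trans ?_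
      refine liminf_le_of_le (by isBoundedDefault) fun b hb => ?_
      obtain ⟨n, hn⟩ := hb.exists
      refine hn.trans ?_
      have h1 : (fun ω => ∑ j ∈ Finset.range n, w j ω) = ∑ j ∈ Finset.range n, w j := by ext; simp
      rw [h1]
      refine (eLpNorm_sum_le (fun j _ => hwm j) (by exact_mod_cast hk)).trans ?_
      refine (Finset.sum_le_sum fun j _ => hwk j).trans ?_
      rw [← ENNReal.ofReal_sum_of_nonneg fun j _ => mul_nonneg hC (ha j), mul_one,
        ← Finset.mul_sum]
      exact ENNReal.ofReal_le_ofReal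
        (mul_le_mul_of_nonneg_left (hs.sum_le_tsum _ fun j _ => ha j) hC)
  constructor
  · intro i
    obtain ⟨C, -, H⟩ := hdom 1 le_rfl
    obtain ⟨G, -, hG, -⟩ := H i
    filter_upwards [hG] with ω hω using hω.1 rfl
  · intro k hk
    obtain ⟨C, hC, H⟩ := hdom k hk
    refine ⟨C, hC, fun i => ?_⟩
    obtain ⟨G, hm, hG, hn⟩ := H i
    refine ⟨G, hm, ?_, hn⟩
    filter_upwards [hG] with ω hω
    rw [abs_of_nonneg (tsum_nonneg fun j => abs_nonneg _)]
    exact hω.2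

end MomentBounded

end MomentBounds

/-! ### Even moments of sums of independent centred variables -/

section IndependentSums

variable {Ω : Type*} [MeasurableSpace Ω] {μ : Measure Ω}

/-- The binomial expansion of an even power up to first order, with a two-term remainder. -/
lemma add_pow_even_le (l : ℕ) (s y : ℝ) :
    (s + y) ^ (2 * (l + 1)) ≤ s ^ (2 * (l + 1)) + (2 * (l + 1) : ℕ) * (s ^ (2 * l + 1) * y) +
      4 ^ (l + 1) * (s ^ (2 * l) * y ^ 2 + y ^ (2 * (l + 1))) := by
  have hterm : ∀ j ∈ Finset.range (2 * l + 1),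
      |y ^ (j + 2) * s ^ (2 * l - j)| ≤ s ^ (2 * l) * y ^ 2 + y ^ (2 * (l + 1)) := by
    intro j hj
    have hj' : j ≤ 2 * l := by simpa [Nat.lt_succ_iff] using hj
    rw [abs_mul, abs_pow, abs_pow]
    have e1 : s ^ (2 * l) = |s| ^ (2 * l) := ((even_two_mul l).pow_abs s).symm
    have e2 : y ^ 2 = |y| ^ 2 := (sq_abs y).symm
    have e3 : y ^ (2 * (l + 1)) = |y| ^ (2 * (l + 1)) := ((even_two_mul (l + 1)).pow_abs y).symm
    rw [e1, e2, e3]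
    have hs := abs_nonneg s
    have hy := abs_nonneg y
    -- A monomial with at least two factors `y` is dominated by one of the two extreme monomials,
    -- according to which of `|y|`, `|s|` is larger.
    rcases le_total |y| |s| with h | h
    · have : |y| ^ (j + 2) * |s| ^ (2 * l - j) ≤ |s| ^ (2 * l) * |y| ^ 2 := by
        calc |y| ^ (j + 2) * |s| ^ (2 * l - j) = |y| ^ j * |s| ^ (2 * l - j) * |y| ^ 2 := by ring
          _ ≤ |s| ^ j * |s| ^ (2 * l - j) * |y| ^ 2 := by gcongr
          _ = |s| ^ (2 * l) * |y| ^ 2 := by rw [← pow_add]; congr 2; omega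
      have h2 : 0 ≤ |y| ^ (2 * (l + 1)) := by positivity
      linarith
    · have : |y| ^ (j + 2) * |s| ^ (2 * l - j) ≤ |y| ^ (2 * (l + 1)) := by
        calc |y| ^ (j + 2) * |s| ^ (2 * l - j) ≤ |y| ^ (j + 2) * |y| ^ (2 * l - j) := by gcongr
          _ = |y| ^ (2 * (l + 1)) := by rw [← pow_add]; congr 1; omega
      have h2 : 0 ≤ |s| ^ (2 * l) * |y| ^ 2 := by positivity
      linarith
  have hexp : (s + y) ^ (2 * (l + 1)) = s ^ (2 * (l + 1)) +
      (2 * (l + 1) : ℕ) * (s ^ (2 * l + 1) * y) +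
      ∑ j ∈ Finset.range (2 * l + 1),
        y ^ (j + 2) * s ^ (2 * l - j) * ((2 * (l + 1)).choose (j + 2) : ℝ) := by
    rw [add_comm s y, add_pow, show 2 * (l + 1) + 1 = (2 * l + 1) + 1 + 1 by ring,
      Finset.sum_range_succ', Finset.sum_range_succ']
    have : ∀ j, 2 * (l + 1) - (j + 1 + 1) = 2 * l - j := fun j => by omega
    have h2 : 2 * (l + 1) - (0 + 1) = 2 * l + 1 := by omega
    simp only [this, h2]
    simp
    ring
  rw [hexp]
  refine add_le_add_right ?_ _
  set A := s ^ (2 * l) * y ^ 2 + y ^ (2 * (l + 1)) with hA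
  have hA0 : 0 ≤ A := by
    have h1 : 0 ≤ s ^ (2 * l) := (even_two_mul l).pow_nonneg s
    have h2 : 0 ≤ y ^ (2 * (l + 1)) := (even_two_mul (l + 1)).pow_nonneg y
    positivity
  calc ∑ j ∈ Finset.range (2 * l + 1),
        y ^ (j + 2) * s ^ (2 * l - j) * ((2 * (l + 1)).choose (j + 2) : ℝ)
      ≤ ∑ j ∈ Finset.range (2 * l + 1), A * ((2 * (l + 1)).choose (j + 2) : ℝ) := by
        refine Finset.sum_le_sum fun j hj => ?_
        exact mul_le_mul_of_nonneg_right ((le_abs_self _).trans (hterm j hj)) (by positivity)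
    _ = A * ∑ j ∈ Finset.range (2 * l + 1), ((2 * (l + 1)).choose (j + 2) : ℝ) := by
        rw [Finset.mul_sum]
    -- All binomial coefficients of order `2 (l + 1)` together sum to `4 ^ (l + 1)`.
    _ ≤ A * 4 ^ (l + 1) := by
        refine mul_le_mul_of_nonneg_left ?_ hA0
        have h1 := Nat.sum_range_choose (2 * (l + 1))
        rw [show 2 * (l + 1) + 1 = (2 * l + 1) + 1 + 1 by ring,
          Finset.sum_range_succ', Finset.sum_range_succ'] at h1
        have h2 : (∑ j ∈ Finset.range (2 * l + 1), (2 * (l + 1)).choose (j + 2)) ≤ 4 ^ (l + 1) := by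
          have h3 : 4 ^ (l + 1) = 2 ^ (2 * (l + 1)) := by rw [show (4 : ℕ) = 2 ^ 2 by norm_num, ← pow_mul]
          simp only [add_assoc, Nat.reduceAdd] at h1 h3 ⊢
          omega
        exact_mod_cast h2
    _ = 4 ^ (l + 1) * A := mul_comm _ _

/-- The constants in the moment inequality for sums of independent variables. -/
def indepSumConst : ℕ → ℝ
  | 0 => 1
  | l + 1 => 4 ^ (l + 1) * (indepSumConst l + 1)

lemma indepSumConst_pos : ∀ l, 0 < indepSumConst l
  | 0 => one_pos
  | l + 1 => by
    have := indepSumConst_pos l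
    simp only [indepSumConst]; positivity

/-- A moment inequality for sums of independent centred variables. -/
lemma integral_sum_pow_even_le [IsProbabilityMeasure μ] (Y : ℕ → Ω → ℝ) (s : Finset ℕ)
    (hY : ∀ n ∈ s, ∀ k : ℕ, MemLp (Y n) k μ) (h0 : ∀ n ∈ s, ∫ ω, Y n ω ∂μ = 0)
    (hind : ∀ n ∈ s, ∀ t ⊆ s, (∀ i ∈ t, i < n) → IndepFun (fun ω => ∑ i ∈ t, Y i ω) (Y n) μ)
    {B : ℝ} (l : ℕ) (hB : ∀ n ∈ s, ∀ j ≤ l, ∫ ω, Y n ω ^ (2 * j) ∂μ ≤ B ^ (2 * j)) :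
    ∫ ω, (∑ i ∈ s, Y i ω) ^ (2 * l) ∂μ ≤ indepSumConst l * (s.card + 1 : ℝ) ^ l * B ^ (2 * l) := by
  have hint : ∀ {f : Ω → ℝ}, (∀ k : ℕ, MemLp f k μ) → ∀ n : ℕ, ∀ k : ℕ,
      MemLp (fun ω => f ω ^ n) k μ := by
    intro f hf n k
    rcases Nat.eq_zero_or_pos n with rfl | hn
    · simpa using memLp_const (1 : ℝ)
    have h1 := (hf (n * k)).norm_rpow_div (n : ℝ≥0∞)
    have h2 : (((n * k : ℕ) : ℝ≥0∞) / (n : ℝ≥0∞)) = k := by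
      push_cast
      rw [mul_comm, mul_div_assoc, ENNReal.div_self (by simp; omega) (by simp), mul_one]
    rw [h2] at h1
    refine h1.of_le ((hf 0).1.pow n) (ae_of_all _ fun ω => ?_)
    simp
  -- Outer induction on the order, inner induction on the largest index, so that the new summand is
  -- independent of the sum `S` of the others. The linear term of the expansion has mean zero; the
  -- remainder involves only the moment of order `2 l` of `S`, known from the outer induction.
  induction l generalizing s with
  | zero => simp [indepSumConst]
  | succ l ih =>
    induction s using Finset.induction_on_max with
    | empty =>
      simp only [Finset.sum_empty, Finset.card_empty]
      rw [zero_pow (by omega)]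
      simp only [integral_zero]
      have := indepSumConst_pos (l + 1)
      have hB : 0 ≤ B ^ (2 * (l + 1)) := (even_two_mul (l + 1)).pow_nonneg B
      positivity
    | insert n t hlt ihn =>
      have hnt : n ∉ t := fun h => lt_irrefl _ (hlt n h)
      have hsub : t ⊆ insert n t := Finset.subset_insert _ _
      have hn : n ∈ insert n t := Finset.mem_insert_self _ _
      have ih1 := ihn (fun i hi => hY i (hsub hi)) (fun i hi => h0 i (hsub hi))
        (fun i hi r hr => hind i (hsub hi) r (hr.trans hsub)) (fun i hi => hB i (hsub hi))
      have ih2 := ih t (fun i hi => hY i (hsub hi)) (fun i hi => h0 i (hsub hi))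
        (fun i hi r hr => hind i (hsub hi) r (hr.trans hsub))
        (fun i hi j hj => hB i (hsub hi) j (by omega))
      set S : Ω → ℝ := fun ω => ∑ i ∈ t, Y i ω with hS
      have hSm : ∀ k : ℕ, MemLp S k μ := fun k => memLp_finsetSum t fun i hi => hY i (hsub hi) k
      have hYn := hY n hn
      have hI := hind n hn t hsub hlt
      have hprod : ∀ a b : ℕ, ∫ ω, S ω ^ a * Y n ω ^ b ∂μ =
          (∫ ω, S ω ^ a ∂μ) * ∫ ω, Y n ω ^ b ∂μ := by
        intro a b
        have h1 := hI.comp (φ := fun x : ℝ => x ^ a) (ψ := fun x : ℝ => x ^ b)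
          (measurable_id.pow_const a) (measurable_id.pow_const b)
        exact h1.integral_fun_mul_eq_mul_integral ((hSm 0).1.pow a) ((hYn 0).1.pow b)
      have hprodI : ∀ a b : ℕ, Integrable (fun ω => S ω ^ a * Y n ω ^ b) μ := by
        intro a b
        have := (hint hYn b 2).mul (r := 1) (hint hSm a 2) (p := 2) (q := 2)
        simpa [memLp_one_iff_integrable, Pi.mul_def] using this
      have hSI : ∀ a : ℕ, Integrable (fun ω => S ω ^ a) μ := fun a => by
        simpa [memLp_one_iff_integrable] using hint hSm a 1
      have hYI : ∀ a : ℕ, Integrable (fun ω => Y n ω ^ a) μ := fun a => by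
        simpa [memLp_one_iff_integrable] using hint hYn a 1
      have hstep : ∫ ω, (S ω + Y n ω) ^ (2 * (l + 1)) ∂μ ≤
          (∫ ω, S ω ^ (2 * (l + 1)) ∂μ) + 4 ^ (l + 1) *
            ((∫ ω, S ω ^ (2 * l) ∂μ) * (∫ ω, Y n ω ^ 2 ∂μ) + ∫ ω, Y n ω ^ (2 * (l + 1)) ∂μ) := by
        have hp1 : Integrable (fun ω => S ω ^ (2 * l + 1) * Y n ω) μ := by
          simpa using hprodI (2 * l + 1) 1
        have hz : ∫ ω, S ω ^ (2 * l + 1) * Y n ω ∂μ = 0 := by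
          have := hprod (2 * l + 1) 1
          simpa [h0 n hn] using this
        have hsumI : ∀ k : ℕ, MemLp (fun ω => S ω + Y n ω) k μ := fun k => (hSm k).add (hYn k)
        calc ∫ ω, (S ω + Y n ω) ^ (2 * (l + 1)) ∂μ
            ≤ ∫ ω, (S ω ^ (2 * (l + 1)) + (2 * (l + 1) : ℕ) * (S ω ^ (2 * l + 1) * Y n ω) +
              4 ^ (l + 1) * (S ω ^ (2 * l) * Y n ω ^ 2 + Y n ω ^ (2 * (l + 1)))) ∂μ := by
              refine integral_mono ?_ ?_ fun ω => add_pow_even_le l (S ω) (Y n ω)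
              · simpa [memLp_one_iff_integrable] using hint hsumI (2 * (l + 1)) 1
              · exact ((hSI _).add (hp1.const_mul _)).add
                  (((hprodI _ 2).add (hYI _)).const_mul _)
          _ = _ := by
              have i1 := hSI (2 * (l + 1))
              have i2 := hp1.const_mul ((2 * (l + 1) : ℕ) : ℝ)
              have i3 := hprodI (2 * l) 2
              have i4 := hYI (2 * (l + 1))
              have i5 : Integrable (fun ω => (4 : ℝ) ^ (l + 1) *
                (S ω ^ (2 * l) * Y n ω ^ 2 + Y n ω ^ (2 * (l + 1)))) μ := (i3.add i4).const_mul _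
              have i6 : Integrable (fun ω => S ω ^ (2 * (l + 1)) + (2 * (l + 1) : ℕ) *
                (S ω ^ (2 * l + 1) * Y n ω)) μ := i1.add i2
              rw [integral_add i6 i5, integral_add i1 i2, integral_const_mul, hz,
                integral_const_mul, integral_add i3 i4, hprod]
              ring
      have hsumeq : ∀ ω, ∑ i ∈ insert n t, Y i ω = S ω + Y n ω := fun ω => by
        rw [Finset.sum_insert hnt, add_comm]
      simp only [hsumeq]
      refine hstep.trans ?_
      rw [Finset.card_insert_of_notMem hnt]
      have hB2 := hB n hn 1 (by omega)
      have hBl := hB n hn (l + 1) le_rfl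
      simp only [mul_one] at hB2
      have hC := indepSumConst_pos l
      have hBe : 0 ≤ B ^ (2 * l) := (even_two_mul l).pow_nonneg B
      have hBe' : 0 ≤ B ^ (2 * (l + 1)) := (even_two_mul (l + 1)).pow_nonneg B
      have hY2 : 0 ≤ ∫ ω, Y n ω ^ 2 ∂μ := integral_nonneg fun ω => sq_nonneg _
      -- The added `1` gives `m ≥ 1` even for empty `t`, so that the constant term can be absorbed
      -- into `m ^ l`.
      set m : ℝ := (t.card : ℝ) + 1 with hm
      have hm1 : 1 ≤ m := by simp [hm]
      have hmul : (∫ ω, S ω ^ (2 * l) ∂μ) * (∫ ω, Y n ω ^ 2 ∂μ) ≤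
          indepSumConst l * m ^ l * B ^ (2 * (l + 1)) := by
        calc _ ≤ (indepSumConst l * m ^ l * B ^ (2 * l)) * B ^ 2 :=
              mul_le_mul ih2 hB2 hY2 (by positivity)
          _ = _ := by ring
      have hone : 1 ≤ m ^ l := one_le_pow₀ hm1
      -- The recursion for the constants makes the cost of one summand at most `indepSumConst (l +
      -- 1) * m ^ l`, and `m ^ (l + 1) + m ^ l ≤ (m + 1) ^ (l + 1)`.
      have key : indepSumConst (l + 1) * m ^ (l + 1) + 4 ^ (l + 1) *
          (indepSumConst l * m ^ l + 1) ≤ indepSumConst (l + 1) * (m + 1) ^ (l + 1) := by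
        have h1 : indepSumConst l * m ^ l + 1 ≤ (indepSumConst l + 1) * m ^ l := by
          rw [add_mul]; linarith
        have h2 : m ^ (l + 1) + m ^ l ≤ (m + 1) ^ (l + 1) := by
          have : m ^ l ≤ (m + 1) ^ l := by gcongr; linarith
          calc m ^ (l + 1) + m ^ l = (m + 1) * m ^ l := by ring
            _ ≤ (m + 1) * (m + 1) ^ l := by gcongr
            _ = _ := by ring
        have hCl := indepSumConst_pos (l + 1)
        calc _ ≤ indepSumConst (l + 1) * m ^ (l + 1) +
              4 ^ (l + 1) * ((indepSumConst l + 1) * m ^ l) := by gcongr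
          _ = indepSumConst (l + 1) * (m ^ (l + 1) + m ^ l) := by
              simp only [indepSumConst]; ring
          _ ≤ _ := by gcongr
      calc _ ≤ indepSumConst (l + 1) * m ^ (l + 1) * B ^ (2 * (l + 1)) + 4 ^ (l + 1) *
            (indepSumConst l * m ^ l * B ^ (2 * (l + 1)) + B ^ (2 * (l + 1))) := by
            gcongr
        _ = (indepSumConst (l + 1) * m ^ (l + 1) + 4 ^ (l + 1) *
            (indepSumConst l * m ^ l + 1)) * B ^ (2 * (l + 1)) := by ring
        _ ≤ indepSumConst (l + 1) * (m + 1) ^ (l + 1) * B ^ (2 * (l + 1)) := by gcongr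
        _ = _ := by simp [hm]

end IndependentSums

/-! ### Sums of variables that depend on finite windows of the noise -/

section DependentSums

variable {Ω : Type*}

/-- The σ-algebra generated by the variables `e j`, `j ∈ S`. -/
abbrev sigmaOn (e : ℤ → Ω → ℝ) (S : Set ℤ) : MeasurableSpace Ω :=
  ⨆ j ∈ S, MeasurableSpace.comap (e j) inferInstance

lemma sigmaOn_mono (e : ℤ → Ω → ℝ) {S T : Set ℤ} (h : S ⊆ T) : sigmaOn e S ≤ sigmaOn e T :=
  biSup_mono h

lemma measurable_sigmaOn (e : ℤ → Ω → ℝ) {S : Set ℤ} {j : ℤ} (hj : j ∈ S) :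
    Measurable[sigmaOn e S] (e j) :=
  (comap_measurable (e j)).mono (le_iSup₂_of_le j hj le_rfl) le_rfl

variable {mΩ : MeasurableSpace Ω} {μ : Measure Ω}

lemma sigmaOn_le {e : ℤ → Ω → ℝ} (he : ∀ j, Measurable (e j)) (S : Set ℤ) :
    sigmaOn e S ≤ mΩ :=
  iSup₂_le fun j _ => (he j).comap_le

lemma indepFun_of_sigmaOn {e : ℤ → Ω → ℝ} (he : ∀ j, Measurable (e j)) (hind : iIndepFun e μ)
    {S T : Set ℤ} (hST : Disjoint S T) {β γ : Type*} [MeasurableSpace β] [MeasurableSpace γ]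
    {X : Ω → β} {Y : Ω → γ} (hX : Measurable[sigmaOn e S] X) (hY : Measurable[sigmaOn e T] Y) :
    IndepFun X Y μ := by
  have h := indep_iSup_of_disjoint (fun j => (he j).comap_le) hind hST
  exact indep_of_indep_of_le_right (indep_of_indep_of_le_left h hX.comap_le) hY.comap_le

lemma eLpNorm_eq_ofReal_integral_pow {f : Ω → ℝ} {l : ℕ} (hl : 1 ≤ l)
    (hf : MemLp f (2 * l : ℕ) μ) :
    eLpNorm f (2 * l : ℕ) μ =
      ENNReal.ofReal ((∫ ω, f ω ^ (2 * l) ∂μ) ^ (((2 * l : ℕ) : ℝ)⁻¹)) := by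
  rw [hf.eLpNorm_eq_integral_rpow_norm (by positivity)
    (ENNReal.natCast_ne_top _)]
  simp only [ENNReal.toReal_natCast, Real.rpow_natCast, Real.norm_eq_abs,
    (even_two_mul l).pow_abs]

lemma eLpNorm_le_of_integral_pow_le {f : Ω → ℝ} {l : ℕ} (hl : 1 ≤ l)
    (hf : MemLp f (2 * l : ℕ) μ) {a : ℝ} (ha : 0 ≤ a) (h : ∫ ω, f ω ^ (2 * l) ∂μ ≤ a ^ (2 * l)) :
    eLpNorm f (2 * l : ℕ) μ ≤ ENNReal.ofReal a := by
  rw [eLpNorm_eq_ofReal_integral_pow hl hf]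
  refine ENNReal.ofReal_le_ofReal ?_
  rw [Real.rpow_inv_le_iff_of_pos (integral_nonneg fun ω => (even_two_mul l).pow_nonneg _) ha
    (by positivity)]
  exact_mod_cast h

lemma integral_pow_le_of_eLpNorm_le [IsProbabilityMeasure μ] {f : Ω → ℝ} {l j : ℕ} (hj : j ≤ l)
    (hf : MemLp f (2 * l : ℕ) μ) {a : ℝ} (ha : 0 ≤ a)
    (h : eLpNorm f (2 * l : ℕ) μ ≤ ENNReal.ofReal a) :
    ∫ ω, f ω ^ (2 * j) ∂μ ≤ a ^ (2 * j) := by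
  rcases Nat.eq_zero_or_pos j with rfl | hj0
  · simp
  have hle : ((2 * j : ℕ) : ℝ≥0∞) ≤ ((2 * l : ℕ) : ℝ≥0∞) := by
    exact_mod_cast Nat.mul_le_mul_left 2 hj
  have hfj := hf.mono_exponent hle
  have h1 := (eLpNorm_le_eLpNorm_of_exponent_le hle hf.1).trans h
  rw [eLpNorm_eq_ofReal_integral_pow hj0 hfj, ENNReal.ofReal_le_ofReal_iff ha,
    Real.rpow_inv_le_iff_of_pos (integral_nonneg fun ω => (even_two_mul j).pow_nonneg _) ha
    (by positivity)] at h1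
  exact_mod_cast h1

/-- A moment inequality for sums of centred variables, each of which depends on the noise only
through a window of length `k`. -/
lemma eLpNorm_sum_le_of_window [IsProbabilityMeasure μ] {e : ℤ → Ω → ℝ}
    (he : ∀ j, Measurable (e j)) (hind : iIndepFun e μ) {l : ℕ} (hl : 1 ≤ l) (Y : ℕ → Ω → ℝ)
    {k : ℕ} (hk : 1 ≤ k)
    (hYm : ∀ n : ℕ, Measurable[sigmaOn e (Set.Ioc ((n : ℤ) - k) n)] (Y n))
    (hY : ∀ n, ∀ j : ℕ, MemLp (Y n) j μ) (h0 : ∀ n, ∫ ω, Y n ω ∂μ = 0) {B : ℝ} (hB0 : 0 ≤ B)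
    (hB : ∀ n, eLpNorm (Y n) (2 * l : ℕ) μ ≤ ENNReal.ofReal B) (s : Finset ℕ) :
    eLpNorm (fun ω => ∑ n ∈ s, Y n ω) (2 * l : ℕ) μ ≤
      ENNReal.ofReal (k * (max 1 (indepSumConst l) * √(s.card + 1) * B)) := by
  have hY' : ∀ t : Finset ℕ, MemLp (fun ω => ∑ n ∈ t, Y n ω) (2 * l : ℕ) μ := fun t =>
    memLp_finsetSum t fun n _ => hY n _
  -- Within one residue class modulo `k` the windows are disjoint, so the summands are independent.
  -- Minkowski's inequality over the `k` classes then produces the factor `k`.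
  have hclass : ∀ r ∈ Finset.range k, eLpNorm (fun ω => ∑ n ∈ s with n % k = r, Y n ω)
      (2 * l : ℕ) μ ≤ ENNReal.ofReal (max 1 (indepSumConst l) * √(s.card + 1) * B) := by
    intro r _
    refine eLpNorm_le_of_integral_pow_le hl (hY' _) (by positivity) ?_
    refine (integral_sum_pow_even_le Y _ (fun n _ j => hY n j) (fun n _ => h0 n) ?_ (B := B) l
      fun n _ j hj => integral_pow_le_of_eLpNorm_le hj (hY n _) hB0 (hB n)).trans ?_
    · intro n hn t ht hlt
      have hn' : n % k = r := (Finset.mem_filter.1 hn).2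
      refine indepFun_of_sigmaOn he hind (S := Set.Iic ((n : ℤ) - k))
        (T := Set.Ioc ((n : ℤ) - k) n) ?_ ?_ (hYm n)
      · rw [Set.disjoint_left]
        intro x hx hx'
        exact not_lt.2 hx hx'.1
      · refine Finset.measurable_fun_sum t fun i hi => ?_
        have hi' : i % k = r := (Finset.mem_filter.1 (ht hi)).2
        have hik : i + k ≤ n := by
          have h1 : k ∣ n - i := (Nat.modEq_iff_dvd' (hlt i hi).le).1 (hi'.trans hn'.symm)
          have h2 := Nat.le_of_dvd (Nat.sub_pos_of_lt (hlt i hi)) h1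
          omega
        refine (hYm i).mono (sigmaOn_mono e fun x hx => ?_) le_rfl
        have := hx.2
        simp only [Set.mem_Iic]
        omega
    · have hC := indepSumConst_pos l
      have hcard : (((s.filter fun n => n % k = r).card : ℝ) + 1) ≤ (s.card : ℝ) + 1 := by
        have := Finset.card_filter_le s fun n => n % k = r
        have : ((s.filter fun n => n % k = r).card : ℝ) ≤ s.card := by exact_mod_cast this
        linarith
      rw [mul_pow, mul_pow]
      gcongr ?_ * ?_ * _
      -- Replacing the constant by its maximum with `1` avoids taking a `2 l`-th root of it.
      · calc indepSumConst l ≤ max 1 (indepSumConst l) := le_max_right _ _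
          _ ≤ max 1 (indepSumConst l) ^ (2 * l) := le_self_pow₀ (le_max_left _ _) (by omega)
      · rw [pow_mul, Real.sq_sqrt (by positivity)]
        gcongr
  have hsplit : (fun ω => ∑ n ∈ s, Y n ω) =
      ∑ r ∈ Finset.range k, fun ω => ∑ n ∈ s with n % k = r, Y n ω := by
    ext ω
    rw [Finset.sum_apply]
    exact (Finset.sum_fiberwise_of_maps_to
      (fun n _ => Finset.mem_range.2 (Nat.mod_lt n hk)) _).symm
  rw [hsplit]
  refine (eLpNorm_sum_le (fun r _ => (hY' _).1) (by exact_mod_cast (by omega : 1 ≤ 2 * l))).trans ?_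
  refine (Finset.sum_le_sum hclass).trans ?_
  rw [Finset.sum_const, Finset.card_range, nsmul_eq_mul,
    ENNReal.ofReal_mul (p := (k : ℝ)) (by positivity), ENNReal.ofReal_natCast]

end DependentSums

/-! ### Locally Lipschitz functions of polynomial growth -/

section PolyLipschitz

variable {F W W' : Type*} [NormedAddCommGroup F] [NormedAddCommGroup W] [NormedAddCommGroup W']

/-- Functions that are Lipschitz on balls, with constants growing polynomially in the radius. -/
def PolyLipschitz (G : F → W) : Prop :=
  ∃ (C : ℝ) (r : ℕ), 0 ≤ C ∧ ∀ x y, ‖G x - G y‖ ≤ C * ‖x - y‖ * (1 + ‖x‖ + ‖y‖) ^ r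

namespace PolyLipschitz

variable {G : F → W}

lemma continuous (hG : PolyLipschitz G) : Continuous G := by
  obtain ⟨C, r, hC, h⟩ := hG
  refine continuous_iff_continuousAt.2 fun x => ?_
  rw [ContinuousAt, tendsto_iff_norm_sub_tendsto_zero]
  have hlim : Tendsto (fun y => C * ‖y - x‖ * (1 + ‖y‖ + ‖x‖) ^ r) (𝓝 x) (𝓝 0) := by
    have : Continuous fun y => C * ‖y - x‖ * (1 + ‖y‖ + ‖x‖) ^ r := by fun_prop
    simpa using this.tendsto x
  exact squeeze_zero (fun y => norm_nonneg _) (fun y => h y x) hlim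

lemma growth (hG : PolyLipschitz G) :
    ∃ (C : ℝ) (r : ℕ), 0 ≤ C ∧ ∀ x, ‖G x‖ ≤ C * (1 + ‖x‖) ^ r := by
  obtain ⟨C, r, hC, h⟩ := hG
  refine ⟨C + ‖G 0‖, r + 1, by positivity, fun x => ?_⟩
  have h1 := h x 0
  simp only [sub_zero, norm_zero, add_zero] at h1
  have h2 : ‖G x‖ ≤ ‖G x - G 0‖ + ‖G 0‖ := by simpa using norm_add_le (G x - G 0) (G 0)
  have h3 : ‖x‖ ≤ 1 + ‖x‖ := by linarith [norm_nonneg x]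
  have h4 : 1 ≤ (1 + ‖x‖) ^ (r + 1) := one_le_pow₀ (by linarith [norm_nonneg x])
  calc ‖G x‖ ≤ C * ‖x‖ * (1 + ‖x‖) ^ r + ‖G 0‖ := h2.trans (by linarith)
    _ ≤ C * (1 + ‖x‖) * (1 + ‖x‖) ^ r + ‖G 0‖ * (1 + ‖x‖) ^ (r + 1) := by
        gcongr
        exact le_mul_of_one_le_right (norm_nonneg _) h4
    _ = _ := by ring

lemma const (w : W) : PolyLipschitz (fun _ : F => w) := ⟨0, 0, le_rfl, fun x y => by simp⟩

lemma of_lipschitz {C : ℝ} (hC : 0 ≤ C) (h : ∀ x y, ‖G x - G y‖ ≤ C * ‖x - y‖) :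
    PolyLipschitz G := ⟨C, 0, hC, fun x y => by simpa using h x y⟩

lemma add {G' : F → W} (hG : PolyLipschitz G) (hG' : PolyLipschitz G') :
    PolyLipschitz (fun x => G x + G' x) := by
  obtain ⟨C, r, hC, h⟩ := hG
  obtain ⟨C', r', hC', h'⟩ := hG'
  refine ⟨C + C', r + r', by positivity, fun x y => ?_⟩
  have h1 : 1 ≤ 1 + ‖x‖ + ‖y‖ := by linarith [norm_nonneg x, norm_nonneg y]
  calc ‖G x + G' x - (G y + G' y)‖ = ‖(G x - G y) + (G' x - G' y)‖ := by congr 1; abel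
    _ ≤ C * ‖x - y‖ * (1 + ‖x‖ + ‖y‖) ^ r + C' * ‖x - y‖ * (1 + ‖x‖ + ‖y‖) ^ r' :=
        (norm_add_le _ _).trans (add_le_add (h x y) (h' x y))
    _ ≤ C * ‖x - y‖ * (1 + ‖x‖ + ‖y‖) ^ (r + r') + C' * ‖x - y‖ * (1 + ‖x‖ + ‖y‖) ^ (r + r') := by
        gcongr <;> first | exact h1 | omega
    _ = _ := by ring

lemma clm_comp [NormedSpace ℝ W] [NormedSpace ℝ W'] (L : W →L[ℝ] W') (hG : PolyLipschitz G) :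
    PolyLipschitz (fun x => L (G x)) := by
  obtain ⟨C, r, hC, h⟩ := hG
  refine ⟨‖L‖ * C, r, by positivity, fun x y => ?_⟩
  rw [← map_sub]
  calc _ ≤ ‖L‖ * ‖G x - G y‖ := L.le_opNorm _
    _ ≤ ‖L‖ * (C * ‖x - y‖ * (1 + ‖x‖ + ‖y‖) ^ r) := by gcongr; exact h x y
    _ = _ := by ring

lemma clm [NormedSpace ℝ F] [NormedSpace ℝ W] (L : F →L[ℝ] W) : PolyLipschitz (fun x => L x) :=
  of_lipschitz (norm_nonneg L) fun x y => by rw [← map_sub]; exact L.le_opNorm _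

lemma smul {𝕜 : Type*} [NormedField 𝕜] [NormedSpace 𝕜 W] {a : F → 𝕜} (ha : PolyLipschitz a)
    (hG : PolyLipschitz G) : PolyLipschitz (fun x => a x • G x) := by
  obtain ⟨A, s, hA, hga⟩ := ha.growth
  obtain ⟨B, t, hB, hgG⟩ := hG.growth
  obtain ⟨C, r, hC, h⟩ := hG
  obtain ⟨C', r', hC', h'⟩ := ha
  refine ⟨A * C + C' * B, r + r' + s + t, by positivity, fun x y => ?_⟩
  have h1 : 1 ≤ 1 + ‖x‖ + ‖y‖ := by linarith [norm_nonneg x, norm_nonneg y]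
  have hx : 1 + ‖x‖ ≤ 1 + ‖x‖ + ‖y‖ := by linarith [norm_nonneg y]
  have hy : 1 + ‖y‖ ≤ 1 + ‖x‖ + ‖y‖ := by linarith [norm_nonneg x]
  set z := 1 + ‖x‖ + ‖y‖
  calc ‖a x • G x - a y • G y‖ = ‖a x • (G x - G y) + (a x - a y) • G y‖ := by
        congr 1; rw [smul_sub, sub_smul]; abel
    _ ≤ ‖a x‖ * ‖G x - G y‖ + ‖a x - a y‖ * ‖G y‖ := by
        refine (norm_add_le _ _).trans (le_of_eq ?_); rw [norm_smul, norm_smul]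
    _ ≤ (A * (1 + ‖x‖) ^ s) * (C * ‖x - y‖ * z ^ r) +
          (C' * ‖x - y‖ * z ^ r') * (B * (1 + ‖y‖) ^ t) := by
        gcongr
        exacts [hga x, h x y, h' x y, hgG y]
    _ ≤ (A * z ^ s) * (C * ‖x - y‖ * z ^ r) + (C' * ‖x - y‖ * z ^ r') * (B * z ^ t) := by
        gcongr
    _ = A * C * ‖x - y‖ * z ^ (s + r) + C' * B * ‖x - y‖ * z ^ (r' + t) := by ring
    _ ≤ A * C * ‖x - y‖ * z ^ (r + r' + s + t) + C' * B * ‖x - y‖ * z ^ (r + r' + s + t) := by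
        refine add_le_add ?_ ?_ <;>
          exact mul_le_mul_of_nonneg_left (pow_le_pow_right₀ h1 (by omega)) (by positivity)
    _ = _ := by ring

lemma pow {a : F → ℝ} (ha : PolyLipschitz a) (n : ℕ) : PolyLipschitz (fun x => a x ^ n) := by
  induction n with
  | zero => simpa using const (F := F) (1 : ℝ)
  | succ n ih => simpa [pow_succ] using ih.smul ha

lemma norm_comp (hG : PolyLipschitz G) : PolyLipschitz (fun x => ‖G x‖) := by
  obtain ⟨C, r, hC, h⟩ := hG
  exact ⟨C, r, hC, fun x y => (abs_norm_sub_norm_le _ _).trans (h x y)⟩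

lemma pi {ι : Type*} [Fintype ι] {H : ι → F → W} (h : ∀ i, PolyLipschitz (H i)) :
    PolyLipschitz (fun x i => H i x) := by
  choose C r hC hH using h
  refine ⟨∑ i, C i, ∑ i, r i, Finset.sum_nonneg fun i _ => hC i, fun x y => ?_⟩
  have h1 : 1 ≤ 1 + ‖x‖ + ‖y‖ := by linarith [norm_nonneg x, norm_nonneg y]
  have h0 : 0 ≤ ∑ i, C i := Finset.sum_nonneg fun i _ => hC i
  refine (pi_norm_le_iff_of_nonneg (by positivity)).2 fun i => (hH i x y).trans ?_
  gcongr
  · exact Finset.single_le_sum (f := C) (fun i _ => hC i) (Finset.mem_univ i)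
  · exact Finset.single_le_sum (f := r) (fun i _ => Nat.zero_le _) (Finset.mem_univ i)

end PolyLipschitz

end PolyLipschitz

/-! ### Linear processes, their truncations and a common envelope -/

section LinearProcess

variable {Ω : Type*}

/-- The exponentially weighted sum of the absolute values of the past. -/
def envelope (ρ : ℝ) (e : ℤ → Ω → ℝ) (n : ℤ) (ω : Ω) : ℝ := ∑' i : ℕ, |ρ ^ i * e (n - i) ω|

lemma envelope_nonneg (ρ : ℝ) (e : ℤ → Ω → ℝ) (n : ℤ) (ω : Ω) : 0 ≤ envelope ρ e n ω :=
  tsum_nonneg fun _ => abs_nonneg _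

variable {e : ℤ → Ω → ℝ} {ρ : ℝ}
variable {F : Type*} [NormedAddCommGroup F] [NormedSpace ℝ F]

/-- The linear process with coefficients `c i`. -/
def linProc (e : ℤ → Ω → ℝ) (c : ℕ → F) (n : ℤ) (ω : Ω) : F := ∑' i : ℕ, e (n - i) ω • c i

/-- The linear process cut off after `m` terms. -/
def linProcCut (e : ℤ → Ω → ℝ) (c : ℕ → F) (m : ℕ) (n : ℤ) (ω : Ω) : F :=
  ∑ i ∈ Finset.range m, e (n - i) ω • c i

variable {c : ℕ → F} {C : ℝ}

lemma norm_smul_coeff_le (hc : ∀ i, ‖c i‖ ≤ C * ρ ^ i) (h0 : 0 < ρ) (n : ℤ) (ω : Ω) (i : ℕ) :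
    ‖e (n - i) ω • c i‖ ≤ C * |ρ ^ i * e (n - i) ω| := by
  rw [norm_smul, Real.norm_eq_abs, abs_mul, abs_of_pos (pow_pos h0 i)]
  calc |e (n - i) ω| * ‖c i‖ ≤ |e (n - i) ω| * (C * ρ ^ i) := by gcongr; exact hc i
    _ = _ := by ring

lemma norm_linProcCut_le (hc : ∀ i, ‖c i‖ ≤ C * ρ ^ i) (hC : 0 ≤ C) (h0 : 0 < ρ) {n : ℤ} {ω : Ω}
    (hs : Summable fun i : ℕ => |ρ ^ i * e (n - i) ω|) (m : ℕ) :
    ‖linProcCut e c m n ω‖ ≤ C * envelope ρ e n ω := by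
  refine (norm_sum_le _ _).trans ((Finset.sum_le_sum fun i _ =>
    norm_smul_coeff_le hc h0 n ω i).trans ?_)
  rw [← Finset.mul_sum]
  exact mul_le_mul_of_nonneg_left (hs.sum_le_tsum _ fun i _ => abs_nonneg _) hC

lemma summable_linProc [CompleteSpace F] (hc : ∀ i, ‖c i‖ ≤ C * ρ ^ i) (h0 : 0 < ρ) {n : ℤ}
    {ω : Ω} (hs : Summable fun i : ℕ => |ρ ^ i * e (n - i) ω|) :
    Summable fun i : ℕ => e (n - i) ω • c i :=
  Summable.of_norm_bounded (hs.mul_left C) fun i => norm_smul_coeff_le hc h0 n ω i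

lemma norm_linProc_le [CompleteSpace F] (hc : ∀ i, ‖c i‖ ≤ C * ρ ^ i) (h0 : 0 < ρ) {n : ℤ} {ω : Ω}
    (hs : Summable fun i : ℕ => |ρ ^ i * e (n - i) ω|) :
    ‖linProc e c n ω‖ ≤ C * envelope ρ e n ω :=
  tsum_of_norm_bounded (hs.hasSum.mul_left C) fun i => norm_smul_coeff_le hc h0 n ω i

/-- The tail is a linear process in the noise up to time `n - m`, with coefficients that carry an
extra factor `ρ ^ m`. -/
lemma norm_linProc_sub_cut_le [CompleteSpace F] (hc : ∀ i, ‖c i‖ ≤ C * ρ ^ i) (h0 : 0 < ρ)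
    {n : ℤ} {ω : Ω} (hs : ∀ n : ℤ, Summable fun i : ℕ => |ρ ^ i * e (n - i) ω|) (m : ℕ) :
    ‖linProc e c n ω - linProcCut e c m n ω‖ ≤ C * (ρ ^ m * envelope ρ e (n - m) ω) := by
  have h1 := (summable_linProc hc h0 (hs n)).sum_add_tsum_nat_add m
  have h2 : linProc e c n ω - linProcCut e c m n ω =
      ∑' i : ℕ, e (n - ((i + m : ℕ) : ℤ)) ω • c (i + m) := by
    rw [linProc, linProcCut, ← h1]; abel
  rw [h2, envelope, ← tsum_mul_left]
  refine tsum_of_norm_bounded (((hs (n - m)).mul_left (ρ ^ m)).hasSum.mul_left C) fun i => ?_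
  refine (norm_smul_coeff_le hc h0 n ω (i + m)).trans (le_of_eq ?_)
  have : n - ((i + m : ℕ) : ℤ) = n - m - i := by push_cast; ring
  rw [this, pow_add, mul_comm (ρ ^ i), mul_assoc, abs_mul (ρ ^ m), abs_of_pos (pow_pos h0 m)]

end LinearProcess

/-! ### Noise sequences -/

section Noise

variable {Ω : Type*} [MeasurableSpace Ω] {μ : Measure Ω}

lemma MomentBounded.weight {ι : Type*} {X : ι → Ω → ℝ} {f : ι → ℝ} (h : MomentBounded μ X f)
    (w : ι → ℝ) : MomentBounded μ (fun i ω => w i * X i ω) (fun i => |w i| * f i) := by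
  intro k hk
  obtain ⟨C, hC, H⟩ := h k hk
  refine ⟨C, hC, fun i => ?_⟩
  obtain ⟨g, hm, hg, hn⟩ := H i
  refine ⟨fun ω => |w i| * g ω, hm.const_mul _, ?_, ?_⟩
  · filter_upwards [hg] with ω h1
    rw [abs_mul]
    exact mul_le_mul_of_nonneg_left h1 (abs_nonneg _)
  · have := eLpNorm_const_smul (|w i|) g (k : ℝ≥0∞) μ
    simp only [Pi.smul_def, smul_eq_mul] at this
    rw [this, mul_left_comm, ENNReal.ofReal_mul (abs_nonneg _), Real.enorm_eq_ofReal_abs, abs_abs]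
    gcongr

lemma MomentBounded.of_const_le [IsProbabilityMeasure μ] {ι : Type*} {c f : ι → ℝ} {C : ℝ}
    (hC : 0 ≤ C) (h : ∀ i, |c i| ≤ C * f i) : MomentBounded μ (fun i (_ : Ω) => c i) f := by
  have h1 := ((MomentBounded.const (μ := μ) (ι := ι) 1).weight c).mono_right hC (g := f)
    fun i => by simpa using h i
  simpa using h1

lemma MomentBounded.integral [IsProbabilityMeasure μ] {ι : Type*} {X : ι → Ω → ℝ} {f : ι → ℝ}
    (h : MomentBounded μ X f) (hf : ∀ i, 0 ≤ f i) :
    MomentBounded μ (fun i (_ : Ω) => ∫ ω, X i ω ∂μ) f := by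
  obtain ⟨C, hC, H⟩ := h.integral_abs_le hf
  exact MomentBounded.of_const_le hC fun i => (abs_integral_le_integral_abs).trans (H i)

/-- Independent identically distributed variables with finite moments. -/
structure IsNoise (μ : Measure Ω) (e : ℤ → Ω → ℝ) : Prop where
  measurable : ∀ n, Measurable (e n)
  indep : iIndepFun e μ
  ident : ∀ n, IdentDistrib (e n) (e 0) μ μ
  moments : MomentBounded μ e (fun _ => 1)

variable {e : ℤ → Ω → ℝ} {ρ : ℝ}

lemma MomentBounded.envelope (h : MomentBounded μ e (fun _ => 1)) (h0 : 0 < ρ) (h1 : ρ < 1) :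
    (∀ᵐ ω ∂μ, ∀ n : ℤ, Summable fun i : ℕ => |ρ ^ i * e (n - i) ω|) ∧
      MomentBounded μ (envelope ρ e) (fun _ => 1) := by
  have hX : MomentBounded μ (fun (p : ℤ × ℕ) ω => ρ ^ p.2 * e (p.1 - p.2) ω)
      (fun p => ρ ^ p.2) := by
    have := (h.comp fun p : ℤ × ℕ => p.1 - p.2).weight fun p => ρ ^ p.2
    simpa [abs_of_pos h0] using this
  have := MomentBounded.tsum (X := fun (n : ℤ) (i : ℕ) ω => ρ ^ i * e (n - i) ω)
    (a := fun i => ρ ^ i) (fun i => by positivity) (summable_geometric_of_lt_one h0.le h1) hX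
  exact ⟨ae_all_iff.2 this.1, this.2⟩

end Noise

/-! ### Functions of linear processes: approximation, stationarity, centred sums -/

section LinearProcessMoments

variable {Ω : Type*} {e : ℤ → Ω → ℝ} {ρ : ℝ}
  {F : Type*} [NormedAddCommGroup F] [NormedSpace ℝ F] {c : ℕ → F} {C : ℝ}
  {W : Type*} [NormedAddCommGroup W] {G : F → W}

lemma linProcCut_eq_comp (e : ℤ → Ω → ℝ) (c : ℕ → F) (m : ℕ) (n : ℤ) :
    linProcCut e c m n =
      (fun x : Fin m → ℝ => ∑ i : Fin m, x i • c i) ∘ fun ω (i : Fin m) => e (n - (i : ℕ)) ω := by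
  ext ω
  simp [linProcCut, Finset.sum_range]

lemma measurable_comp_linProcCut (hG : Continuous G) (e : ℤ → Ω → ℝ) (c : ℕ → F) (m : ℕ) (n : ℤ) :
    StronglyMeasurable[sigmaOn e (Set.Ioc (n - m) n)] fun ω => G (linProcCut e c m n ω) := by
  have h1 : Continuous fun x : Fin m → ℝ => G (∑ i : Fin m, x i • c i) := by fun_prop
  have h2 : Measurable[sigmaOn e (Set.Ioc (n - m) n)]
      fun ω (i : Fin m) => e (n - (i : ℕ)) ω := by
    refine @measurable_pi_lambda _ _ _ (sigmaOn e _) _ _ fun i => measurable_sigmaOn e ?_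
    have := i.2
    exact ⟨by omega, by omega⟩
  have h3 := h1.comp_stronglyMeasurable h2.stronglyMeasurable
  rw [linProcCut_eq_comp]
  exact h3

variable {mΩ : MeasurableSpace Ω} {μ : Measure Ω}

lemma IsNoise.aestronglyMeasurable_comp_linProcCut (he : IsNoise μ e) (hG : Continuous G) (m : ℕ)
    (n : ℤ) : AEStronglyMeasurable (fun ω => G (linProcCut e c m n ω)) μ :=
  ((measurable_comp_linProcCut hG e c m n).mono
    (sigmaOn_le he.measurable _)).aestronglyMeasurable

lemma IsNoise.aestronglyMeasurable_comp_linProc [CompleteSpace F] (he : IsNoise μ e) (h0 : 0 < ρ)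
    (h1 : ρ < 1)
    (hc : ∀ i, ‖c i‖ ≤ C * ρ ^ i) (hG : Continuous G) (n : ℤ) :
    AEStronglyMeasurable (fun ω => G (linProc e c n ω)) μ := by
  refine aestronglyMeasurable_of_tendsto_ae atTop
    (fun m => he.aestronglyMeasurable_comp_linProcCut (c := c) hG m n) ?_
  filter_upwards [(he.moments.envelope h0 h1).1] with ω hs
  exact (hG.tendsto _).comp (summable_linProc hc h0 (hs n)).hasSum.tendsto_sum_nat

variable [IsProbabilityMeasure μ]

/-- Every block of `m` consecutive noise variables has the same product law. -/
lemma IsNoise.integral_comp_linProcCut [NormedSpace ℝ W] (he : IsNoise μ e) (hG : Continuous G)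
    (m : ℕ) (n n' : ℤ) :
    ∫ ω, G (linProcCut e c m n ω) ∂μ = ∫ ω, G (linProcCut e c m n' ω) ∂μ := by
  have hlaw : ∀ n : ℤ, μ.map (fun ω (i : Fin m) => e (n - (i : ℕ)) ω) =
      Measure.pi fun _ => μ.map (e 0) := by
    intro n
    have hinj : Function.Injective fun i : Fin m => n - ((i : ℕ) : ℤ) := by
      intro i j hij
      simp only [sub_right_inj, Nat.cast_inj] at hij
      exact Fin.ext hij
    have h1 := (iIndepFun_iff_map_fun_eq_pi_map fun i : Fin m =>
      (he.measurable (n - (i : ℕ))).aemeasurable).1 (he.indep.precomp hinj)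
    rw [h1]
    congr 1
    ext1 i
    exact (he.ident _).map_eq
  have hcont : Continuous fun x : Fin m → ℝ => G (∑ i : Fin m, x i • c i) := by fun_prop
  have key : ∀ n : ℤ, ∫ ω, G (linProcCut e c m n ω) ∂μ =
      ∫ x, G (∑ i : Fin m, x i • c i) ∂(Measure.pi fun _ : Fin m => μ.map (e 0)) := by
    intro n
    rw [← hlaw n, integral_map
      (measurable_pi_lambda _ fun i => he.measurable _).aemeasurable
      hcont.aestronglyMeasurable]
    simp only [linProcCut_eq_comp, Function.comp_apply]
  rw [key n, key n']

variable [CompleteSpace F]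

/-- The truncation error is `ρ ^ m` times an envelope; the local Lipschitz constant of `G` is
polynomial in another envelope, and products of such factors keep bounded moments. -/
lemma IsNoise.momentBounded_linProc_sub_cut (he : IsNoise μ e) (h0 : 0 < ρ) (h1 : ρ < 1)
    (hC : 0 ≤ C) (hc : ∀ i, ‖c i‖ ≤ C * ρ ^ i) (hG : PolyLipschitz G) :
    MomentBounded μ (fun (p : ℕ × ℤ) ω => ‖G (linProc e c p.2 ω) - G (linProcCut e c p.1 p.2 ω)‖)
      (fun p => ρ ^ p.1) := by
  obtain ⟨K, r, hK, hlip⟩ := hG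
  obtain ⟨hs, henv⟩ := he.moments.envelope h0 h1
  have hA : MomentBounded μ (fun (p : ℕ × ℤ) ω =>
      (1 + 2 * C * envelope ρ e p.2 ω) ^ r) (fun _ => 1) := by
    have := ((MomentBounded.const (μ := μ) (ι := ℕ × ℤ) 1).add
      ((henv.comp fun p : ℕ × ℤ => p.2).const_mul (2 * C)) fun _ => zero_le_one).pow
      (fun _ => zero_le_one) r
    simpa using this
  have hB := ((henv.comp fun p : ℕ × ℤ => p.2 - p.1).mul hA fun _ => zero_le_one).weight
    fun p => K * C * ρ ^ p.1
  have hB' := hB.mono_right (g := fun p => ρ ^ p.1) (c := K * C) (by positivity)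
    fun p => by rw [abs_of_nonneg (by positivity)]; simp
  refine hB'.mono_ae fun p => ?_
  filter_upwards [hs] with ω hω
  have e0 := envelope_nonneg ρ e p.2 ω
  have e1 := envelope_nonneg ρ e (p.2 - p.1) ω
  rw [abs_of_nonneg (norm_nonneg _), abs_of_nonneg (by positivity)]
  have b1 := norm_linProc_le hc h0 (hω p.2)
  have b2 := norm_linProcCut_le hc hC h0 (hω p.2) p.1
  have b3 := norm_linProc_sub_cut_le hc h0 hω p.1 (n := p.2)
  refine (hlip _ _).trans ?_
  calc _ ≤ K * (C * (ρ ^ p.1 * envelope ρ e (p.2 - p.1) ω)) *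
        (1 + C * envelope ρ e p.2 ω + C * envelope ρ e p.2 ω) ^ r := by gcongr
    _ = _ := by ring

lemma IsNoise.momentBounded_comp_linProc (he : IsNoise μ e) (h0 : 0 < ρ) (h1 : ρ < 1)
    (hC : 0 ≤ C) (hc : ∀ i, ‖c i‖ ≤ C * ρ ^ i) (hG : PolyLipschitz G) :
    MomentBounded μ (fun (n : ℤ) ω => ‖G (linProc e c n ω)‖) (fun _ => 1) := by
  -- Cutting off after `0` terms leaves `0`, so this controls the distance of `G (linProc e c n ω)`
  -- from the constant `G 0`.
  have hR := (he.momentBounded_linProc_sub_cut h0 h1 hC hc hG).comp fun n : ℤ => (0, n)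
  have hsum := hR.add ((MomentBounded.const (μ := μ) (ι := ℤ) ‖G 0‖).mono_right zero_le_one
    fun n => by simp) fun n => by simp
  refine (hsum.mono_right zero_le_one fun n => by simp).mono fun n ω => ?_
  rw [abs_of_nonneg (norm_nonneg _), abs_of_nonneg (by positivity)]
  have : linProcCut e c 0 n ω = 0 := by simp [linProcCut]
  rw [this]
  simpa using norm_add_le (G (linProc e c n ω) - G 0) (G 0)

lemma IsNoise.integrable_comp_linProc (he : IsNoise μ e) (h0 : 0 < ρ) (h1 : ρ < 1)
    (hC : 0 ≤ C) (hc : ∀ i, ‖c i‖ ≤ C * ρ ^ i) (hG : PolyLipschitz G) (n : ℤ) :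
    Integrable (fun ω => G (linProc e c n ω)) μ := by
  have hm := he.aestronglyMeasurable_comp_linProc h0 h1 hc hG.continuous n
  exact (integrable_norm_iff hm).1
    ((he.momentBounded_comp_linProc h0 h1 hC hc hG).integrable (i := n) hm.norm)

lemma IsNoise.integrable_comp_linProcCut (he : IsNoise μ e) (h0 : 0 < ρ) (h1 : ρ < 1)
    (hC : 0 ≤ C) (hc : ∀ i, ‖c i‖ ≤ C * ρ ^ i) (hG : PolyLipschitz G) (m : ℕ) (n : ℤ) :
    Integrable (fun ω => G (linProcCut e c m n ω)) μ := by
  have hm := he.aestronglyMeasurable_comp_linProc h0 h1 hc hG.continuous n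
  have hm' := he.aestronglyMeasurable_comp_linProcCut (c := c) hG.continuous m n
  have h2 := (integrable_norm_iff (hm.sub hm')).1
    ((he.momentBounded_linProc_sub_cut h0 h1 hC hc hG).integrable (i := (m, n)) (hm.sub hm').norm)
  have := (he.integrable_comp_linProc h0 h1 hC hc hG n).sub h2
  simpa using this

/-- Stationarity of functions of a linear process. -/
lemma IsNoise.integral_comp_linProc [NormedSpace ℝ W] (he : IsNoise μ e) (h0 : 0 < ρ) (h1 : ρ < 1)
    (hC : 0 ≤ C) (hc : ∀ i, ‖c i‖ ≤ C * ρ ^ i) (hG : PolyLipschitz G) (n n' : ℤ) :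
    ∫ ω, G (linProc e c n ω) ∂μ = ∫ ω, G (linProc e c n' ω) ∂μ := by
  obtain ⟨K, hK, hb⟩ :=
    (he.momentBounded_linProc_sub_cut h0 h1 hC hc hG).integral_abs_le fun p => by positivity
  have hlim : ∀ n : ℤ, Tendsto (fun m : ℕ => ∫ ω, G (linProcCut e c m n ω) ∂μ) atTop
      (𝓝 (∫ ω, G (linProc e c n ω) ∂μ)) := by
    intro n
    rw [tendsto_iff_norm_sub_tendsto_zero]
    refine squeeze_zero (g := fun m => K * ρ ^ m) (fun m => norm_nonneg _) (fun m => ?_) ?_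
    · rw [norm_sub_rev, ← integral_sub (he.integrable_comp_linProc h0 h1 hC hc hG n)
        (he.integrable_comp_linProcCut h0 h1 hC hc hG m n)]
      refine (norm_integral_le_integral_norm _).trans ?_
      simpa using hb (m, n)
    · simpa using (tendsto_pow_atTop_nhds_zero_of_lt_one h0.le h1).const_mul K
  refine tendsto_nhds_unique (hlim n) ?_
  simp_rw [he.integral_comp_linProcCut hG.continuous _ n n']
  exact hlim n'

/-- The moments of centred sums of functions of a linear process. -/
lemma IsNoise.momentBounded_sum_linProc {G : F → ℝ} (he : IsNoise μ e) (h0 : 0 < ρ) (h1 : ρ < 1)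
    (hC : 0 ≤ C) (hc : ∀ i, ‖c i‖ ≤ C * ρ ^ i) (hG : PolyLipschitz G) :
    MomentBounded μ (fun (s : Finset ℕ) ω =>
      ∑ n ∈ s, (G (linProc e c n ω) - ∫ ω', G (linProc e c 0 ω') ∂μ))
      (fun s => √(s.card + 1)) := by
  have hGc := hG.continuous
  have hIX := he.integrable_comp_linProc h0 h1 hC hc hG
  have hIT := he.integrable_comp_linProcCut h0 h1 hC hc hG
  -- remainders, differences and their centred versions
  let R : ℕ × ℕ → Ω → ℝ := fun p ω =>
    (G (linProc e c p.2 ω) - G (linProcCut e c p.1 p.2 ω)) -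
      ∫ ω', (G (linProc e c p.2 ω') - G (linProcCut e c p.1 p.2 ω')) ∂μ
  have hR0 : MomentBounded μ (fun (p : ℕ × ℕ) ω =>
      G (linProc e c p.2 ω) - G (linProcCut e c p.1 p.2 ω)) (fun p => ρ ^ p.1) :=
    ((he.momentBounded_linProc_sub_cut h0 h1 hC hc hG).comp
      fun p : ℕ × ℕ => (p.1, (p.2 : ℤ))).mono fun p ω => by simp
  have hpow : ∀ p : ℕ × ℕ, 0 ≤ ρ ^ p.1 := fun p => by positivity
  have hR : MomentBounded μ R (fun p => ρ ^ p.1) := by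
    have := hR0.add ((hR0.integral hpow).const_mul (-1)) hpow
    simpa [R, sub_eq_add_neg] using this
  have hRm : ∀ p, AEStronglyMeasurable (R p) μ := fun p =>
    (((hIX p.2).sub (hIT p.1 p.2)).sub (integrable_const _)).1
  -- `Y (m, n)` is the centred change when the cut moves from `m` to `m + 1`. It is of order `ρ ^ m`
  -- and depends on a window of length `m + 1`, so the sums over `n` have norms of order `(m + 1) ρ
  -- ^ m √(card s + 1)`, which are summable in `m`.
  let Y : ℕ × ℕ → Ω → ℝ := fun p ω => R p ω - R (p.1 + 1, p.2) ω
  have hY : MomentBounded μ Y (fun p => ρ ^ p.1) := by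
    have h2 := (hR.comp fun p : ℕ × ℕ => (p.1 + 1, p.2)).mono_right (g := fun p => ρ ^ p.1)
      zero_le_one fun p => by
        rw [one_mul]; exact pow_le_pow_of_le_one h0.le h1.le (Nat.le_succ _)
    have := hR.add (h2.const_mul (-1)) hpow
    simpa [Y, sub_eq_add_neg] using this
  have hYm : ∀ p, AEStronglyMeasurable (Y p) μ := fun p => (hRm p).sub (hRm _)
  have hYeq : ∀ p ω, Y p ω = G (linProcCut e c (p.1 + 1) p.2 ω) - G (linProcCut e c p.1 p.2 ω) -
      ∫ ω', (G (linProcCut e c (p.1 + 1) p.2 ω') - G (linProcCut e c p.1 p.2 ω')) ∂μ := by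
    intro p ω
    simp only [Y, R]
    rw [integral_sub (hIX _) (hIT _ _), integral_sub (hIX _) (hIT _ _),
      integral_sub (hIT _ _) (hIT _ _)]
    ring
  have hY0 : ∀ p, ∫ ω, Y p ω ∂μ = 0 := by
    intro p
    have hI : Integrable (fun ω => G (linProcCut e c (p.1 + 1) p.2 ω) -
      G (linProcCut e c p.1 p.2 ω)) μ := (hIT _ _).sub (hIT _ _)
    simp_rw [hYeq]
    rw [integral_sub hI (integrable_const _), integral_const]
    simp
  have hYs : ∀ m n : ℕ, Measurable[sigmaOn e (Set.Ioc ((n : ℤ) - (m + 1 : ℕ)) n)] (Y (m, n)) := by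
    intro m n
    have hYf := funext (hYeq (m, n))
    rw [hYf]
    refine Measurable.sub_const (Measurable.sub ?_ ?_) _
    · exact (measurable_comp_linProcCut hGc e c (m + 1) n).measurable
    · refine (measurable_comp_linProcCut hGc e c m n).measurable.mono
        (sigmaOn_mono e (Set.Ioc_subset_Ioc_left ?_)) le_rfl
      push_cast; omega
  have hsumm : Summable fun m : ℕ => ((m + 1 : ℕ) : ℝ) * ρ ^ m := by
    have h2 := summable_pow_mul_geometric_of_norm_lt_one 1
      (show ‖ρ‖ < 1 by rwa [Real.norm_eq_abs, abs_of_pos h0])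
    have h3 := h2.add (summable_geometric_of_lt_one h0.le h1)
    refine h3.congr fun m => ?_
    push_cast; ring
  refine MomentBounded.of_eLpNorm_le (fun s => Finset.aestronglyMeasurable_fun_sum _
    fun n _ => ((hIX n).sub (integrable_const _)).1) fun k hk => ?_
  -- The moment inequality is for even orders; order `k` is read off from order `2 k`.
  obtain ⟨A, hA, hAY⟩ := hY.eLpNorm_le (k := 2 * k) (by omega)
  obtain ⟨A', hA', hAR⟩ := hR.eLpNorm_le (k := 2 * k) (by omega)
  set S := ∑' m : ℕ, ((m + 1 : ℕ) : ℝ) * ρ ^ m with hS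
  set D := max 1 (indepSumConst k) with hD
  have hD0 : 0 ≤ D := zero_le_one.trans (le_max_left _ _)
  have hS0 : 0 ≤ S := tsum_nonneg fun m => by positivity
  refine ⟨S * D * A + A', by positivity, fun s => ?_⟩
  -- The telescoping stops at an `m0` with `card s * ρ ^ m0 ≤ 1`, so that the triangle inequality
  -- suffices for the remainders.
  obtain ⟨m0, hm0⟩ := exists_pow_lt_of_lt_one (show (0 : ℝ) < 1 / (s.card + 1) by positivity) h1
  have hdecomp : (fun ω => ∑ n ∈ s, (G (linProc e c n ω) - ∫ ω', G (linProc e c 0 ω') ∂μ)) =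
      (∑ m ∈ Finset.range m0, fun ω => ∑ n ∈ s, Y (m, n) ω) + ∑ n ∈ s, R (m0, n) := by
    ext ω
    rw [Pi.add_apply, Finset.sum_apply, Finset.sum_apply, Finset.sum_comm, ← Finset.sum_add_distrib]
    refine Finset.sum_congr rfl fun n _ => ?_
    have htel : ∑ m ∈ Finset.range m0, Y (m, n) ω = R (0, n) ω - R (m0, n) ω :=
      Finset.sum_range_sub' (fun m => R (m, n) ω) m0
    rw [htel, sub_add_cancel]
    have hz : ∀ ω, linProcCut e c 0 (n : ℤ) ω = 0 := fun ω => by simp [linProcCut]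
    simp only [R, hz]
    rw [integral_sub (hIX _) (integrable_const _), he.integral_comp_linProc h0 h1 hC hc hG n 0]
    simp
  have hmeas : AEStronglyMeasurable
      (fun ω => ∑ n ∈ s, (G (linProc e c n ω) - ∫ ω', G (linProc e c 0 ω') ∂μ)) μ :=
    Finset.aestronglyMeasurable_fun_sum _ fun n _ => ((hIX n).sub (integrable_const _)).1
  refine (eLpNorm_le_eLpNorm_of_exponent_le (q := (2 * k : ℕ))
    (by exact_mod_cast (by omega : k ≤ 2 * k)) hmeas).trans ?_
  have h2k : (1 : ℝ≥0∞) ≤ (2 * k : ℕ) := by exact_mod_cast (by omega : 1 ≤ 2 * k)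
  have hYsm : ∀ m, AEStronglyMeasurable (fun ω => ∑ n ∈ s, Y (m, n) ω) μ := fun m =>
    Finset.aestronglyMeasurable_fun_sum _ fun n _ => hYm _
  rw [hdecomp]
  refine (eLpNorm_add_le (Finset.aestronglyMeasurable_sum _ fun m _ => hYsm m)
    (Finset.aestronglyMeasurable_sum _ fun n _ => hRm _) h2k).trans ?_
  have hfirst : eLpNorm (∑ m ∈ Finset.range m0, fun ω => ∑ n ∈ s, Y (m, n) ω) (2 * k : ℕ) μ ≤
      ENNReal.ofReal (S * D * A * √(s.card + 1)) := by
    refine (eLpNorm_sum_le (fun m _ => hYsm m) h2k).trans ?_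
    have hterm : ∀ m ∈ Finset.range m0, eLpNorm (fun ω => ∑ n ∈ s, Y (m, n) ω) (2 * k : ℕ) μ ≤
        ENNReal.ofReal ((((m + 1 : ℕ) : ℝ) * ρ ^ m) * (D * A * √(s.card + 1))) := by
      intro m _
      refine (eLpNorm_sum_le_of_window he.measurable he.indep hk (fun n => Y (m, n))
        (k := m + 1) (by omega) (hYs m) (fun n j => hY.memLp (hYm _) j) (fun n => hY0 _)
        (B := A * ρ ^ m) (by positivity) (fun n => hAY (m, n)) s).trans
        (ENNReal.ofReal_le_ofReal (le_of_eq ?_))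
      rw [hD]; ring
    refine (Finset.sum_le_sum hterm).trans ?_
    rw [← ENNReal.ofReal_sum_of_nonneg fun m _ => by positivity, ← Finset.sum_mul]
    refine ENNReal.ofReal_le_ofReal ?_
    calc _ ≤ S * (D * A * √(s.card + 1)) :=
          mul_le_mul_of_nonneg_right (hsumm.sum_le_tsum _ fun m _ => by positivity) (by positivity)
      _ = _ := by ring
  have hsecond : eLpNorm (∑ n ∈ s, R (m0, n)) (2 * k : ℕ) μ ≤
      ENNReal.ofReal (A' * √(s.card + 1)) := by
    refine (eLpNorm_sum_le (fun n _ => hRm _) h2k).trans ?_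
    refine (Finset.sum_le_sum fun n _ => hAR (m0, n)).trans ?_
    rw [← ENNReal.ofReal_sum_of_nonneg fun n _ => by positivity]
    simp only [Finset.sum_const, nsmul_eq_mul]
    refine ENNReal.ofReal_le_ofReal ?_
    have h3 : (s.card : ℝ) * ρ ^ m0 ≤ 1 := by
      rw [lt_div_iff₀ (by positivity)] at hm0
      have : 0 < ρ ^ m0 := by positivity
      nlinarith
    have h4 : 1 ≤ √((s.card : ℝ) + 1) := by
      rw [Real.one_le_sqrt]; linarith [Nat.cast_nonneg (α := ℝ) s.card]
    calc (s.card : ℝ) * (A' * ρ ^ m0) = A' * (s.card * ρ ^ m0) := by ring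
      _ ≤ A' * √(s.card + 1) := by gcongr; exact h3.trans h4
  refine (add_le_add hfirst hsecond).trans ?_
  rw [← ENNReal.ofReal_add (by positivity) (by positivity), ← add_mul]

end LinearProcessMoments

/-! ### Geometrically decaying power sequences as smooth functions of the operator -/

section Resolvent

open BoundedContinuousFunction

variable {V W : Type*} [NormedAddCommGroup V] [NormedSpace ℝ V] [NormedAddCommGroup W]
  [NormedSpace ℝ W]

/-- Pointwise application of a linear map to bounded sequences. -/
def seqMap (V W : Type*) [NormedAddCommGroup V] [NormedSpace ℝ V] [NormedAddCommGroup W]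
    [NormedSpace ℝ W] : (V →L[ℝ] W) →L[ℝ] ((ℕ →ᵇ V) →L[ℝ] (ℕ →ᵇ W)) :=
  LinearMap.mkContinuous
    { toFun := fun A => A.compLeftContinuousBounded ℕ
      map_add' := fun A B => by ext; simp
      map_smul' := fun a A => by ext; simp } 1 fun A => by
    refine ContinuousLinearMap.opNorm_le_bound _ (by positivity) fun s => ?_
    rw [one_mul]
    refine (norm_le (by positivity)).2 fun j => ?_
    exact (A.le_opNorm _).trans (by gcongr; exact s.norm_coe_le_norm j)

@[simp] lemma seqMap_apply (A : V →L[ℝ] W) (s : ℕ →ᵇ V) (j : ℕ) : seqMap V W A s j = A (s j) := rfl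

/-- The right shift on bounded sequences. -/
def seqShift (V : Type*) [NormedAddCommGroup V] [NormedSpace ℝ V] : (ℕ →ᵇ V) →L[ℝ] (ℕ →ᵇ V) :=
  LinearMap.mkContinuous
    { toFun := fun s => ofNormedAddCommGroupDiscrete (fun j => Nat.casesOn j 0 fun i => s i) ‖s‖
        fun j => by cases j with
          | zero => simp
          | succ i => exact s.norm_coe_le_norm i
      map_add' := fun s t => by ext j; cases j <;> simp
      map_smul' := fun a s => by ext j; cases j <;> simp } 1 fun s => by
    rw [one_mul]
    refine (norm_le (norm_nonneg _)).2 fun j => ?_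
    cases j with
    | zero => simp
    | succ i => exact s.norm_coe_le_norm i

@[simp] lemma seqShift_zero (s : ℕ →ᵇ V) : seqShift V s 0 = 0 := rfl

@[simp] lemma seqShift_succ (s : ℕ →ᵇ V) (j : ℕ) : seqShift V s (j + 1) = s j := rfl

/-- The sequence `v, 0, 0, …`. -/
def seqSingle (V : Type*) [NormedAddCommGroup V] [NormedSpace ℝ V] : V →L[ℝ] (ℕ →ᵇ V) :=
  LinearMap.mkContinuous
    { toFun := fun v => ofNormedAddCommGroupDiscrete (fun j => Nat.casesOn j v fun _ => 0) ‖v‖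
        fun j => by cases j <;> simp
      map_add' := fun s t => by ext j; cases j <;> simp
      map_smul' := fun a s => by ext j; cases j <;> simp } 1 fun v => by
    rw [one_mul]
    refine (norm_le (norm_nonneg _)).2 fun j => ?_
    cases j <;> simp

@[simp] lemma seqSingle_zero (v : V) : seqSingle V v 0 = v := rfl

@[simp] lemma seqSingle_succ (v : V) (j : ℕ) : seqSingle V v (j + 1) = 0 := rfl

/-- The operator `s ↦ (s_0, s_1 - A s_0, s_2 - A s_1, …)`, which inverts `v ↦ (A^j v)_j`. -/
def seqDiff (A : V →L[ℝ] V) : (ℕ →ᵇ V) →L[ℝ] (ℕ →ᵇ V) := 1 - seqMap V V A * seqShift V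

/-- Pointwise application of `A` commutes with shifting, so the `m`-th power shifts by `m` places
and applies `A ^ m`. -/
lemma norm_seqMap_mul_seqShift_pow_le (A : V →L[ℝ] V) (m : ℕ) :
    ‖(seqMap V V A * seqShift V) ^ m‖ ≤ ‖A ^ m‖ := by
  have key : ∀ m (s : ℕ →ᵇ V) (j : ℕ), ((seqMap V V A * seqShift V) ^ m) s j =
      if j < m then 0 else (A ^ m) (s (j - m)) := by
    intro m
    induction m with
    | zero => intro s j; simp
    | succ m ih =>
      intro s j
      rw [pow_succ', pow_succ' A]
      cases j with
      | zero => simp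
      | succ j =>
        simp only [mul_apply_eq_comp, seqMap_apply, seqShift_succ, ih,
          Nat.add_lt_add_iff_right, Nat.add_sub_add_right]
        split_ifs <;> simp
  refine ContinuousLinearMap.opNorm_le_bound _ (norm_nonneg _) fun s => ?_
  refine (norm_le (by positivity)).2 fun j => ?_
  rw [key]
  split_ifs
  · simp only [norm_zero]; positivity
  · exact ((A ^ m).le_opNorm _).trans (by gcongr; exact s.norm_coe_le_norm _)

/-- With `X` the shift followed by `A`, the operator `1 - X ^ m` is invertible by the Neumann series
and factors into a geometric sum and `1 - X`. The factors commute, so both are units. -/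
lemma isUnit_seqDiff [CompleteSpace V] {A : V →L[ℝ] V} {m : ℕ} (h : ‖A ^ m‖ < 1) :
    IsUnit (seqDiff A) := by
  set X := seqMap V V A * seqShift V with hX
  have h1 : IsUnit (1 - X ^ m) :=
    (Units.oneSub (X ^ m) ((norm_seqMap_mul_seqShift_pow_le A m).trans_lt h)).isUnit
  have hc : Commute (∑ i ∈ Finset.range m, X ^ i) (1 - X) := by
    rw [Commute, SemiconjBy, geom_sum_mul_neg, mul_neg_geom_sum]
  rw [← geom_sum_mul_neg X m, hc.isUnit_mul_iff] at h1
  exact h1.2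

/-- The preimage `s` solves the recursion `s 0 = v`, `s (j + 1) = A (s j)`. -/
lemma inverse_seqDiff_apply [CompleteSpace V] {A : V →L[ℝ] V} (h : IsUnit (seqDiff A)) (v : V)
    (j : ℕ) : Ring.inverse (seqDiff A) (seqSingle V v) j = (A ^ j) v := by
  set s := Ring.inverse (seqDiff A) (seqSingle V v) with hs
  have h1 : seqDiff A s = seqSingle V v := by
    have := Ring.mul_inverse_cancel _ h
    rw [hs, ← mul_apply_eq_comp, this, one_apply_eq_self]
  have h2 : ∀ j, s j - (seqMap V V A * seqShift V) s j = seqSingle V v j := fun j => by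
    rw [← h1]; rfl
  induction j with
  | zero => simpa using h2 0
  | succ j ih =>
    have := h2 (j + 1)
    rw [mul_apply_eq_comp, seqMap_apply, seqShift_succ, seqSingle_succ, sub_eq_zero,
      ih] at this
    rw [this, pow_succ', mul_apply_eq_comp]

/-- Some power of `A` is smaller than the same power of `r`. -/
def GeomDecay (A : V →L[ℝ] V) (r : ℝ) : Prop := ∃ m : ℕ, 1 ≤ m ∧ ‖A ^ m‖ < r ^ m

lemma GeomDecay.mono {A : V →L[ℝ] V} {r r' : ℝ} (h : GeomDecay A r) (h0 : 0 ≤ r) (hr : r ≤ r') :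
    GeomDecay A r' := by
  obtain ⟨m, hm, h⟩ := h
  exact ⟨m, hm, h.trans_le (by gcongr)⟩

/-- Decay is witnessed by a single power, a strict inequality between continuous functions. Openness
is what later makes the rate uniform on compact sets of parameters. -/
lemma isOpen_geomDecay (r : ℝ) : IsOpen {A : V →L[ℝ] V | GeomDecay A r} := by
  have : {A : V →L[ℝ] V | GeomDecay A r} =
      ⋃ m : ℕ, ⋃ _ : 1 ≤ m, {A : V →L[ℝ] V | ‖A ^ m‖ < r ^ m} := by
    ext A; simp [GeomDecay]
  rw [this]
  exact isOpen_iUnion fun m => isOpen_iUnion fun _ =>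
    isOpen_lt (continuous_id.pow m).norm continuous_const

/-- The sequence `(r⁻¹ A)^j v`. -/
def powSeq (r : ℝ) (A : V →L[ℝ] V) (v : V) : ℕ →ᵇ V :=
  Ring.inverse (seqDiff (r⁻¹ • A)) (seqSingle V v)

lemma GeomDecay.isUnit [CompleteSpace V] {A : V →L[ℝ] V} {r : ℝ} (h : GeomDecay A r) (hr : 0 < r) :
    IsUnit (seqDiff (r⁻¹ • A)) := by
  obtain ⟨m, -, hm⟩ := h
  refine isUnit_seqDiff (m := m) ?_
  rw [smul_pow, norm_smul, norm_pow, norm_inv, Real.norm_eq_abs, abs_of_pos hr, inv_pow,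
    inv_mul_lt_one₀ (by positivity)]
  exact hm

lemma GeomDecay.powSeq_apply [CompleteSpace V] {A : V →L[ℝ] V} {r : ℝ} (h : GeomDecay A r)
    (hr : 0 < r) (v : V) (j : ℕ) : r ^ j • powSeq r A v j = (A ^ j) v := by
  rw [powSeq, inverse_seqDiff_apply (h.isUnit hr), smul_pow, _root_.smul_apply, smul_smul,
    inv_pow, mul_inv_cancel₀ (by positivity), one_smul]

lemma GeomDecay.norm_pow_apply_le [CompleteSpace V] {A : V →L[ℝ] V} {r : ℝ} (h : GeomDecay A r)
    (hr : 0 < r) (v : V) (j : ℕ) : ‖(A ^ j) v‖ ≤ ‖powSeq r A v‖ * r ^ j := by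
  rw [← h.powSeq_apply hr v j, norm_smul, norm_pow, Real.norm_eq_abs, abs_of_pos hr, mul_comm]
  gcongr
  exact (powSeq r A v).norm_coe_le_norm j

/-- Inversion of operators is smooth, so the whole sequence of powers is differentiated at once in
the supremum norm, with the decay rate preserved under differentiation. -/
lemma contDiffOn_powSeq [CompleteSpace V] {E : Type*} [NormedAddCommGroup E] [NormedSpace ℝ E]
    {n : WithTop ℕ∞} {A : E → V →L[ℝ] V} {v : E → V} {U : Set E} {r : ℝ} (hr : 0 < r)
    (hA : ContDiffOn ℝ n A U) (hv : ContDiffOn ℝ n v U) (h : ∀ θ ∈ U, GeomDecay (A θ) r) :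
    ContDiffOn ℝ n (fun θ => powSeq r (A θ) (v θ)) U := by
  have h1 : ContDiffOn ℝ n (fun θ => seqDiff (r⁻¹ • A θ)) U := by
    have h2 : ContDiffOn ℝ n (fun θ => seqMap V V (r⁻¹ • A θ)) U :=
      (seqMap V V).contDiff.comp_contDiffOn (hA.const_smul r⁻¹)
    exact contDiffOn_const.sub (h2.mul contDiffOn_const)
  have h2 : ContDiffOn ℝ n (fun θ => Ring.inverse (seqDiff (r⁻¹ • A θ))) U := by
    intro θ hθ
    obtain ⟨x, hx⟩ := (h θ hθ).isUnit hr
    have h3 := contDiffAt_ringInverse (n := n) ℝ x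
    rw [hx] at h3
    exact h3.comp_contDiffWithinAt θ (h1 θ hθ)
  exact h2.clm_apply ((seqSingle V).contDiff.comp_contDiffOn hv)

end Resolvent

/-! ### Stability of matrices and geometric decay -/

section StableMatrices

/-- A real matrix as a continuous linear map. -/
def matrixCLM (d : ℕ) : Matrix (Fin d) (Fin d) ℝ →ₗ[ℝ] ((Fin d → ℝ) →L[ℝ] (Fin d → ℝ)) :=
  LinearMap.toContinuousLinearMap.toLinearMap ∘ₗ Matrix.toLin'.toLinearMap

@[simp] lemma matrixCLM_apply {d : ℕ} (A : Matrix (Fin d) (Fin d) ℝ) (v : Fin d → ℝ) :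
    matrixCLM d A v = A *ᵥ v := rfl

lemma matrixCLM_pow_apply {d : ℕ} (A : Matrix (Fin d) (Fin d) ℝ) (j : ℕ) (v : Fin d → ℝ) :
    (matrixCLM d A ^ j) v = A ^ j *ᵥ v := by
  induction j with
  | zero => simp
  | succ j ih =>
    rw [pow_succ', mul_apply_eq_comp, ih, matrixCLM_apply, Matrix.mulVec_mulVec,
      pow_succ']

-- Gelfand's formula for the complexified matrix: some power is smaller than the same power of an
-- `r` between the spectral radius and `1`. In the row-sum norm complexification is isometric, so
-- the bound descends to the real matrix.
open scoped Matrix.Norms.Operator in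
lemma IsStableMatrix.exists_geomDecay {d : ℕ} {A : Matrix (Fin d) (Fin d) ℝ}
    (hA : IsStableMatrix A) : ∃ r : ℝ, 0 < r ∧ r < 1 ∧ GeomDecay (matrixCLM d A) r := by
  set B : Matrix (Fin d) (Fin d) ℂ := A.map (fun a : ℝ => (a : ℂ)) with hB
  have hrad : spectralRadius ℂ B < 1 := by
    -- An empty spectrum, as for `d = 0`, has spectral radius `0`, a supremum over nothing.
    rcases (spectrum ℂ B).eq_empty_or_nonempty with h | h
    · simp [spectralRadius, h]
    · have := spectrum.spectralRadius_lt_of_forall_lt_of_nonempty (r := 1) h fun k hk => hA k hk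
      simpa using this
  obtain ⟨r, hr1, hr2⟩ := ENNReal.lt_iff_exists_nnreal_btwn.1 hrad
  have hr2' : r < 1 := by exact_mod_cast hr2
  have hr0 : 0 < r := by
    have := (zero_le (a := spectralRadius ℂ B)).trans_lt hr1
    exact_mod_cast this
  have hlim := spectrum.pow_nnnorm_pow_one_div_tendsto_nhds_spectralRadius B
  obtain ⟨n, hn, hn1⟩ := ((hlim.eventually (gt_mem_nhds hr1)).and (eventually_ge_atTop 1)).exists
  have hpow : ‖B ^ n‖ < (r : ℝ) ^ n := by
    have hn0 : (0 : ℝ) < n := by exact_mod_cast hn1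
    have h1 := ENNReal.rpow_lt_rpow hn hn0
    rw [← ENNReal.rpow_mul, one_div, inv_mul_cancel₀ hn0.ne', ENNReal.rpow_one,
      ENNReal.rpow_natCast] at h1
    have h2 : ‖B ^ n‖₊ < r ^ n := by exact_mod_cast h1
    exact_mod_cast h2
  have hBn : B ^ n = (A ^ n).map (fun a : ℝ => (a : ℂ)) := by
    exact (map_pow (Complex.ofRealHom.mapMatrix (m := Fin d)) A n).symm
  refine ⟨r, by exact_mod_cast hr0, by exact_mod_cast hr2', n, hn1, lt_of_le_of_lt ?_ hpow⟩
  have hnorm : ‖B ^ n‖ = ‖A ^ n‖ := by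
    rw [hBn, Matrix.linfty_opNorm_def, Matrix.linfty_opNorm_def]
    simp
  rw [hnorm]
  refine ContinuousLinearMap.opNorm_le_bound _ (norm_nonneg _) fun v => ?_
  rw [matrixCLM_pow_apply]
  exact Matrix.linfty_opNorm_mulVec _ _

lemma contDiffOn_matrixCLM {d : ℕ} {E : Type*} [NormedAddCommGroup E] [NormedSpace ℝ E]
    {n : WithTop ℕ∞} {A : E → Matrix (Fin d) (Fin d) ℝ} {U : Set E}
    (h : ∀ i j, ContDiffOn ℝ n (fun θ => A θ i j) U) :
    ContDiffOn ℝ n (fun θ => matrixCLM d (A θ)) U := by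
  have h1 : ContDiffOn ℝ n (fun θ i j => A θ i j : E → Fin d → Fin d → ℝ) U :=
    contDiffOn_pi.2 fun i => contDiffOn_pi.2 fun j => h i j
  let T : (Fin d → Fin d → ℝ) →ₗ[ℝ] ((Fin d → ℝ) →L[ℝ] (Fin d → ℝ)) :=
    matrixCLM d ∘ₗ (Matrix.ofLinearEquiv ℝ).toLinearMap
  exact T.toContinuousLinearMap.contDiff.comp_contDiffOn h1

/-- The row vector `l` as a linear functional. -/
def rowCLM (d : ℕ) : (Fin d → ℝ) →L[ℝ] ((Fin d → ℝ) →L[ℝ] ℝ) :=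
  LinearMap.toContinuousLinearMap
    (LinearMap.toContinuousLinearMap.toLinearMap ∘ₗ dotProductBilin ℝ ℝ)

@[simp] lemma rowCLM_apply {d : ℕ} (l v : Fin d → ℝ) : rowCLM d l v = l ⬝ᵥ v := rfl

end StableMatrices

/-! ### Composition of linear filters -/

section Convolution

variable {Ω : Type*} {F : Type*} [NormedAddCommGroup F] [NormedSpace ℝ F]

/-- The coefficients of the composition of two linear filters. -/
def convCoeff (k : ℕ → ℝ) (c : ℕ → F) (i : ℕ) : F :=
  ∑ q ∈ Finset.HasAntidiagonal.antidiagonal i, k q.2 • c q.1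

variable {k : ℕ → ℝ} {c : ℕ → F} {A B ρ : ℝ}

/-- Convolving two sequences with rate `ρ ^ 2` produces a factor `i + 1`, absorbed by weakening the
rate to `ρ`. This is why filters below decay like `(ρ ^ 2) ^ j` and their compositions like `ρ ^ j`.
-/
lemma succ_mul_pow_le (h0 : 0 < ρ) (h1 : ρ < 1) (i : ℕ) :
    ((i : ℝ) + 1) * (ρ ^ 2) ^ i ≤ (1 - ρ)⁻¹ * ρ ^ i := by
  have h2 : ((i : ℝ) + 1) * ρ ^ i ≤ (1 - ρ)⁻¹ := by
    calc ((i : ℝ) + 1) * ρ ^ i = ∑ _j ∈ Finset.range (i + 1), ρ ^ i := by simp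
      _ ≤ ∑ j ∈ Finset.range (i + 1), ρ ^ j := Finset.sum_le_sum fun j hj =>
          pow_le_pow_of_le_one h0.le h1.le (by simpa [Nat.lt_succ_iff] using hj)
      _ ≤ ∑' j, ρ ^ j := (summable_geometric_of_lt_one h0.le h1).sum_le_tsum _
          fun j _ => by positivity
      _ = (1 - ρ)⁻¹ := tsum_geometric_of_lt_one h0.le h1
  calc ((i : ℝ) + 1) * (ρ ^ 2) ^ i = ((i : ℝ) + 1) * ρ ^ i * ρ ^ i := by rw [← pow_mul]; ring
    _ ≤ _ := by gcongr

lemma norm_convCoeff_le (hB : 0 ≤ B) (h0 : 0 < ρ) (h1 : ρ < 1)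
    (hk : ∀ l, ‖k l‖ ≤ A * (ρ ^ 2) ^ l) (hc : ∀ j, ‖c j‖ ≤ B * (ρ ^ 2) ^ j) (i : ℕ) :
    ‖convCoeff k c i‖ ≤ A * B * (1 - ρ)⁻¹ * ρ ^ i := by
  have hA : 0 ≤ A := by simpa using (norm_nonneg _).trans (hk 0)
  have hterm : ∀ q ∈ Finset.HasAntidiagonal.antidiagonal i, ‖k q.2 • c q.1‖ ≤ A * B * (ρ ^ 2) ^ i := by
    intro q hq
    rw [Finset.HasAntidiagonal.mem_antidiagonal] at hq
    rw [norm_smul]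
    calc _ ≤ (A * (ρ ^ 2) ^ q.2) * (B * (ρ ^ 2) ^ q.1) := by gcongr; exacts [hk _, hc _]
      _ = A * B * (ρ ^ 2) ^ (q.1 + q.2) := by rw [pow_add]; ring
      _ = _ := by rw [hq]
  refine (norm_sum_le_of_le _ hterm).trans ?_
  rw [Finset.sum_const, Finset.Nat.card_antidiagonal, nsmul_eq_mul]
  push_cast
  calc _ = A * B * (((i : ℝ) + 1) * (ρ ^ 2) ^ i) := by ring
    _ ≤ A * B * ((1 - ρ)⁻¹ * ρ ^ i) :=
        mul_le_mul_of_nonneg_left (succ_mul_pow_le h0 h1 i) (by positivity)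
    _ = _ := by ring

/-- The double series is absolutely summable along antidiagonals, by the envelope of `e`, and may
therefore be summed either by rows or by antidiagonals. -/
lemma linProc_linProc [CompleteSpace F] (hB : 0 ≤ B) (h0 : 0 < ρ) (h1 : ρ < 1)
    (hk : ∀ l, ‖k l‖ ≤ A * (ρ ^ 2) ^ l) (hc : ∀ j, ‖c j‖ ≤ B * (ρ ^ 2) ^ j)
    {e : ℤ → Ω → ℝ} {ω : Ω} (hs : ∀ n : ℤ, Summable fun i : ℕ => |ρ ^ i * e (n - i) ω|) (n : ℤ) :
    linProc (linProc e k) c n ω = linProc e (convCoeff k c) n ω := by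
  have hA : 0 ≤ A := by simpa using (norm_nonneg _).trans (hk 0)
  let f : ℕ × ℕ → F := fun q => e (n - q.1 - q.2) ω • k q.2 • c q.1
  have hρ2 : ∀ l : ℕ, (ρ ^ 2) ^ l ≤ ρ ^ l := fun l => by
    rw [← pow_mul]
    exact pow_le_pow_of_le_one h0.le h1.le (by omega)
  have hf : Summable f := by
    rw [← Finset.HasAntidiagonal.sigmaAntidiagonalEquivProd.summable_iff]
    refine Summable.of_norm ?_
    rw [summable_sigma_of_nonneg fun _ => norm_nonneg _]
    refine ⟨fun i => Summable.of_finite, ?_⟩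
    refine Summable.of_nonneg_of_le (fun i => tsum_nonneg fun _ => norm_nonneg _) (fun i => ?_)
      ((hs n).mul_left (A * B * (1 - ρ)⁻¹))
    rw [tsum_fintype]
    have hterm : ∀ q ∈ (Finset.univ : Finset (Finset.HasAntidiagonal.antidiagonal i)),
        ‖(f ∘ Finset.HasAntidiagonal.sigmaAntidiagonalEquivProd) ⟨i, q⟩‖ ≤
          A * B * (ρ ^ 2) ^ i * |e (n - i) ω| := by
      rintro ⟨q, hq⟩ -
      rw [Finset.HasAntidiagonal.mem_antidiagonal] at hq
      have hn : n - (q.1 : ℤ) - q.2 = n - i := by rw [← hq]; push_cast; ring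
      simp only [Function.comp_apply, Finset.HasAntidiagonal.sigmaAntidiagonalEquivProd_apply, f, norm_smul, hn,
        Real.norm_eq_abs]
      calc _ ≤ |e (n - i) ω| * ((A * (ρ ^ 2) ^ q.2) * (B * (ρ ^ 2) ^ q.1)) := by
            gcongr; exacts [hk _, hc _]
        _ = A * B * (ρ ^ 2) ^ (q.1 + q.2) * |e (n - i) ω| := by rw [pow_add]; ring
        _ = _ := by rw [hq]
    refine (Finset.sum_le_sum hterm).trans ?_
    rw [Finset.sum_const, Finset.card_univ, Fintype.card_coe, Finset.Nat.card_antidiagonal,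
      nsmul_eq_mul, abs_mul, abs_of_pos (pow_pos h0 i)]
    push_cast
    calc _ = A * B * (((i : ℝ) + 1) * (ρ ^ 2) ^ i) * |e (n - i) ω| := by ring
      _ ≤ A * B * ((1 - ρ)⁻¹ * ρ ^ i) * |e (n - i) ω| := by
        refine mul_le_mul_of_nonneg_right ?_ (abs_nonneg _)
        exact mul_le_mul_of_nonneg_left (succ_mul_pow_le h0 h1 i) (by positivity)
      _ = _ := by ring
  have hk' : ∀ l, ‖k l‖ ≤ A * ρ ^ l := fun l => (hk l).trans (by exact mul_le_mul_of_nonneg_left (hρ2 l) hA)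
  have hrow : ∀ j : ℕ, HasSum (fun l => f (j, l)) (linProc e k (n - j) ω • c j) := by
    intro j
    have := (summable_linProc hk' h0 (hs (n - j))).hasSum.smul_const (c j)
    simpa [f, linProc, smul_smul] using this
  have h3 := hf.hasSum.prod_fiberwise hrow
  have h4 : HasSum (fun i : ℕ => e (n - i) ω • convCoeff k c i) (∑' q, f q) := by
    have h5 := (Finset.HasAntidiagonal.sigmaAntidiagonalEquivProd.hasSum_iff.2 hf.hasSum).sigma
      fun i => hasSum_fintype _
    refine h5.congr_fun fun i => ?_
    rw [convCoeff, Finset.smul_sum, ← Finset.sum_coe_sort]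
    refine Finset.sum_congr rfl fun q _ => ?_
    have hq := Finset.HasAntidiagonal.mem_antidiagonal.1 q.2
    have hn : n - (q.1.1 : ℤ) - q.1.2 = n - i := by omega
    simp [f, hn]
  rw [linProc, h3.tsum_eq, linProc, h4.tsum_eq]

end Convolution

/-! ### The innovations as random functionals of deterministic filter coefficients -/

section FilterFunctionals

open BoundedContinuousFunction

/-- The space of coefficient sequences of the inverse filter and of its initial transient. -/
abbrev FilterSpace := ℝ × (ℕ →ᵇ ℝ) × (ℕ →ᵇ ℝ)

/-- The dual vector by which the observation at lag `j` acts on filter coefficients. -/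
def lagFunctional (r : ℝ) : ℕ → (FilterSpace →L[ℝ] ℝ)
  | 0 => ContinuousLinearMap.fst ℝ ℝ _
  | j + 1 => -(r ^ j) • (evalCLM ℝ j ∘L ContinuousLinearMap.fst ℝ _ _ ∘L
      ContinuousLinearMap.snd ℝ ℝ _)

/-- The dual vector that extracts the effect of the initial state after `j` steps. -/
def initFunctional (r : ℝ) (j : ℕ) : FilterSpace →L[ℝ] ℝ :=
  (r ^ j) • (evalCLM ℝ j ∘L ContinuousLinearMap.snd ℝ (ℕ →ᵇ ℝ) _ ∘L ContinuousLinearMap.snd ℝ ℝ _)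

lemma norm_eval_le (j : ℕ) (s : ℕ →ᵇ ℝ) : ‖s j‖ ≤ ‖s‖ := s.norm_coe_le_norm j

lemma norm_lagFunctional_le {r : ℝ} (h0 : 0 < r) (h1 : r < 1) (j : ℕ) :
    ‖lagFunctional r j‖ ≤ r⁻¹ * r ^ j := by
  refine ContinuousLinearMap.opNorm_le_bound _ (by positivity) fun x => ?_
  cases j with
  | zero =>
    have h2 : 1 ≤ r⁻¹ := (one_le_inv₀ h0).2 h1.le
    rw [pow_zero, mul_one]
    exact (norm_fst_le x).trans (le_mul_of_one_le_left (norm_nonneg _) h2)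
  | succ j =>
    have h2 : ‖x.2.1 j‖ ≤ ‖x‖ :=
      (norm_eval_le j _).trans ((norm_fst_le x.2).trans (norm_snd_le x))
    have h3 : r⁻¹ * r ^ (j + 1) = r ^ j := by rw [pow_succ]; field_simp
    rw [h3]
    have h4 : lagFunctional r (j + 1) x = -(r ^ j) * x.2.1 j := rfl
    rw [h4, norm_mul, norm_neg, norm_pow, Real.norm_eq_abs, abs_of_pos h0]
    gcongr

lemma norm_initFunctional_le {r : ℝ} (h0 : 0 < r) (j : ℕ) : ‖initFunctional r j‖ ≤ r ^ j := by
  refine ContinuousLinearMap.opNorm_le_bound _ (by positivity) fun x => ?_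
  have h2 : ‖x.2.2 j‖ ≤ ‖x‖ :=
    (norm_eval_le j _).trans ((norm_snd_le x.2).trans (norm_snd_le x))
  have h4 : initFunctional r j x = (r ^ j) * x.2.2 j := rfl
  rw [h4, norm_mul, norm_pow, Real.norm_eq_abs, abs_of_pos h0]
  gcongr

variable {Ω : Type*}

/-- The estimated innovation at time `n` as a functional of the filter coefficients. -/
def innovFunctional (r : ℝ) (y : ℤ → Ω → ℝ) (n : ℕ) (ω : Ω) : FilterSpace →L[ℝ] ℝ :=
  linProcCut y (lagFunctional r) n n ω - initFunctional r (n - 1)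

namespace InnovationSystem

variable {p d : ℕ} (S : InnovationSystem p d)

/-- The filter coefficients belonging to a parameter. -/
def filterPoint (ξ : Fin d → ℝ) (r : ℝ) (θ : EuclideanSpace ℝ (Fin p)) : FilterSpace :=
  (1, seqMap _ ℝ (rowCLM d (S.L θ)) (powSeq r (matrixCLM d (S.invH θ)) (S.K θ)),
    seqMap _ ℝ (rowCLM d (S.L θ)) (powSeq r (matrixCLM d (S.invH θ)) ξ))

variable {S} {ξ : Fin d → ℝ} {r : ℝ} {θ : EuclideanSpace ℝ (Fin p)}

lemma lagFunctional_filterPoint (hr : 0 < r) (h : GeomDecay (matrixCLM d (S.invH θ)) r) (j : ℕ) :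
    lagFunctional r (j + 1) (S.filterPoint ξ r θ) = -(S.L θ ⬝ᵥ (S.invH θ ^ j *ᵥ S.K θ)) := by
  have h1 : lagFunctional r (j + 1) (S.filterPoint ξ r θ) =
      -(r ^ j) * (S.L θ ⬝ᵥ (powSeq r (matrixCLM d (S.invH θ)) (S.K θ)) j) := rfl
  rw [h1, ← matrixCLM_pow_apply, ← h.powSeq_apply hr, dotProduct_smul, smul_eq_mul, neg_mul]

lemma initFunctional_filterPoint (hr : 0 < r) (h : GeomDecay (matrixCLM d (S.invH θ)) r) (j : ℕ) :
    initFunctional r j (S.filterPoint ξ r θ) = S.L θ ⬝ᵥ (S.invH θ ^ j *ᵥ ξ) := by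
  have h1 : initFunctional r j (S.filterPoint ξ r θ) =
      (r ^ j) * (S.L θ ⬝ᵥ (powSeq r (matrixCLM d (S.invH θ)) ξ) j) := rfl
  rw [h1, ← matrixCLM_pow_apply, ← h.powSeq_apply hr, dotProduct_smul, smul_eq_mul]

lemma filterState_eq (y : ℤ → Ω → ℝ) (ω : Ω) (m : ℕ) :
    S.filterState ξ y θ ω m = S.invH θ ^ m *ᵥ ξ +
      ∑ j ∈ Finset.range m, y ((m : ℤ) - j) ω • (S.invH θ ^ j *ᵥ S.K θ) := by
  induction m with
  | zero => simp [filterState]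
  | succ m ih =>
    rw [filterState, ih, Matrix.mulVec_add, Matrix.mulVec_mulVec, ← pow_succ', Matrix.mulVec_sum,
      Finset.sum_range_succ', add_assoc]
    congr 1
    congr 1
    · refine Finset.sum_congr rfl fun j _ => ?_
      rw [Matrix.mulVec_smul, Matrix.mulVec_mulVec, ← pow_succ']
      congr 2
      push_cast; ring
    · simp

/-- The unrolled filter recursion separates the data, which enter the functional, from the
parameter, which enters the point. The case `n = 0` must be excluded: there the cut process has no
terms and the observation `y 0` would be missing. -/
lemma innovation_eq (hr : 0 < r) (h : GeomDecay (matrixCLM d (S.invH θ)) r) (y : ℤ → Ω → ℝ)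
    (ω : Ω) {n : ℕ} (hn : 1 ≤ n) :
    S.innovation ξ y ω n θ = innovFunctional r y n ω (S.filterPoint ξ r θ) := by
  obtain ⟨m, rfl⟩ : ∃ m, n = m + 1 := ⟨n - 1, by omega⟩
  have h0 : lagFunctional r 0 (S.filterPoint ξ r θ) = 1 := rfl
  rw [innovation, innovFunctional, linProcCut, Nat.add_sub_cancel, filterState_eq,
    _root_.sub_apply, initFunctional_filterPoint hr h, _root_.sum_apply, Finset.sum_range_succ',
    dotProduct_add, dotProduct_sum]
  simp only [_root_.smul_apply, lagFunctional_filterPoint hr h, h0, dotProduct_smul, smul_eq_mul]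
  have : ∀ j : ℕ, ((m + 1 : ℕ) : ℤ) - ((j + 1 : ℕ) : ℤ) = m - j := fun j => by push_cast; ring
  simp only [this, mul_neg, Finset.sum_neg_distrib]
  simp
  ring

lemma statInnovation_eq (hr : 0 < r) (hr1 : r < 1) (h : GeomDecay (matrixCLM d (S.invH θ)) r)
    {y : ℤ → Ω → ℝ} {ω : Ω} {n : ℤ} (hs : Summable fun i : ℕ => |r ^ i * y (n - i) ω|) :
    S.statInnovation y ω n θ = linProc y (lagFunctional r) n ω (S.filterPoint ξ r θ) := by
  have hs' := summable_linProc (F := FilterSpace →L[ℝ] ℝ) (c := lagFunctional r) (C := r⁻¹)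
    (ρ := r) (norm_lagFunctional_le hr hr1) hr hs
  have h1 : HasSum (fun j : ℕ => y (n - j) ω * lagFunctional r j (S.filterPoint ξ r θ))
      (linProc y (lagFunctional r) n ω (S.filterPoint ξ r θ)) :=
    (ContinuousLinearMap.apply ℝ ℝ (S.filterPoint ξ r θ)).hasSum hs'.hasSum
  have h2 := h1.summable.tsum_eq_zero_add
  have h0 : lagFunctional r 0 (S.filterPoint ξ r θ) = 1 := rfl
  simp only [lagFunctional_filterPoint hr h, h0] at h2
  rw [statInnovation, ← h1.tsum_eq]
  rw [h2]
  have : ∀ j : ℕ, n - ((j + 1 : ℕ) : ℤ) = n - 1 - j := fun j => by push_cast; ring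
  simp only [this, mul_neg, tsum_neg, Nat.cast_zero, sub_zero, mul_one]
  rw [sub_eq_add_neg]
  congr 3
  ext j
  ring

/-- The coefficients of the stationary output. -/
def outputCoeff (S : InnovationSystem p d) (θ : EuclideanSpace ℝ (Fin p)) : ℕ → ℝ
  | 0 => 1
  | j + 1 => S.L θ ⬝ᵥ (S.H θ ^ j *ᵥ S.K θ)

lemma exists_norm_outputCoeff_le (hr : 0 < r) (h : GeomDecay (matrixCLM d (S.H θ)) r) :
    ∃ C : ℝ, 0 ≤ C ∧ ∀ j, ‖S.outputCoeff θ j‖ ≤ C * r ^ j := by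
  refine ⟨max 1 (r⁻¹ * (‖rowCLM d (S.L θ)‖ * ‖powSeq r (matrixCLM d (S.H θ)) (S.K θ)‖)),
    by positivity, fun j => ?_⟩
  cases j with
  | zero => simp [outputCoeff]
  | succ j =>
    rw [outputCoeff, ← matrixCLM_pow_apply, ← rowCLM_apply]
    refine ((rowCLM d (S.L θ)).le_opNorm _).trans ?_
    calc _ ≤ ‖rowCLM d (S.L θ)‖ * (‖powSeq r (matrixCLM d (S.H θ)) (S.K θ)‖ * r ^ j) := by
          gcongr; exact h.norm_pow_apply_le hr _ j
      _ = r⁻¹ * (‖rowCLM d (S.L θ)‖ * ‖powSeq r (matrixCLM d (S.H θ)) (S.K θ)‖) * r ^ (j + 1) := by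
          rw [pow_succ]; field_simp
      _ ≤ _ := by gcongr; exact le_max_right _ _

lemma output_eq {C : ℝ} (hr : 0 < r) (hC : ∀ j, ‖S.outputCoeff θ j‖ ≤ C * r ^ j)
    {e : ℤ → Ω → ℝ} {ω : Ω} {n : ℤ} (hs : Summable fun i : ℕ => |r ^ i * e (n - i) ω|) :
    S.output θ e n ω = linProc e (S.outputCoeff θ) n ω := by
  rw [output, linProc, (summable_linProc hC hr hs).tsum_eq_zero_add]
  have : ∀ j : ℕ, n - ((j + 1 : ℕ) : ℤ) = n - 1 - j := fun j => by push_cast; ring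
  simp only [this, outputCoeff, smul_eq_mul, Nat.cast_zero, sub_zero, mul_one]
  congr 2
  ext j
  ring

lemma contDiffOn_filterPoint {U : Set (EuclideanSpace ℝ (Fin p))} (hr : 0 < r)
    (hS : S.IsSmoothOn U) (h : ∀ θ ∈ U, GeomDecay (matrixCLM d (S.invH θ)) r) :
    ContDiffOn ℝ 3 (S.filterPoint ξ r) U := by
  obtain ⟨hH, hK, hL⟩ := hS
  have hM : ContDiffOn ℝ 3 (fun θ => matrixCLM d (S.invH θ)) U := contDiffOn_matrixCLM
    fun i j => (hH i j).sub ((hK i).mul (hL j))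
  have hK' : ContDiffOn ℝ 3 S.K U := contDiffOn_pi.2 hK
  have hL' : ContDiffOn ℝ 3 (fun θ => seqMap _ ℝ (rowCLM d (S.L θ))) U :=
    (seqMap (Fin d → ℝ) ℝ).contDiff.comp_contDiffOn ((rowCLM d).contDiff.comp_contDiffOn (contDiffOn_pi.2 hL))
  exact contDiffOn_const.prodMk ((hL'.clm_apply (contDiffOn_powSeq hr hM hK' h)).prodMk
    (hL'.clm_apply (contDiffOn_powSeq hr hM contDiffOn_const h)))

/-- On a neighbourhood of a compact set of parameters the inverse systems, and one given system,
decay at a common geometric rate. -/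
lemma exists_decay_rate {G D : Set (EuclideanSpace ℝ (Fin p))} (hG : IsOpen G) (hDG : D ⊆ G)
    (hD : IsCompact D) (hsmooth : S.IsSmoothOn G) (hstable : S.IsStableOn G)
    {θs : EuclideanSpace ℝ (Fin p)} (hθs : θs ∈ G) :
    ∃ ρ : ℝ, 0 < ρ ∧ ρ < 1 ∧ GeomDecay (matrixCLM d (S.H θs)) (ρ ^ 2) ∧
      ∃ U : Set (EuclideanSpace ℝ (Fin p)), IsOpen U ∧ D ⊆ U ∧ U ⊆ G ∧
        ∀ θ ∈ U, GeomDecay (matrixCLM d (S.invH θ)) (ρ ^ 2) := by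
  obtain ⟨r0, hr0, hr01, hd0⟩ := (hstable θs hθs).1.exists_geomDecay
  have hM : ContinuousOn (fun θ => matrixCLM d (S.invH θ)) G :=
    (contDiffOn_matrixCLM (n := 3)
      fun i j => (hsmooth.1 i j).sub ((hsmooth.2.1 i).mul (hsmooth.2.2 j))).continuousOn
  -- Compactness: each parameter has a neighbourhood with a common rate, and a finite union takes
  -- the maximum of the rates.
  have hcov : ∃ r : ℝ, 0 < r ∧ r < 1 ∧ ∀ θ ∈ D, GeomDecay (matrixCLM d (S.invH θ)) r := by
    refine hD.induction_on (p := fun s => ∃ r : ℝ, 0 < r ∧ r < 1 ∧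
      ∀ θ ∈ s, GeomDecay (matrixCLM d (S.invH θ)) r) ⟨1 / 2, by norm_num, by norm_num, by simp⟩
      ?_ ?_ ?_
    · rintro s t hst ⟨r, h0, h1, h⟩
      exact ⟨r, h0, h1, fun θ hθ => h θ (hst hθ)⟩
    · rintro s t ⟨r, h0, h1, h⟩ ⟨r', h0', h1', h'⟩
      refine ⟨max r r', lt_max_of_lt_left h0, max_lt h1 h1', fun θ hθ => ?_⟩
      rcases hθ with hθ | hθ
      · exact (h θ hθ).mono h0.le (le_max_left _ _)
      · exact (h' θ hθ).mono h0'.le (le_max_right _ _)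
    · intro θ hθ
      obtain ⟨r, h0, h1, h⟩ := (hstable θ (hDG hθ)).2.exists_geomDecay
      have hnhds := (hM.continuousAt (hG.mem_nhds (hDG hθ))).preimage_mem_nhds
        ((isOpen_geomDecay r).mem_nhds h)
      exact ⟨_, mem_nhdsWithin_of_mem_nhds hnhds, r, h0, h1, fun θ' hθ' => hθ'⟩
  obtain ⟨r1, hr1, hr11, hd1⟩ := hcov
  set r := max r0 r1 with hr
  have hrpos : 0 < r := lt_max_of_lt_left hr0
  -- The square root supplies a rate of the form `ρ ^ 2`, leaving room for one convolution.
  have hsq : √r ^ 2 = r := Real.sq_sqrt hrpos.le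
  refine ⟨√r, Real.sqrt_pos.2 hrpos, ?_, ?_, G ∩ {θ | GeomDecay (matrixCLM d (S.invH θ)) r}, ?_,
    ?_, Set.inter_subset_left, ?_⟩
  · rw [Real.sqrt_lt' one_pos, one_pow]; exact max_lt hr01 hr11
  · rw [hsq]; exact hd0.mono hr0.le (le_max_left _ _)
  · exact hM.isOpen_inter_preimage hG (isOpen_geomDecay r)
  · exact fun θ hθ => ⟨hDG hθ, (hd1 θ hθ).mono hr1.le (le_max_right _ _)⟩
  · rw [hsq]; exact fun θ hθ => hθ.2

end InnovationSystem

end FilterFunctionals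

/-! ### Sample means along the filter, with rate `N^{-1/2}` -/

section SampleMeans

variable {Ω : Type*} {mΩ : MeasurableSpace Ω} {μ : Measure Ω} [IsProbabilityMeasure μ]
  {e y : ℤ → Ω → ℝ} {k : ℕ → ℝ} {A B B' ρ : ℝ}
  {F : Type*} [NormedAddCommGroup F] [NormedSpace ℝ F] [CompleteSpace F] {c a : ℕ → F}
  {W : Type*} [NormedAddCommGroup W]

lemma IsNoise.momentBounded_filtered (he : IsNoise μ e) (h0 : 0 < ρ) (h1 : ρ < 1)
    (hA : 0 ≤ A) (hk : ∀ l, ‖k l‖ ≤ A * ρ ^ l)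
    (hy : ∀ᵐ ω ∂μ, ∀ n, y n ω = linProc e k n ω) : MomentBounded μ y (fun _ => 1) := by
  have h := he.momentBounded_comp_linProc h0 h1 hA hk (PolyLipschitz.clm (ContinuousLinearMap.id ℝ ℝ))
  refine h.mono_ae fun n => ?_
  filter_upwards [hy] with ω hω
  rw [hω n]
  simp

/-- Functions of a filter started at time zero differ from those of its stationary version by
geometrically decaying terms. -/
lemma momentBounded_comp_linProcCut_sub (hy : MomentBounded μ y (fun _ => 1)) {r : ℝ}
    (h0 : 0 < r) (h1 : r < 1) (hB : 0 ≤ B) (hc : ∀ j, ‖c j‖ ≤ B * r ^ j) (hB' : 0 ≤ B')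
    (ha : ∀ j, ‖a j‖ ≤ B' * r ^ j) {G : F → W} (hG : PolyLipschitz G) :
    MomentBounded μ (fun (n : ℕ) ω => ‖G (linProcCut y c n n ω - a n) - G (linProc y c n ω)‖)
      (fun n => r ^ n) := by
  obtain ⟨K, s, hK, hlip⟩ := hG
  obtain ⟨hs, henv⟩ := hy.envelope h0 h1
  have e1 : MomentBounded μ (fun (_ : ℕ) ω => B * envelope r y 0 ω + B') (fun _ => 1) :=
    ((henv.comp fun _ : ℕ => (0 : ℤ)).const_mul B).add
      ((MomentBounded.const B')) fun _ => zero_le_one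
  have e2 : MomentBounded μ (fun (n : ℕ) ω => (1 + B' + 2 * B * envelope r y n ω) ^ s)
      (fun _ => 1) := by
    have := ((MomentBounded.const (1 + B')).add ((henv.comp fun n : ℕ => (n : ℤ)).const_mul (2 * B))
      fun _ => zero_le_one).pow (fun _ => zero_le_one) s
    simpa using this
  have e3 := ((e1.mul e2 fun _ => zero_le_one).weight fun n => K * r ^ n).mono_right
    (g := fun n => r ^ n) (c := K) hK fun n => by rw [abs_of_nonneg (by positivity)]; simp
  refine e3.mono_ae fun n => ?_
  filter_upwards [hs] with ω hω
  have p0 := envelope_nonneg r y 0 ω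
  have pn := envelope_nonneg r y n ω
  rw [abs_of_nonneg (norm_nonneg _), abs_of_nonneg (by positivity)]
  have b1 := norm_linProc_le hc h0 (hω n)
  have b2 := norm_linProcCut_le hc hB h0 (hω n) n
  -- At time `n` the filter started at zero lacks exactly the observations at times `≤ 0`, so the
  -- error is `r ^ n` times the envelope at time `0`.
  have b3 := norm_linProc_sub_cut_le hc h0 hω n (n := n)
  rw [sub_self] at b3
  have ha1 : ‖a n‖ ≤ B' := (ha n).trans (mul_le_of_le_one_right hB' (pow_le_one₀ h0.le h1.le))
  have d1 : ‖linProcCut y c n n ω - a n - linProc y c n ω‖ ≤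
      r ^ n * (B * envelope r y 0 ω + B') := by
    calc _ = ‖-(linProc y c n ω - linProcCut y c n n ω) - a n‖ := by congr 1; abel
      _ ≤ B * (r ^ n * envelope r y 0 ω) + B' * r ^ n := by
        refine (norm_sub_le _ _).trans ?_
        rw [norm_neg]
        exact add_le_add b3 (ha n)
      _ = _ := by ring
  have d2 : ‖linProcCut y c n n ω - a n‖ ≤ B * envelope r y n ω + B' :=
    (norm_sub_le _ _).trans (add_le_add b2 ha1)
  refine (hlip _ _).trans ?_
  calc _ ≤ K * (r ^ n * (B * envelope r y 0 ω + B')) *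
        (1 + (B * envelope r y n ω + B') + B * envelope r y n ω) ^ s := by gcongr
    _ = K * r ^ n * ((B * envelope r y 0 ω + B') * (1 + B' + 2 * B * envelope r y n ω) ^ s) := by
      ring

/-- Sample means of functions of a filter driven by a linear process converge to the stationary
expectation at the rate `N^{-1/2}`, in all moments. -/
lemma IsNoise.momentBounded_sampleMean_real (he : IsNoise μ e) (h0 : 0 < ρ) (h1 : ρ < 1)
    (hA : 0 ≤ A) (hk : ∀ l, ‖k l‖ ≤ A * (ρ ^ 2) ^ l)
    (hy : ∀ᵐ ω ∂μ, ∀ n, y n ω = linProc e k n ω)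
    (hB : 0 ≤ B) (hc : ∀ j, ‖c j‖ ≤ B * (ρ ^ 2) ^ j) (hB' : 0 ≤ B')
    (ha : ∀ j, ‖a j‖ ≤ B' * (ρ ^ 2) ^ j) {G : F → ℝ} (hG : PolyLipschitz G) :
    MomentBounded μ (fun (N : ℕ) ω =>
      (N : ℝ)⁻¹ * ∑ n ∈ Finset.Icc 1 N, G (linProcCut y c n n ω - a n) -
        ∫ ω', G (linProc e (convCoeff k c) 0 ω') ∂μ) (fun N => (√(N + 1))⁻¹) := by
  have hr0 : 0 < ρ ^ 2 := by positivity
  have hr1 : ρ ^ 2 < 1 := pow_lt_one₀ h0.le h1 (by norm_num)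
  have hyM := he.momentBounded_filtered hr0 hr1 hA hk hy
  have hpos : 0 < 1 - ρ := by linarith
  have hlam := norm_convCoeff_le hB h0 h1 hk hc
  set I := ∫ ω', G (linProc e (convCoeff k c) 0 ω') ∂μ with hI
  have hw : ∀ N : ℕ, (N : ℝ)⁻¹ * (N + 1) ≤ 2 := by
    intro N
    rcases Nat.eq_zero_or_pos N with rfl | hN
    · simp
    · have : (1 : ℝ) ≤ N := by exact_mod_cast hN
      rw [inv_mul_le_iff₀ (by linarith)]; linarith
  have hsq : ∀ N : ℕ, 0 < √((N : ℝ) + 1) := fun N => Real.sqrt_pos.2 (by positivity)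
  have hsq1 : ∀ N : ℕ, 1 ≤ √((N : ℝ) + 1) := fun N => by
    rw [Real.one_le_sqrt]; linarith [Nat.cast_nonneg (α := ℝ) N]
  have hsqm : ∀ N : ℕ, √((N : ℝ) + 1) * √((N : ℝ) + 1) = N + 1 := fun N =>
    Real.mul_self_sqrt (by positivity)
  have t1 := ((he.momentBounded_sum_linProc h0 h1 (by positivity) hlam hG).comp
    fun N : ℕ => Finset.Icc 1 N).weight fun N => (N : ℝ)⁻¹
  have t1' := t1.mono_right (g := fun N : ℕ => (√((N : ℝ) + 1))⁻¹) zero_le_two fun N => by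
    rw [Nat.card_Icc, Nat.add_sub_cancel, abs_of_nonneg (by positivity), ← div_eq_mul_inv,
      le_div_iff₀ (hsq N), mul_assoc, hsqm]
    exact hw N
  -- The transients form a geometric series, so their mean is of order `N⁻¹`.
  have t2 := (((momentBounded_comp_linProcCut_sub hyM hr0 hr1 hB hc hB' ha hG).sum (fun n => by positivity)
    fun N : ℕ => Finset.Icc 1 N)).weight fun N => (N : ℝ)⁻¹
  have t2' := t2.mono_right (g := fun N : ℕ => (√((N : ℝ) + 1))⁻¹) (c := 2 * (1 - ρ ^ 2)⁻¹)
    (by have : 0 < 1 - ρ ^ 2 := by linarith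
        positivity) fun N => by
    have h3 : ∑ n ∈ Finset.Icc 1 N, (ρ ^ 2) ^ n ≤ (1 - ρ ^ 2)⁻¹ := by
      rw [← tsum_geometric_of_lt_one hr0.le hr1]
      exact (summable_geometric_of_lt_one hr0.le hr1).sum_le_tsum _ fun j _ => by positivity
    rw [abs_of_nonneg (by positivity), ← div_eq_mul_inv, le_div_iff₀ (hsq N)]
    have h4 : √((N : ℝ) + 1) ≤ N + 1 := by
      nlinarith [hsq1 N, hsqm N]
    have h5 : 0 ≤ ∑ n ∈ Finset.Icc 1 N, (ρ ^ 2) ^ n := Finset.sum_nonneg fun n _ => by positivity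
    calc (N : ℝ)⁻¹ * (∑ n ∈ Finset.Icc 1 N, (ρ ^ 2) ^ n) * √((N : ℝ) + 1)
        ≤ (N : ℝ)⁻¹ * (∑ n ∈ Finset.Icc 1 N, (ρ ^ 2) ^ n) * (N + 1) := by gcongr
      _ = ((N : ℝ)⁻¹ * (N + 1)) * ∑ n ∈ Finset.Icc 1 N, (ρ ^ 2) ^ n := by ring
      _ ≤ 2 * (1 - ρ ^ 2)⁻¹ := mul_le_mul (hw N) h3 h5 zero_le_two
  -- This term vanishes for `N ≥ 1`; it accounts for `N = 0`, where `(N : ℝ)⁻¹ * N` is `0`. The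
  -- weight uses `N + 1` so that the bound covers this index.
  have t3 : MomentBounded μ (fun (N : ℕ) (_ : Ω) => ((N : ℝ)⁻¹ * N - 1) * I)
      (fun N => (√((N : ℝ) + 1))⁻¹) := by
    refine MomentBounded.of_const_le (abs_nonneg I) fun N => ?_
    rcases Nat.eq_zero_or_pos N with rfl | hN
    · simp
    · have : (N : ℝ) ≠ 0 := by positivity
      rw [inv_mul_cancel₀ this]
      simp only [sub_self, zero_mul, abs_zero]
      positivity
  have hae : ∀ᵐ ω ∂μ, ∀ n : ℕ, linProc y c n ω = linProc e (convCoeff k c) n ω := by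
    filter_upwards [(he.moments.envelope h0 h1).1, hy] with ω hs hω n
    rw [← linProc_linProc hB h0 h1 hk hc hs]
    simp only [linProc, hω]
  have habs : MomentBounded μ (fun (N : ℕ) ω =>
      |(N : ℝ)⁻¹ * ∑ n ∈ Finset.Icc 1 N, (G (linProc e (convCoeff k c) n ω) - I)| +
      (N : ℝ)⁻¹ * ∑ n ∈ Finset.Icc 1 N, ‖G (linProcCut y c n n ω - a n) - G (linProc y c n ω)‖ +
      |((N : ℝ)⁻¹ * N - 1) * I|) (fun N => (√((N : ℝ) + 1))⁻¹) :=
    ((t1'.mono fun N ω => (abs_abs _).le).add t2' fun N => by positivity).add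
      (t3.mono fun N ω => (abs_abs _).le) fun N => by positivity
  refine habs.mono_ae fun N => ?_
  filter_upwards [hae] with ω hω
  refine le_trans ?_ (le_abs_self _)
  have hdec : (N : ℝ)⁻¹ * ∑ n ∈ Finset.Icc 1 N, G (linProcCut y c n n ω - a n) - I =
      (N : ℝ)⁻¹ * ∑ n ∈ Finset.Icc 1 N, (G (linProc e (convCoeff k c) n ω) - I) +
      (N : ℝ)⁻¹ * ∑ n ∈ Finset.Icc 1 N, (G (linProcCut y c n n ω - a n) - G (linProc y c n ω)) +
      ((N : ℝ)⁻¹ * N - 1) * I := by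
    simp only [hω, Finset.sum_sub_distrib, Finset.sum_const, Nat.card_Icc, Nat.add_sub_cancel,
      nsmul_eq_mul]
    ring
  rw [hdec]
  refine (abs_add_le _ _).trans (add_le_add ((abs_add_le _ _).trans (add_le_add le_rfl ?_)) le_rfl)
  rw [abs_mul, abs_of_nonneg (by positivity : (0 : ℝ) ≤ (N : ℝ)⁻¹)]
  exact mul_le_mul_of_nonneg_left (Finset.abs_sum_le_sum_abs _ _) (by positivity)

/-- In finite dimension the norm is controlled by finitely many coordinates, each of which falls
under the real case. -/
lemma IsNoise.momentBounded_sampleMean [NormedSpace ℝ W] [FiniteDimensional ℝ W]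
    (he : IsNoise μ e) (h0 : 0 < ρ) (h1 : ρ < 1)
    (hA : 0 ≤ A) (hk : ∀ l, ‖k l‖ ≤ A * (ρ ^ 2) ^ l)
    (hy : ∀ᵐ ω ∂μ, ∀ n, y n ω = linProc e k n ω)
    (hB : 0 ≤ B) (hc : ∀ j, ‖c j‖ ≤ B * (ρ ^ 2) ^ j) (hB' : 0 ≤ B')
    (ha : ∀ j, ‖a j‖ ≤ B' * (ρ ^ 2) ^ j) {G : F → W} (hG : PolyLipschitz G) :
    MomentBounded μ (fun (N : ℕ) ω =>
      ‖(N : ℝ)⁻¹ • ∑ n ∈ Finset.Icc 1 N, G (linProcCut y c n n ω - a n) -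
        ∫ ω', G (linProc e (convCoeff k c) 0 ω') ∂μ‖) (fun N => (√(N + 1))⁻¹) := by
  have : CompleteSpace W := FiniteDimensional.complete ℝ W
  let b := Module.finBasis ℝ W
  let φ : Fin (Module.finrank ℝ W) → W →L[ℝ] ℝ := fun i => LinearMap.toContinuousLinearMap (b.coord i)
  have hpos : 0 < 1 - ρ := by linarith
  have hint := he.integrable_comp_linProc h0 h1 (by positivity) (norm_convCoeff_le hB h0 h1 hk hc)
    hG 0
  have hcoord : ∀ i, MomentBounded μ (fun (N : ℕ) ω =>
      ‖b i‖ * |φ i ((N : ℝ)⁻¹ • ∑ n ∈ Finset.Icc 1 N, G (linProcCut y c n n ω - a n) -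
        ∫ ω', G (linProc e (convCoeff k c) 0 ω') ∂μ)|) (fun N => (√(N + 1))⁻¹) := by
    intro i
    have := he.momentBounded_sampleMean_real h0 h1 hA hk hy hB hc hB' ha (hG.clm_comp (φ i))
    refine MomentBounded.const_mul (this.mono fun N ω => le_of_eq ?_) _
    rw [abs_abs, map_sub, map_smul, map_sum, smul_eq_mul, ← (φ i).integral_comp_comm hint]
  have hsum : ∀ s : Finset (Fin (Module.finrank ℝ W)), MomentBounded μ (fun (N : ℕ) ω =>
      ∑ i ∈ s, ‖b i‖ * |φ i ((N : ℝ)⁻¹ • ∑ n ∈ Finset.Icc 1 N, G (linProcCut y c n n ω - a n) -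
        ∫ ω', G (linProc e (convCoeff k c) 0 ω') ∂μ)|) (fun N => (√((N : ℝ) + 1))⁻¹) := by
    intro s
    induction s using Finset.induction_on with
    | empty =>
      simp only [Finset.sum_empty]
      exact MomentBounded.of_const_le zero_le_one fun N => by simp only [abs_zero]; positivity
    | insert i s hi ih =>
      simp only [Finset.sum_insert hi]
      exact (hcoord i).add ih fun N => by positivity
  refine (hsum Finset.univ).mono fun N ω => ?_
  refine le_trans ?_ (le_abs_self _)
  rw [abs_of_nonneg (norm_nonneg _)]
  set w := (N : ℝ)⁻¹ • ∑ n ∈ Finset.Icc 1 N, G (linProcCut y c n n ω - a n) -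
        ∫ ω', G (linProc e (convCoeff k c) 0 ω') ∂μ
  calc ‖w‖ = ‖∑ i, b.repr w i • b i‖ := by rw [b.sum_repr]
    _ ≤ ∑ i, ‖b.repr w i • b i‖ := norm_sum_le _ _
    _ = _ := Finset.sum_congr rfl fun i _ => by
      rw [norm_smul, mul_comm, Real.norm_eq_abs]; rfl

end SampleMeans

/-! ### Bounded Lipschitz functions and exponentials -/

section BoundedLipschitz

variable {E W W' : Type*} [NormedAddCommGroup E] [NormedAddCommGroup W] [NormedAddCommGroup W']
  {s : Set E} {f : E → W} {a b : ℝ}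

/-- `f` is bounded and Lipschitz on `s` with the constant `a`. -/
def BddLipOn (f : E → W) (s : Set E) (a : ℝ) : Prop :=
  (∀ x ∈ s, ‖f x‖ ≤ a) ∧ ∀ x ∈ s, ∀ y ∈ s, ‖f x - f y‖ ≤ a * ‖x - y‖

namespace BddLipOn

lemma mono (h : BddLipOn f s a) (hab : a ≤ b) : BddLipOn f s b :=
  ⟨fun x hx => (h.1 x hx).trans hab, fun x hx y hy => (h.2 x hx y hy).trans (by gcongr)⟩

lemma mono_set {t : Set E} (h : BddLipOn f s a) (hts : t ⊆ s) : BddLipOn f t a :=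
  ⟨fun x hx => h.1 x (hts hx), fun x hx y hy => h.2 x (hts hx) y (hts hy)⟩

lemma add {g : E → W} (h : BddLipOn f s a) (hg : BddLipOn g s b) :
    BddLipOn (fun x => f x + g x) s (a + b) := by
  refine ⟨fun x hx => (norm_add_le _ _).trans (add_le_add (h.1 x hx) (hg.1 x hx)),
    fun x hx y hy => ?_⟩
  calc ‖f x + g x - (f y + g y)‖ = ‖(f x - f y) + (g x - g y)‖ := by congr 1; abel
    _ ≤ a * ‖x - y‖ + b * ‖x - y‖ :=
      (norm_add_le _ _).trans (add_le_add (h.2 x hx y hy) (hg.2 x hx y hy))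
    _ = _ := by ring

lemma smul {𝕜 : Type*} [NormedField 𝕜] [NormedSpace 𝕜 W] {g : E → 𝕜} (ha : 0 ≤ a) (hb : 0 ≤ b)
    (hg : BddLipOn g s a) (h : BddLipOn f s b) : BddLipOn (fun x => g x • f x) s (2 * (a * b)) := by
  refine ⟨fun x hx => ?_, fun x hx y hy => ?_⟩
  · rw [norm_smul]
    calc ‖g x‖ * ‖f x‖ ≤ a * b := by gcongr; exacts [hg.1 x hx, h.1 x hx]
      _ ≤ _ := by nlinarith [mul_nonneg ha hb]
  · calc ‖g x • f x - g y • f y‖ = ‖g x • (f x - f y) + (g x - g y) • f y‖ := by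
          congr 1; rw [smul_sub, sub_smul]; abel
      _ ≤ ‖g x‖ * ‖f x - f y‖ + ‖g x - g y‖ * ‖f y‖ := by
          refine (norm_add_le _ _).trans (le_of_eq ?_); rw [norm_smul, norm_smul]
      _ ≤ a * (b * ‖x - y‖) + (a * ‖x - y‖) * b := by
          gcongr
          exacts [hg.1 x hx, h.2 x hx y hy, hg.2 x hx y hy, h.1 y hy]
      _ = _ := by ring

lemma clm_comp [NormedSpace ℝ W] [NormedSpace ℝ W'] (L : W →L[ℝ] W') (h : BddLipOn f s a) :
    BddLipOn (fun x => L (f x)) s (‖L‖ * a) := by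
  refine ⟨fun x hx => (L.le_opNorm _).trans (by gcongr; exact h.1 x hx), fun x hx y hy => ?_⟩
  rw [← map_sub, mul_assoc]
  exact (L.le_opNorm _).trans (by gcongr; exact h.2 x hx y hy)

lemma pi {ι : Type*} [Fintype ι] {g : ι → E → W} (ha : 0 ≤ a) (h : ∀ i, BddLipOn (g i) s a) :
    BddLipOn (fun x i => g i x) s a :=
  ⟨fun x hx => (pi_norm_le_iff_of_nonneg ha).2 fun i => (h i).1 x hx,
    fun x hx y hy => (pi_norm_le_iff_of_nonneg (by positivity)).2 fun i => (h i).2 x hx y hy⟩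

end BddLipOn

lemma ContDiffAt.exists_bddLipOn {E : Type*} [NormedAddCommGroup E] [NormedSpace ℝ E]
    {W : Type*} [NormedAddCommGroup W] [NormedSpace ℝ W] {f : E → W} {x : E}
    (hf : ContDiffAt ℝ 1 f x) : ∃ a : ℝ, 0 ≤ a ∧ ∃ t ∈ 𝓝 x, BddLipOn f t a := by
  obtain ⟨K, t, ht, hK⟩ := hf.exists_lipschitzOnWith
  have h1 : ∀ᶠ y in 𝓝 x, ‖f y‖ < ‖f x‖ + 1 :=
    hf.continuousAt.norm.eventually (gt_mem_nhds (lt_add_one _))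
  refine ⟨max K (‖f x‖ + 1), by positivity, t ∩ {y | ‖f y‖ < ‖f x‖ + 1},
    Filter.inter_mem ht h1, fun y hy => hy.2.le.trans (le_max_right _ _), fun y hy z hz => ?_⟩
  have := hK.dist_le_mul y hy.1 z hz.1
  rw [dist_eq_norm, dist_eq_norm] at this
  exact this.trans (by gcongr; exact le_max_left _ _)

end BoundedLipschitz

section ExpLipschitz

lemma norm_exp_I_mul_sub_le (u x y : ℝ) :
    ‖Complex.exp (Complex.I * u * x) - Complex.exp (Complex.I * u * y)‖ ≤ |u| * ‖x - y‖ := by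
  have h1 : Complex.exp (Complex.I * u * x) - Complex.exp (Complex.I * u * y) =
      Complex.exp (Complex.I * ((u * y : ℝ) : ℂ)) *
        (Complex.exp (Complex.I * ((u * (x - y) : ℝ) : ℂ)) - 1) := by
    rw [mul_sub, ← Complex.exp_add, mul_one]
    congr 1 <;> congr 1 <;> push_cast <;> ring
  rw [h1, norm_mul, Complex.norm_exp_I_mul_ofReal, one_mul]
  refine Real.norm_exp_I_mul_ofReal_sub_one_le.trans (le_of_eq ?_)
  rw [norm_mul, Real.norm_eq_abs]

lemma norm_exp_I_mul_mul (u x : ℝ) : ‖Complex.exp (Complex.I * u * x)‖ = 1 := by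
  have : Complex.I * u * x = Complex.I * ((u * x : ℝ) : ℂ) := by push_cast; ring
  rw [this, Complex.norm_exp_I_mul_ofReal]

lemma BddLipOn.exp {E : Type*} [NormedAddCommGroup E] {s : Set E} {f : E → ℝ} {a : ℝ} (ha : 0 ≤ a)
    (h : BddLipOn f s a) (u : ℝ) :
    BddLipOn (fun x => Complex.exp (Complex.I * u * f x)) s (1 + |u| * a) := by
  refine ⟨fun x _ => ?_, fun x hx y hy => ?_⟩
  · rw [norm_exp_I_mul_mul]
    have : 0 ≤ |u| * a := by positivity
    linarith
  · refine (norm_exp_I_mul_sub_le _ _ _).trans ?_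
    calc |u| * ‖f x - f y‖ ≤ |u| * (a * ‖x - y‖) := by gcongr; exact h.2 x hx y hy
      _ ≤ (1 + |u| * a) * ‖x - y‖ := by nlinarith [norm_nonneg (x - y)]

lemma PolyLipschitz.exp {F : Type*} [NormedAddCommGroup F] {f : F → ℝ} (h : PolyLipschitz f)
    (u : ℝ) : PolyLipschitz (fun x => Complex.exp (Complex.I * u * f x)) := by
  obtain ⟨C, r, hC, h⟩ := h
  refine ⟨|u| * C, r, by positivity, fun x y => (norm_exp_I_mul_sub_le _ _ _).trans ?_⟩
  calc _ ≤ |u| * (C * ‖x - y‖ * (1 + ‖x‖ + ‖y‖) ^ r) := by gcongr; exact h x y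
    _ = _ := by ring

end ExpLipschitz

/-! ### Scores and their derivatives as functions of functional and parameter -/

section Scores

variable {p M : ℕ} {F : Type*} [NormedAddCommGroup F] [NormedSpace ℝ F]

/-- The `i`-th partial derivative. -/
def partialDeriv (B : EuclideanSpace ℝ (Fin p) → F) (i : Fin p) (θ : EuclideanSpace ℝ (Fin p)) : F := fderiv ℝ B θ (EuclideanSpace.single i 1)

/-- The score vector belonging to the innovation `θ ↦ Λ (B θ)`. -/
def scoreFun (u : Fin M → ℝ) (c : Fin M → ℂ) (B : EuclideanSpace ℝ (Fin p) → F) (Λ : F →L[ℝ] ℝ) (θ : EuclideanSpace ℝ (Fin p)) :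
    Fin M × Fin p → ℂ := fun a =>
  (Complex.exp (Complex.I * u a.1 * Λ (B θ)) - c a.1) * ((Λ (partialDeriv B a.2 θ) : ℝ) : ℂ)

/-- A real functional on the parameter space as a complex valued map. -/
def complexFunctional (T : EuclideanSpace ℝ (Fin p) →L[ℝ] F) (Λ : F →L[ℝ] ℝ) : EuclideanSpace ℝ (Fin p) →L[ℝ] ℂ :=
  Complex.ofRealCLM ∘L Λ ∘L T

/-- The derivative of one component of the score vector. -/
def scoreDerivComp (u : Fin M → ℝ) (c : Fin M → ℂ) (B : EuclideanSpace ℝ (Fin p) → F) (Λ : F →L[ℝ] ℝ) (θ : EuclideanSpace ℝ (Fin p))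
    (a : Fin M × Fin p) : EuclideanSpace ℝ (Fin p) →L[ℝ] ℂ :=
  (Complex.exp (Complex.I * u a.1 * Λ (B θ)) + -c a.1) •
      complexFunctional (fderiv ℝ (partialDeriv B a.2) θ) Λ +
    (Complex.I * u a.1) • Complex.ofRealCLM (Λ (partialDeriv B a.2 θ)) •
      Complex.exp (Complex.I * u a.1 * Λ (B θ)) • complexFunctional (fderiv ℝ B θ) Λ

/-- The derivative of the score vector. -/
def scoreDeriv (u : Fin M → ℝ) (c : Fin M → ℂ) (B : EuclideanSpace ℝ (Fin p) → F) (Λ : F →L[ℝ] ℝ) (θ : EuclideanSpace ℝ (Fin p)) :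
    EuclideanSpace ℝ (Fin p) →L[ℝ] (Fin M × Fin p → ℂ) :=
  ContinuousLinearMap.piEquivL ℝ (EuclideanSpace ℝ (Fin p)) (fun _ : Fin M × Fin p => ℂ) (scoreDerivComp u c B Λ θ)

variable (u : Fin M → ℝ) (c : Fin M → ℂ) {B : EuclideanSpace ℝ (Fin p) → F} {θ : EuclideanSpace ℝ (Fin p)}

lemma hasFDerivAt_scoreFun (hB : ContDiffAt ℝ 2 B θ) (Λ : F →L[ℝ] ℝ) :
    HasFDerivAt (scoreFun u c B Λ) (scoreDeriv u c B Λ θ) θ := by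
  refine hasFDerivAt_pi'.2 fun a => ?_
  have h1 : HasFDerivAt B (fderiv ℝ B θ) θ := (hB.differentiableAt (by norm_num)).hasFDerivAt
  have h2 : ContDiffAt ℝ 1 (partialDeriv B a.2) θ :=
    (hB.fderiv_right (m := 1) (by norm_num)).clm_apply contDiffAt_const
  have h3 := (h2.differentiableAt (by norm_num)).hasFDerivAt
  have e1 : HasFDerivAt (fun θ => ((Λ (B θ) : ℝ) : ℂ)) (complexFunctional (fderiv ℝ B θ) Λ) θ :=
    Complex.ofRealCLM.hasFDerivAt.comp θ (Λ.hasFDerivAt.comp θ h1)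
  have e2 : HasFDerivAt (fun θ => ((Λ (partialDeriv B a.2 θ) : ℝ) : ℂ))
      (complexFunctional (fderiv ℝ (partialDeriv B a.2) θ) Λ) θ :=
    Complex.ofRealCLM.hasFDerivAt.comp θ (Λ.hasFDerivAt.comp θ h3)
  have e3 := (((e1.const_mul (Complex.I * u a.1)).cexp).sub_const (c a.1)).mul e2
  refine e3.congr_fderiv ?_
  ext v
  simp [scoreDeriv, scoreDerivComp]
  ring

lemma polyLipschitz_complexFunctional (T : EuclideanSpace ℝ (Fin p) →L[ℝ] F) :
    PolyLipschitz (complexFunctional T) := by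
  refine PolyLipschitz.of_lipschitz (C := ‖T‖) (norm_nonneg _) fun Λ Λ' => ?_
  refine ContinuousLinearMap.opNorm_le_bound _ (by positivity) fun v => ?_
  have h1 : (complexFunctional T Λ - complexFunctional T Λ') v = (((Λ - Λ') (T v) : ℝ) : ℂ) := by
    simp [complexFunctional]
  rw [h1, Complex.norm_real]
  calc _ ≤ ‖Λ - Λ'‖ * (‖T‖ * ‖v‖) := ((Λ - Λ').le_opNorm _).trans (by gcongr; exact T.le_opNorm v)
    _ = _ := by ring

lemma polyLipschitz_eval (x : F) : PolyLipschitz (fun Λ : F →L[ℝ] ℝ => Λ x) :=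
  PolyLipschitz.clm (ContinuousLinearMap.apply ℝ ℝ x)

/-- For fixed `θ` the exponential is Lipschitz in `Λ` and the other factor is linear in `Λ`.
Together with the corresponding fact for derivatives, this brings the scores under the law for
sample means. -/
lemma polyLipschitz_scoreFun (B : EuclideanSpace ℝ (Fin p) → F) (θ : EuclideanSpace ℝ (Fin p)) :
    PolyLipschitz (fun Λ : F →L[ℝ] ℝ => scoreFun u c B Λ θ) := by
  refine PolyLipschitz.pi fun a => ?_
  have h1 := ((polyLipschitz_eval (B θ)).exp (u a.1)).add (PolyLipschitz.const (-c a.1))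
  have h2 := (polyLipschitz_eval (partialDeriv B a.2 θ)).clm_comp Complex.ofRealCLM
  simpa [scoreFun, sub_eq_add_neg] using h1.smul h2

lemma polyLipschitz_scoreDeriv (B : EuclideanSpace ℝ (Fin p) → F) (θ : EuclideanSpace ℝ (Fin p)) :
    PolyLipschitz (fun Λ : F →L[ℝ] ℝ => scoreDeriv u c B Λ θ) := by
  refine PolyLipschitz.clm_comp (ContinuousLinearMap.piEquivL ℝ (EuclideanSpace ℝ (Fin p))
    (fun _ : Fin M × Fin p => ℂ)).toContinuousLinearMap (PolyLipschitz.pi fun a => ?_)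
  have h0 := (polyLipschitz_eval (B θ)).exp (u a.1)
  have h2 := (polyLipschitz_eval (partialDeriv B a.2 θ)).clm_comp Complex.ofRealCLM
  exact ((h0.add (PolyLipschitz.const (-c a.1))).smul (polyLipschitz_complexFunctional _)).add
    ((PolyLipschitz.const (Complex.I * u a.1)).smul
      (h2.smul (h0.smul (polyLipschitz_complexFunctional _))))

lemma bddLipOn_apply {s : Set (EuclideanSpace ℝ (Fin p))} {f : EuclideanSpace ℝ (Fin p) → F} {b : ℝ} (Λ : F →L[ℝ] ℝ) (hb : 0 ≤ b)
    (h : BddLipOn f s b) : BddLipOn (fun θ => Λ (f θ)) s (b * (1 + ‖Λ‖)) :=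
  (h.clm_comp Λ).mono (by nlinarith [norm_nonneg Λ])

lemma bddLipOn_complexFunctional {s : Set (EuclideanSpace ℝ (Fin p))} {T : EuclideanSpace ℝ (Fin p) → EuclideanSpace ℝ (Fin p) →L[ℝ] F} {b : ℝ} (Λ : F →L[ℝ] ℝ)
    (h : BddLipOn T s b) :
    BddLipOn (fun θ => complexFunctional (T θ) Λ) s (b * (1 + ‖Λ‖)) := by
  have key : ∀ T : EuclideanSpace ℝ (Fin p) →L[ℝ] F, ‖complexFunctional T Λ‖ ≤ ‖T‖ * (1 + ‖Λ‖) := by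
    intro T
    refine ContinuousLinearMap.opNorm_le_bound _ (by positivity) fun v => ?_
    have h1 : complexFunctional T Λ v = ((Λ (T v) : ℝ) : ℂ) := rfl
    rw [h1, Complex.norm_real]
    calc ‖Λ (T v)‖ ≤ ‖Λ‖ * (‖T‖ * ‖v‖) := (Λ.le_opNorm _).trans (by gcongr; exact T.le_opNorm v)
      _ ≤ (1 + ‖Λ‖) * (‖T‖ * ‖v‖) := by gcongr; linarith
      _ = _ := by ring
  have hsub : ∀ T T' : EuclideanSpace ℝ (Fin p) →L[ℝ] F,
      complexFunctional T Λ - complexFunctional T' Λ = complexFunctional (T - T') Λ := by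
    intro T T'; ext v; simp [complexFunctional]
  refine ⟨fun x hx => (key _).trans (by gcongr; exact h.1 x hx), fun x hx y hy => ?_⟩
  rw [hsub]
  calc _ ≤ ‖T x - T y‖ * (1 + ‖Λ‖) := key _
    _ ≤ (b * ‖x - y‖) * (1 + ‖Λ‖) := by gcongr; exact h.2 x hx y hy
    _ = _ := by ring

/-- The derivatives of the scores are locally bounded and Lipschitz, with constants of polynomial
growth in the functional. -/
lemma exists_bddLipOn_scoreDeriv (hB : ContDiffAt ℝ 3 B θ) :
    ∃ C : ℝ, 0 ≤ C ∧ ∃ t ∈ 𝓝 θ, ∀ Λ : F →L[ℝ] ℝ,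
      BddLipOn (scoreDeriv u c B Λ) t (C * (1 + ‖Λ‖) ^ 3) := by
  have hp : ∀ i, ContDiffAt ℝ 2 (partialDeriv B i) θ := fun i =>
    (hB.fderiv_right (m := 2) (by norm_num)).clm_apply contDiffAt_const
  obtain ⟨b0, hb0, t0, ht0, h0⟩ := (hB.of_le (by norm_num : (1 : WithTop ℕ∞) ≤ 3)).exists_bddLipOn
  obtain ⟨b1, hb1, t1, ht1, h1⟩ := (hB.fderiv_right (m := 1) (by norm_num)).exists_bddLipOn
  have h2 := fun i => ((hp i).of_le (by norm_num : (1 : WithTop ℕ∞) ≤ 2)).exists_bddLipOn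
  choose b2 hb2 t2 ht2 h2 using h2
  have h3 := fun i => ((hp i).fderiv_right (m := 1) (by norm_num)).exists_bddLipOn
  choose b3 hb3 t3 ht3 h3 using h3
  let b := b0 + b1 + ∑ i, b2 i + ∑ i, b3 i
  have hs2 : 0 ≤ ∑ i, b2 i := Finset.sum_nonneg fun i _ => hb2 i
  have hs3 : 0 ≤ ∑ i, b3 i := Finset.sum_nonneg fun i _ => hb3 i
  have hb : 0 ≤ b := by positivity
  have hle0 : b0 ≤ b := by simp only [b]; linarith
  have hle1 : b1 ≤ b := by simp only [b]; linarith
  have hle2 : ∀ i, b2 i ≤ b := fun i => by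
    have := Finset.single_le_sum (f := b2) (fun i _ => hb2 i) (Finset.mem_univ i)
    simp only [b]; linarith
  have hle3 : ∀ i, b3 i ≤ b := fun i => by
    have := Finset.single_le_sum (f := b3) (fun i _ => hb3 i) (Finset.mem_univ i)
    simp only [b]; linarith
  -- The neighbourhood depends on `B` alone, so one choice serves every `Λ`, hence every time and
  -- every path.
  let t := t0 ∩ t1 ∩ (⋂ i, t2 i) ∩ ⋂ i, t3 i
  have ht : t ∈ 𝓝 θ := Filter.inter_mem (Filter.inter_mem (Filter.inter_mem ht0 ht1)
    ((Filter.iInter_mem).2 ht2)) ((Filter.iInter_mem).2 ht3)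
  have k0 : BddLipOn B t b := (h0.mono hle0).mono_set fun x hx => hx.1.1.1
  have k1 : BddLipOn (fderiv ℝ B) t b := (h1.mono hle1).mono_set fun x hx => hx.1.1.2
  have k2 : ∀ i, BddLipOn (partialDeriv B i) t b := fun i =>
    ((h2 i).mono (hle2 i)).mono_set fun x hx => Set.mem_iInter.1 hx.1.2 i
  have k3 : ∀ i, BddLipOn (fderiv ℝ (partialDeriv B i)) t b := fun i =>
    ((h3 i).mono (hle3 i)).mono_set fun x hx => Set.mem_iInter.1 hx.2 i
  let U := ∑ j, |u j|
  let D := ∑ j, ‖c j‖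
  have hU : ∀ j, |u j| ≤ U := fun j =>
    Finset.single_le_sum (f := fun j => |u j|) (fun i _ => abs_nonneg _) (Finset.mem_univ j)
  have hD : ∀ j, ‖c j‖ ≤ D := fun j =>
    Finset.single_le_sum (f := fun j => ‖c j‖) (fun i _ => norm_nonneg _) (Finset.mem_univ j)
  have hU0 : 0 ≤ U := Finset.sum_nonneg fun i _ => abs_nonneg _
  have hD0 : 0 ≤ D := Finset.sum_nonneg fun i _ => norm_nonneg _
  let L := (ContinuousLinearMap.piEquivL ℝ (EuclideanSpace ℝ (Fin p)) (fun _ : Fin M × Fin p => ℂ)).toContinuousLinearMap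
  -- The two summands are those of the product rule. The second has three factors whose bounds each
  -- grow linearly in `1 + ‖Λ‖`, whence the third power.
  let C1 := 2 * ((1 + U * b + D) * b) + 2 * (U * (2 * (b * (2 * ((1 + U * b) * b)))))
  have hC1 : 0 ≤ C1 := by positivity
  refine ⟨‖L‖ * C1, by positivity, t, ht, fun Λ => ?_⟩
  set z := 1 + ‖Λ‖ with hz
  have hz1 : 1 ≤ z := by simp [hz]
  have hz0 : 0 ≤ z := zero_le_one.trans hz1
  have hcomp : ∀ a, BddLipOn (fun θ => scoreDerivComp u c B Λ θ a) t (C1 * z ^ 3) := by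
    intro a
    have m0 : BddLipOn (fun θ => Complex.exp (Complex.I * u a.1 * Λ (B θ))) t
        ((1 + U * b) * z) := ((bddLipOn_apply Λ hb k0).exp (by positivity) (u a.1)).mono (by
      have : |u a.1| * (b * z) ≤ U * (b * z) := by gcongr; exact hU _
      nlinarith)
    have mc : BddLipOn (fun _ : (EuclideanSpace ℝ (Fin p)) => -c a.1) t (D * z) := by
      refine ⟨fun x _ => ?_, fun x _ y _ => by simp; positivity⟩
      rw [norm_neg]
      exact (hD _).trans (le_mul_of_one_le_right hD0 hz1)
    have mu : BddLipOn (fun _ : (EuclideanSpace ℝ (Fin p)) => Complex.I * (u a.1 : ℂ)) t U := by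
      refine ⟨fun x _ => ?_, fun x _ y _ => by simp; positivity⟩
      simpa using hU a.1
    have m1 := bddLipOn_complexFunctional Λ (k3 a.2)
    have m2 := bddLipOn_complexFunctional Λ k1
    have m3 : BddLipOn (fun θ => Complex.ofRealCLM (Λ (partialDeriv B a.2 θ))) t (b * z) :=
      ((bddLipOn_apply Λ hb (k2 a.2)).clm_comp Complex.ofRealCLM).mono (by simp [hz])
    have f1 := (m0.add mc).smul (by positivity) (by positivity) m1
    have f2 := mu.smul hU0 (by positivity) (m3.smul (by positivity) (by positivity)
      (m0.smul (by positivity) (by positivity) m2))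
    refine (f1.add f2).mono ?_
    have hz23 : z ^ 2 ≤ z ^ 3 := pow_le_pow_right₀ hz1 (by norm_num)
    calc _ = 2 * ((1 + U * b + D) * b) * z ^ 2 +
          2 * (U * (2 * (b * (2 * ((1 + U * b) * b))))) * z ^ 3 := by rw [← hz]; ring
      _ ≤ 2 * ((1 + U * b + D) * b) * z ^ 3 +
          2 * (U * (2 * (b * (2 * ((1 + U * b) * b))))) * z ^ 3 := by gcongr
      _ = _ := by simp only [C1]; ring
  have := (BddLipOn.pi (by positivity) hcomp).clm_comp L
  rw [← mul_assoc] at this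
  exact this

lemma gradient_apply_eq (f : EuclideanSpace ℝ (Fin p) → ℝ) (θ : EuclideanSpace ℝ (Fin p)) (i : Fin p) :
    gradient f θ i = fderiv ℝ f θ (EuclideanSpace.single i 1) := by
  have h1 : inner ℝ (gradient f θ) (EuclideanSpace.single i (1 : ℝ)) =
      fderiv ℝ f θ (EuclideanSpace.single i 1) := by
    rw [gradient, InnerProductSpace.toDual_symm_apply]
  rw [← h1, EuclideanSpace.inner_single_right]
  simp

/-- Only the germ of `ε` matters for its value and gradient; the representation `Λ ∘ B` is available
merely near admissible parameters. -/
lemma scoreVec_eq_scoreFun {ε : EuclideanSpace ℝ (Fin p) → ℝ} {Λ : F →L[ℝ] ℝ} (hB : DifferentiableAt ℝ B θ)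
    (h : ε =ᶠ[𝓝 θ] fun θ => Λ (B θ)) : scoreVec u c ε θ = scoreFun u c B Λ θ := by
  have h1 : fderiv ℝ ε θ = Λ ∘L fderiv ℝ B θ := by
    rw [h.fderiv_eq]
    exact (Λ.hasFDerivAt.comp θ hB.hasFDerivAt).fderiv
  ext a
  rw [scoreVec, scoreFun, gradient_apply_eq, h1, h.eq_of_nhds]
  rfl

end Scores

/-! ### Critical points of perturbed quadratic costs -/

section QuadraticCost

open Metric

variable {E W : Type*} [NormedAddCommGroup E] [NormedSpace ℝ E]
  [NormedAddCommGroup W] [NormedSpace ℝ W] (Q : W →L[ℝ] W →L[ℝ] ℝ)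

/-- The derivative of `θ ↦ Q (f θ) (f θ)` for a symmetric form `Q`, where `w` and `T` are the
value and the derivative of `f`. -/
def costDeriv (w : W) (T : E →L[ℝ] W) : E →L[ℝ] ℝ := (2 : ℝ) • (Q w ∘L T)

lemma costDeriv_sub_left (w w' : W) (T : E →L[ℝ] W) :
    costDeriv Q (w - w') T = costDeriv Q w T - costDeriv Q w' T := by
  ext v; simp [costDeriv]; ring

lemma costDeriv_sub_right (w : W) (T T' : E →L[ℝ] W) :
    costDeriv Q w (T - T') = costDeriv Q w T - costDeriv Q w T' := by
  ext v; simp [costDeriv]; ring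

lemma norm_costDeriv_le (w : W) (T : E →L[ℝ] W) : ‖costDeriv Q w T‖ ≤ 2 * ‖Q‖ * ‖w‖ * ‖T‖ := by
  rw [costDeriv, norm_smul, Real.norm_ofNat]
  calc (2 : ℝ) * ‖Q w ∘L T‖ ≤ 2 * (‖Q‖ * ‖w‖ * ‖T‖) := by
        gcongr
        exact (ContinuousLinearMap.opNorm_comp_le _ _).trans (by gcongr; exact Q.le_opNorm w)
    _ = _ := by ring

lemma continuous_costDeriv : Continuous fun x : W × (E →L[ℝ] W) => costDeriv Q x.1 x.2 :=
  ((Q.continuous.comp continuous_fst).clm_comp continuous_snd).const_smul (2 : ℝ)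

variable {f : E → W} {f' : E → E →L[ℝ] W} {θ : E} {w : W} {T : E →L[ℝ] W} {r ℓ Y : ℝ}

lemma norm_image_sub_sub_le_of_bddLipOn (hf : ∀ x ∈ closedBall θ r, HasFDerivAt f (f' x) x)
    (hf' : BddLipOn f' (closedBall θ r) ℓ) (hℓ : 0 ≤ ℓ) (hT : ‖f' θ - T‖ ≤ Y) {x y : E}
    (hx : x ∈ closedBall θ r) (hy : y ∈ closedBall θ r) :
    ‖f x - f y - T (x - y)‖ ≤ (Y + ℓ * r) * ‖x - y‖ := by
  have hθ : θ ∈ closedBall θ r := mem_closedBall_self (dist_nonneg.trans hx)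
  refine (convex_closedBall θ r).norm_image_sub_le_of_norm_hasFDerivWithin_le'
    (fun z hz => (hf z hz).hasFDerivWithinAt) (fun z hz => ?_) hy hx
  calc ‖f' z - T‖ = ‖(f' z - f' θ) + (f' θ - T)‖ := by congr 1; abel
    _ ≤ ℓ * ‖z - θ‖ + Y := (norm_add_le _ _).trans (add_le_add (hf'.2 z hz θ hθ) hT)
    _ ≤ ℓ * r + Y := by gcongr; exact mem_closedBall_iff_norm.1 hz
    _ = _ := add_comm _ _

lemma norm_image_sub_le_of_bddLipOn (hf : ∀ x ∈ closedBall θ r, HasFDerivAt f (f' x) x)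
    (hf' : BddLipOn f' (closedBall θ r) ℓ) {x y : E}
    (hx : x ∈ closedBall θ r) (hy : y ∈ closedBall θ r) : ‖f x - f y‖ ≤ ℓ * ‖x - y‖ :=
  (convex_closedBall θ r).norm_image_sub_le_of_norm_hasFDerivWithin_le
    (fun z hz => (hf z hz).hasFDerivWithinAt) (fun z hz => hf'.1 z hz) hy hx

/-- Bilinearity splits the difference into three terms, each with a factor that is small when `Y`
and `r` are. The derivative of the cost is thus approximately linear using only a Lipschitz bound on
`f'`, without second derivatives of `f`. -/
lemma norm_costDeriv_sub_sub_le (hf : ∀ x ∈ closedBall θ r, HasFDerivAt f (f' x) x)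
    (hf' : BddLipOn f' (closedBall θ r) ℓ) (hℓ : 0 ≤ ℓ) (hw : ‖f θ‖ ≤ Y) (hT : ‖f' θ - T‖ ≤ Y)
    {x y : E} (hx : x ∈ closedBall θ r) (hy : y ∈ closedBall θ r) :
    ‖costDeriv Q (f x) (f' x) - costDeriv Q (f y) (f' y) - costDeriv Q (T (x - y)) T‖ ≤
      2 * ‖Q‖ * (Y + ℓ * r) * (2 * ℓ + ‖T‖) * ‖x - y‖ := by
  have hr : 0 ≤ r := dist_nonneg.trans hx
  have hY : 0 ≤ Y := (norm_nonneg _).trans hw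
  have hθ : θ ∈ closedBall θ r := mem_closedBall_self hr
  have e : costDeriv Q (f x) (f' x) - costDeriv Q (f y) (f' y) - costDeriv Q (T (x - y)) T =
      costDeriv Q (f x - f y - T (x - y)) (f' x) + costDeriv Q (T (x - y)) (f' x - T) +
        costDeriv Q (f y) (f' x - f' y) := by
    simp only [costDeriv_sub_left, costDeriv_sub_right]; abel
  have h1 := norm_image_sub_sub_le_of_bddLipOn hf hf' hℓ hT hx hy
  have h2 : ‖f' x - T‖ ≤ Y + ℓ * r := by
    calc ‖f' x - T‖ = ‖(f' x - f' θ) + (f' θ - T)‖ := by congr 1; abel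
      _ ≤ ℓ * ‖x - θ‖ + Y := (norm_add_le _ _).trans (add_le_add (hf'.2 x hx θ hθ) hT)
      _ ≤ ℓ * r + Y := by gcongr; exact mem_closedBall_iff_norm.1 hx
      _ = _ := add_comm _ _
  have h3 : ‖f y‖ ≤ Y + ℓ * r := by
    calc ‖f y‖ = ‖(f y - f θ) + f θ‖ := by congr 1; abel
      _ ≤ ℓ * ‖y - θ‖ + Y :=
        (norm_add_le _ _).trans (add_le_add (norm_image_sub_le_of_bddLipOn hf hf' hy hθ) hw)
      _ ≤ ℓ * r + Y := by gcongr; exact mem_closedBall_iff_norm.1 hy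
      _ = _ := add_comm _ _
  rw [e]
  refine ((norm_add_le _ _).trans (add_le_add_left (norm_add_le _ _) _)).trans ?_
  calc _ ≤ 2 * ‖Q‖ * ((Y + ℓ * r) * ‖x - y‖) * ℓ + 2 * ‖Q‖ * (‖T‖ * ‖x - y‖) * (Y + ℓ * r) +
        2 * ‖Q‖ * (Y + ℓ * r) * (ℓ * ‖x - y‖) := by
        gcongr
        · exact (norm_costDeriv_le Q _ _).trans (by gcongr; exact hf'.1 x hx)
        · exact (norm_costDeriv_le Q _ _).trans (by gcongr; exact T.le_opNorm _)
        · exact (norm_costDeriv_le Q _ _).trans (by gcongr; exact hf'.2 x hx y hy)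
    _ = _ := by ring

/-- Away from the critical points of the limit, a perturbed cost has no critical points. -/
lemma exists_forall_costDeriv_ne_zero {r₀ : ℝ} (hr₀ : 0 < r₀) (hℓ : 0 ≤ ℓ)
    (h0 : costDeriv Q w T ≠ 0) :
    ∃ r > 0, ∃ δ > 0, ∀ (f : E → W) (f' : E → E →L[ℝ] W),
      (∀ x ∈ ball θ r₀, HasFDerivAt f (f' x) x) → BddLipOn f' (ball θ r₀) ℓ →
      ‖f θ - w‖ ≤ δ → ‖f' θ - T‖ ≤ δ → ∀ x ∈ ball θ r, costDeriv Q (f x) (f' x) ≠ 0 := by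
  have hev : ∀ᶠ x : W × (E →L[ℝ] W) in 𝓝 (w, T), costDeriv Q x.1 x.2 ≠ 0 :=
    (continuous_costDeriv Q).continuousAt.eventually_ne h0
  obtain ⟨s, hs, hball⟩ := Metric.eventually_nhds_iff.1 hev
  -- The distance `s` is split in three: one third for the perturbation at `θ`, one for moving from
  -- `θ` to `x`, and one to spare.
  have hr : 0 < min (r₀ / 2) (s / (3 * (ℓ + 1))) := by positivity
  refine ⟨_, hr, s / 3, by positivity, fun f f' hf hf' h1 h2 x hx => ?_⟩
  have hsub : closedBall θ (r₀ / 2) ⊆ ball θ r₀ := closedBall_subset_ball (by linarith)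
  have hθ : θ ∈ closedBall θ (r₀ / 2) := mem_closedBall_self (by positivity)
  have hx' : x ∈ closedBall θ (r₀ / 2) :=
    ball_subset_closedBall (ball_subset_ball (min_le_left _ _) hx)
  have hd : ℓ * ‖x - θ‖ ≤ s / 3 := by
    have : ‖x - θ‖ ≤ s / (3 * (ℓ + 1)) := (mem_ball_iff_norm.1 hx).le.trans (min_le_right _ _)
    calc ℓ * ‖x - θ‖ ≤ (ℓ + 1) * (s / (3 * (ℓ + 1))) := by gcongr; linarith
      _ = _ := by field_simp
  have k1 : ‖f x - f θ‖ ≤ ℓ * ‖x - θ‖ := norm_image_sub_le_of_bddLipOn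
    (fun z hz => hf z (hsub hz)) (hf'.mono_set hsub) hx' hθ
  have k2 := hf'.2 x (hsub hx') θ (hsub hθ)
  refine @hball (f x, f' x) ?_
  rw [Prod.dist_eq, max_lt_iff, dist_eq_norm, dist_eq_norm]
  constructor
  · calc ‖f x - w‖ = ‖(f x - f θ) + (f θ - w)‖ := by congr 1; abel
      _ ≤ s / 3 + s / 3 := (norm_add_le _ _).trans (add_le_add (k1.trans hd) h1)
      _ < s := by linarith
  · calc ‖f' x - T‖ = ‖(f' x - f' θ) + (f' θ - T)‖ := by congr 1; abel
      _ ≤ s / 3 + s / 3 := (norm_add_le _ _).trans (add_le_add (k2.trans hd) h2)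
      _ < s := by linarith

/-- Near a nondegenerate zero of the limit function, a perturbed cost has exactly one critical
point, and one Newton step approximates it up to a quadratic error. -/
lemma exists_unique_costDeriv_eq_zero [CompleteSpace E] {r₀ : ℝ} (hr₀ : 0 < r₀) (hℓ : 0 ≤ ℓ)
    (R : E ≃L[ℝ] (E →L[ℝ] ℝ)) (hR : ∀ v, R v = costDeriv Q (T v) T) {s : Set E} (hs : s ∈ 𝓝 θ) :
    ∃ r > 0, ∃ δ > 0, ∃ C, 0 ≤ C ∧ ∀ (f : E → W) (f' : E → E →L[ℝ] W) (Y : ℝ),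
      (∀ x ∈ ball θ r₀, HasFDerivAt f (f' x) x) → BddLipOn f' (ball θ r₀) ℓ →
      Y ≤ δ → ‖f θ‖ ≤ Y → ‖f' θ - T‖ ≤ Y →
      (∃ x ∈ s, costDeriv Q (f x) (f' x) = 0) ∧
      (∀ x ∈ ball θ r, ∀ y ∈ ball θ r,
        costDeriv Q (f x) (f' x) = 0 → costDeriv Q (f y) (f' y) = 0 → x = y) ∧
      ∀ x ∈ ball θ r, costDeriv Q (f x) (f' x) = 0 →
        ‖x - θ + R.symm (costDeriv Q (f θ) (f' θ))‖ ≤ C * Y ^ 2 := by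
  obtain ⟨r₁, hr₁, hball⟩ := Metric.mem_nhds_iff.1 hs
  set A : ℝ := ‖(R.symm : (E →L[ℝ] ℝ) →L[ℝ] E)‖ with hA
  have hA0 : 0 ≤ A := by rw [hA]; positivity
  -- Adding `1` keeps `κ` positive even if `E` is trivial.
  set κ : ℝ := A + 1 with hκ
  have hκ0 : 0 < κ := by positivity
  set L : ℝ := 2 * ℓ + ‖T‖ with hL
  have hL0 : 0 ≤ L := by positivity
  set q : ℝ := 2 * ‖Q‖ with hq
  have hq0 : 0 ≤ q := by positivity
  -- The radius and the second entry of `δ` each contribute `1 / (4 κ)` to the Lipschitz constant of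
  -- the nonlinear part. The third entry of `δ` makes the value at `θ` so small that the image of
  -- the ball of radius `r` contains `0`.
  set r : ℝ := min (min (r₀ / 2) (r₁ / 2)) (1 / (4 * κ * (q * ℓ * L + 1))) with hr
  have hrpos : 0 < r := by positivity
  set δ : ℝ := min 1 (min (1 / (4 * κ * (q * L + 1))) (r / (2 * κ * (q * (‖T‖ + 1) + 1))))
  have hδpos : 0 < δ := by positivity
  have hrr : r ≤ r₀ / 2 := (min_le_left _ _).trans (min_le_left _ _)
  have hsub : closedBall θ r ⊆ ball θ r₀ := closedBall_subset_ball (by linarith)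
  have hsub1 : closedBall θ r ⊆ ball θ r₁ := closedBall_subset_ball (by
    have : r ≤ r₁ / 2 := (min_le_left _ _).trans (min_le_right _ _)
    linarith)
  set B : ℝ := 2 * (A * (q * (‖T‖ + 1))) with hB
  have hB0 : 0 ≤ B := by positivity
  refine ⟨r, hrpos, δ, hδpos, A * (q * (1 + ℓ * B) * L * B), by positivity,
    fun f f' Y hf hf' hYδ hw hT => ?_⟩
  have hY : 0 ≤ Y := (norm_nonneg _).trans hw
  have hY1 : Y ≤ 1 := hYδ.trans (min_le_left _ _)
  set Φ : E → (E →L[ℝ] ℝ) := fun x => costDeriv Q (f x) (f' x) with hΦ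
  -- All radii up to `r` are needed: `r` itself for existence and uniqueness, and `‖x - θ‖` for the
  -- quadratic error.
  have key : ∀ ρ ≤ r, ∀ x ∈ closedBall θ ρ, ∀ y ∈ closedBall θ ρ,
      ‖Φ x - Φ y - R (x - y)‖ ≤ q * (Y + ℓ * ρ) * L * ‖x - y‖ := by
    intro ρ hρ x hx y hy
    have hsub' := (closedBall_subset_closedBall (x := θ) hρ).trans hsub
    rw [hR]
    exact norm_costDeriv_sub_sub_le Q (fun z hz => hf z (hsub' hz)) (hf'.mono_set hsub') hℓ hw hT
      hx hy
  have hc : q * (Y + ℓ * r) * L ≤ 1 / (2 * κ) := by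
    have h1 : q * L * Y ≤ 1 / (4 * κ) := by
      calc q * L * Y ≤ (q * L + 1) * (1 / (4 * κ * (q * L + 1))) := by
            gcongr
            · linarith
            · exact hYδ.trans ((min_le_right _ _).trans (min_le_left _ _))
        _ = _ := by field_simp
    have h2 : q * ℓ * L * r ≤ 1 / (4 * κ) := by
      calc q * ℓ * L * r ≤ (q * ℓ * L + 1) * (1 / (4 * κ * (q * ℓ * L + 1))) := by
            gcongr
            · linarith
            · exact min_le_right _ _
        _ = _ := by field_simp
    calc q * (Y + ℓ * r) * L = q * L * Y + q * ℓ * L * r := by ring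
      _ ≤ 1 / (4 * κ) + 1 / (4 * κ) := add_le_add h1 h2
      _ = _ := by field_simp; norm_num
  have hinv : ∀ z, ‖R.symm z‖ ≤ A * ‖z‖ := fun z =>
    (R.symm : (E →L[ℝ] ℝ) →L[ℝ] E).le_opNorm z
  have hhalf : ∀ x ∈ closedBall θ r, ∀ y ∈ closedBall θ r,
      ‖x - y - R.symm (Φ x - Φ y)‖ ≤ ‖x - y‖ / 2 := by
    intro x hx y hy
    have h1 : x - y - R.symm (Φ x - Φ y) = -R.symm (Φ x - Φ y - R (x - y)) := by
      rw [map_sub R.symm _ (R (x - y)), R.symm_apply_apply]; abel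
    rw [h1, norm_neg]
    calc _ ≤ A * (1 / (2 * κ) * ‖x - y‖) := (hinv _).trans (by
          gcongr; exact (key r le_rfl x hx y hy).trans (by gcongr))
      _ ≤ κ * (1 / (2 * κ) * ‖x - y‖) := by gcongr; linarith
      _ = _ := by field_simp
  have hΦθ : ‖Φ θ‖ ≤ q * (‖T‖ + 1) * Y := by
    have h1 : ‖f' θ‖ ≤ ‖T‖ + 1 := by
      calc ‖f' θ‖ = ‖T + (f' θ - T)‖ := by congr 1; abel
        _ ≤ ‖T‖ + 1 := (norm_add_le _ _).trans (add_le_add le_rfl (hT.trans hY1))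
    calc ‖Φ θ‖ ≤ q * ‖f θ‖ * ‖f' θ‖ := norm_costDeriv_le Q _ _
      _ ≤ q * Y * (‖T‖ + 1) := by gcongr
      _ = _ := by ring
  have hθr : θ ∈ closedBall θ r := mem_closedBall_self hrpos.le
  refine ⟨?_, ?_, ?_⟩
  -- Existence is the quantitative surjectivity in the inverse function theorem: the image of the
  -- closed ball contains a ball of radius `(κ⁻¹ - 1 / (2 κ)) r` around `Φ θ`.
  · have happ : ApproximatesLinearOn Φ (R : E →L[ℝ] (E →L[ℝ] ℝ)) (closedBall θ r)
        (1 / (2 * κ)).toNNReal := by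
      intro x hx y hy
      rw [Real.coe_toNNReal _ (by positivity)]
      exact (key r le_rfl x hx y hy).trans (by gcongr)
    let I : (R : E →L[ℝ] (E →L[ℝ] ℝ)).NonlinearRightInverse :=
      { toFun := R.symm
        nnnorm := κ.toNNReal
        bound' := fun y => by
          rw [Real.coe_toNNReal _ hκ0.le]
          exact (hinv y).trans (by gcongr; linarith)
        right_inv' := fun y => R.apply_symm_apply y }
    have hsurj := happ.surjOn_closedBall_of_nonlinearRightInverse I hrpos.le subset_rfl
    have h0 : (0 : E →L[ℝ] ℝ) ∈ closedBall (Φ θ)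
        (((I.nnnorm : ℝ)⁻¹ - (1 / (2 * κ)).toNNReal) * r) := by
      have hI : (I.nnnorm : ℝ) = κ := Real.coe_toNNReal _ hκ0.le
      rw [hI, Real.coe_toNNReal _ (by positivity), mem_closedBall, dist_zero_left]
      refine hΦθ.trans ?_
      calc q * (‖T‖ + 1) * Y ≤
          (q * (‖T‖ + 1) + 1) * (r / (2 * κ * (q * (‖T‖ + 1) + 1))) := by
            gcongr
            · linarith
            · exact hYδ.trans ((min_le_right _ _).trans (min_le_right _ _))
        _ = _ := by field_simp; norm_num
    obtain ⟨x, hx, hx0⟩ := hsurj h0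
    exact ⟨x, hball (hsub1 hx), hx0⟩
  · intro x hx y hy hx0 hy0
    have := hhalf x (ball_subset_closedBall hx) y (ball_subset_closedBall hy)
    rw [show Φ x = 0 from hx0, show Φ y = 0 from hy0, sub_self, map_zero, sub_zero] at this
    have h0 : ‖x - y‖ = 0 := le_antisymm (by linarith) (norm_nonneg _)
    exact sub_eq_zero.1 (norm_eq_zero.1 h0)
  · intro x hx hx0
    have hx' := ball_subset_closedBall hx
    have h1 := hhalf x hx' θ hθr
    rw [show Φ x = 0 from hx0, zero_sub, map_neg, sub_neg_eq_add] at h1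
    have h2 : ‖x - θ‖ ≤ B * Y := by
      have h3 : ‖x - θ‖ ≤ ‖x - θ‖ / 2 + A * (q * (‖T‖ + 1) * Y) := by
        calc ‖x - θ‖ = ‖(x - θ + R.symm (Φ θ)) - R.symm (Φ θ)‖ := by congr 1; abel
          _ ≤ _ := (norm_sub_le _ _).trans
            (add_le_add h1 ((hinv _).trans (by gcongr)))
      rw [hB]; linarith
    -- The linear bound `‖x - θ‖ ≤ B * Y` is fed back: on the ball of radius `‖x - θ‖` the nonlinear
    -- part has Lipschitz constant of order `Y`, and its contribution is of order `Y ^ 2`.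
    have hρ : ‖x - θ‖ ≤ r := mem_closedBall_iff_norm.1 hx'
    have h4 := key ‖x - θ‖ hρ x (mem_closedBall_iff_norm.2 le_rfl) θ
      (mem_closedBall_self (norm_nonneg _))
    have h5 : x - θ + R.symm (Φ θ) = -R.symm (Φ x - Φ θ - R (x - θ)) := by
      rw [show Φ x = 0 from hx0, map_sub R.symm _ (R (x - θ)), R.symm_apply_apply, zero_sub,
        map_neg]
      abel
    change ‖x - θ + R.symm (Φ θ)‖ ≤ _
    rw [h5, norm_neg]
    calc _ ≤ A * (q * (Y + ℓ * (B * Y)) * L * (B * Y)) := (hinv _).trans (by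
          gcongr; exact h4.trans (by gcongr))
      _ = _ := by ring

/-- Critical points of perturbed costs on a compact set. -/
theorem exists_finset_unique_costDeriv_eq_zero [CompleteSpace E] {D : Set E} (hD : IsCompact D)
    (hθ : D ∈ 𝓝 θ) {rad ℓ : E → ℝ} (hrad : ∀ x ∈ D, 0 < rad x) (hℓ : ∀ x ∈ D, 0 ≤ ℓ x)
    (g : E → W) (g' : E → E →L[ℝ] W) (hg : g θ = 0)
    (R : E ≃L[ℝ] (E →L[ℝ] ℝ)) (hR : ∀ v, R v = costDeriv Q (g' θ v) (g' θ))
    (hne : ∀ x ∈ D, x ≠ θ → costDeriv Q (g x) (g' x) ≠ 0) :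
    ∃ s : Finset E, θ ∈ s ∧ ↑s ⊆ D ∧ ∃ δ > 0, ∃ C, 0 ≤ C ∧
      ∀ (f : E → W) (f' : E → E →L[ℝ] W) (Y : ℝ),
        (∀ x ∈ D, ∀ z ∈ ball x (rad x), HasFDerivAt f (f' z) z) →
        (∀ x ∈ D, BddLipOn f' (ball x (rad x)) (ℓ x)) → Y ≤ δ →
        (∀ x ∈ s, ‖f x - g x‖ ≤ Y ∧ ‖f' x - g' x‖ ≤ Y) →
        (∃! x, x ∈ D ∧ costDeriv Q (f x) (f' x) = 0) ∧
        ∀ x ∈ D, costDeriv Q (f x) (f' x) = 0 →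
          ‖x - θ + R.symm (costDeriv Q (f θ) (f' θ))‖ ≤ C * Y ^ 2 := by
  classical
  have hθD : θ ∈ D := mem_of_mem_nhds hθ
  obtain ⟨r₀, hr₀, δ₀, hδ₀, C, hC, h0⟩ :=
    exists_unique_costDeriv_eq_zero Q (hrad θ hθD) (hℓ θ hθD) R hR hθ
  have hA : ∀ x : D, (x : E) ≠ θ → ∃ r > 0, ∃ δ > 0, ∀ (f : E → W) (f' : E → E →L[ℝ] W),
      (∀ z ∈ ball (x : E) (rad x), HasFDerivAt f (f' z) z) →
      BddLipOn f' (ball (x : E) (rad x)) (ℓ x) →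
      ‖f x - g x‖ ≤ δ → ‖f' x - g' x‖ ≤ δ →
      ∀ z ∈ ball (x : E) r, costDeriv Q (f z) (f' z) ≠ 0 := fun x hx =>
    exists_forall_costDeriv_ne_zero Q (hrad x x.2) (hℓ x x.2) (hne x x.2 hx)
  choose! r hr δ hδ hAf using hA
  -- `D` is covered by balls free of critical points together with one ball around `θ` where the
  -- Newton analysis applies.
  let r' : D → ℝ := fun x => if (x : E) = θ then r₀ else r x
  have hr' : ∀ x, 0 < r' x := fun x => by
    by_cases h : (x : E) = θ <;> simp [r', h, hr₀, hr]
  obtain ⟨t, ht⟩ := hD.elim_finite_subcover (fun x : D => ball (x : E) (r' x))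
    (fun x => isOpen_ball) (fun x hx => Set.mem_iUnion.2 ⟨⟨x, hx⟩, mem_ball_self (hr' _)⟩)
  let δ' : D → ℝ := fun x => if (x : E) = θ then δ₀ else δ x
  have hδ' : ∀ x, 0 < δ' x := fun x => by
    by_cases h : (x : E) = θ <;> simp [δ', h, hδ₀, hδ]
  -- The point `θ` is added by hand, since the finite subcover need not contain it as a centre.
  obtain ⟨δm, hδm, hδm'⟩ : ∃ δm > 0, ∀ x ∈ insert ⟨θ, hθD⟩ t, δm ≤ δ' x := by
    obtain ⟨x₀, -, h⟩ := (insert (⟨θ, hθD⟩ : D) t).exists_min_image δ' ⟨_, t.mem_insert_self _⟩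
    exact ⟨δ' x₀, hδ' _, h⟩
  have hδθ : δm ≤ δ₀ := by simpa [δ'] using hδm' _ (t.mem_insert_self _)
  refine ⟨(insert ⟨θ, hθD⟩ t).image Subtype.val,
    Finset.mem_image.2 ⟨_, t.mem_insert_self _, rfl⟩, fun x hx => ?_, δm, hδm, C, hC,
    fun f f' Y hf hf' hY hfg => ?_⟩
  · obtain ⟨z, -, rfl⟩ := Finset.mem_image.1 (Finset.mem_coe.1 hx)
    exact z.2
  have hfθ := hfg θ (Finset.mem_image.2 ⟨_, t.mem_insert_self _, rfl⟩)
  rw [hg, sub_zero] at hfθ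
  obtain ⟨⟨x₀, hx₀, hx₀'⟩, hun, hquad⟩ := h0 f f' Y (hf θ hθD) (hf' θ hθD) (hY.trans hδθ)
    hfθ.1 hfθ.2
  have hmem : ∀ x ∈ D, costDeriv Q (f x) (f' x) = 0 → x ∈ ball θ r₀ := by
    intro x hx hx0
    obtain ⟨z, hz, hxz⟩ := Set.mem_iUnion₂.1 (ht hx)
    by_cases hzθ : (z : E) = θ
    · simpa [r', hzθ] using hxz
    · have hzs := hfg z (Finset.mem_image.2 ⟨z, Finset.mem_insert_of_mem hz, rfl⟩)
      have hYz : Y ≤ δ z := by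
        simpa [δ', hzθ] using hY.trans (hδm' z (Finset.mem_insert_of_mem hz))
      refine absurd hx0 (hAf z hzθ f f' (hf z z.2) (hf' z z.2) (hzs.1.trans hYz)
        (hzs.2.trans hYz) x ?_)
      simpa [r', hzθ] using hxz
  exact ⟨⟨x₀, ⟨hx₀, hx₀'⟩, fun x hx => hun x (hmem x hx.1 hx.2) x₀ (hmem x₀ hx₀ hx₀') hx.2 hx₀'⟩,
    fun x hx hx0 => hquad x (hmem x hx hx0) hx0⟩

end QuadraticCost

/-! ### The expected score: smoothness, and its zero at the true parameter -/

section ExpectedScore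

variable {Ω : Type*} {mΩ : MeasurableSpace Ω} {μ : Measure Ω} [IsProbabilityMeasure μ]
  {e : ℤ → Ω → ℝ} {ρ C : ℝ} {p M : ℕ} {F : Type*} [NormedAddCommGroup F] [NormedSpace ℝ F]
  {q : ℕ → F →L[ℝ] ℝ} (u : Fin M → ℝ) (c : Fin M → ℂ) {B : EuclideanSpace ℝ (Fin p) → F}
  {θ : EuclideanSpace ℝ (Fin p)}

lemma polyLipschitz_one_add_norm_pow (n : ℕ) :
    PolyLipschitz (fun Λ : F →L[ℝ] ℝ => (1 + ‖Λ‖) ^ n) :=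
  ((PolyLipschitz.const (1 : ℝ)).add
    (PolyLipschitz.clm (ContinuousLinearMap.id ℝ (F →L[ℝ] ℝ))).norm_comp).pow n

/-- Differentiation under the integral: near `θ` the derivatives are dominated by a multiple of `(1
+ ‖Λ‖) ^ 3`, which is integrable for a linear process `Λ`. -/
lemma IsNoise.hasFDerivAt_integral_scoreFun (he : IsNoise μ e) (h0 : 0 < ρ) (h1 : ρ < 1)
    (hC : 0 ≤ C) (hq : ∀ i, ‖q i‖ ≤ C * ρ ^ i) (hB : ContDiffAt ℝ 3 B θ) :
    HasFDerivAt (fun θ => ∫ ω, scoreFun u c B (linProc e q 0 ω) θ ∂μ)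
      (∫ ω, scoreDeriv u c B (linProc e q 0 ω) θ ∂μ) θ := by
  obtain ⟨A, hA, t, ht, hlip⟩ := exists_bddLipOn_scoreDeriv u c hB
  have hev : ∀ᶠ x in 𝓝 θ, ContDiffAt ℝ 2 B x :=
    (hB.of_le (by norm_num : (2 : WithTop ℕ∞) ≤ 3)).eventually (by norm_num)
  refine hasFDerivAt_integral_of_dominated_of_fderiv_le
    (F' := fun θ ω => scoreDeriv u c B (linProc e q 0 ω) θ)
    (bound := fun ω => A * (1 + ‖linProc e q 0 ω‖) ^ 3)
    (s := t ∩ {x | ContDiffAt ℝ 2 B x}) (Filter.inter_mem ht hev) ?_ ?_ ?_ ?_ ?_ ?_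
  · exact Eventually.of_forall fun x =>
      he.aestronglyMeasurable_comp_linProc h0 h1 hq (polyLipschitz_scoreFun u c B x).continuous 0
  · exact he.integrable_comp_linProc h0 h1 hC hq (polyLipschitz_scoreFun u c B θ) 0
  · exact he.aestronglyMeasurable_comp_linProc h0 h1 hq
      (polyLipschitz_scoreDeriv u c B θ).continuous 0
  · exact Eventually.of_forall fun ω x hx => (hlip _).1 x hx.1
  · exact (he.integrable_comp_linProc h0 h1 hC hq (polyLipschitz_one_add_norm_pow 3) 0).const_mul A
  · exact Eventually.of_forall fun ω x hx => hasFDerivAt_scoreFun u c hx.2 _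

lemma IsNoise.continuousAt_integral_scoreDeriv (he : IsNoise μ e) (h0 : 0 < ρ) (h1 : ρ < 1)
    (hC : 0 ≤ C) (hq : ∀ i, ‖q i‖ ≤ C * ρ ^ i) (hB : ContDiffAt ℝ 3 B θ) :
    ContinuousAt (fun θ => ∫ ω, scoreDeriv u c B (linProc e q 0 ω) θ ∂μ) θ := by
  obtain ⟨A, hA, t, ht, hlip⟩ := exists_bddLipOn_scoreDeriv u c hB
  have hI := he.integrable_comp_linProc h0 h1 hC hq (polyLipschitz_one_add_norm_pow 3) 0
  refine tendsto_integral_filter_of_dominated_convergence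
    (fun ω => A * (1 + ‖linProc e q 0 ω‖) ^ 3) ?_ ?_ (hI.const_mul A) ?_
  · exact Eventually.of_forall fun x => he.aestronglyMeasurable_comp_linProc h0 h1 hq
      (polyLipschitz_scoreDeriv u c B x).continuous 0
  · filter_upwards [ht] with x hx
    exact Eventually.of_forall fun ω => (hlip _).1 x hx
  · refine Eventually.of_forall fun ω => tendsto_iff_norm_sub_tendsto_zero.2 ?_
    have hlim : Tendsto (fun x => A * (1 + ‖linProc e q 0 ω‖) ^ 3 * ‖x - θ‖) (𝓝 θ) (𝓝 0) := by
      have : Continuous fun x => A * (1 + ‖linProc e q 0 ω‖) ^ 3 * ‖x - θ‖ := by fun_prop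
      simpa using this.tendsto θ
    refine tendsto_of_tendsto_of_tendsto_of_le_of_le' tendsto_const_nhds hlim
      (Eventually.of_forall fun x => norm_nonneg _) ?_
    filter_upwards [ht] with x hx
    exact (hlip _).2 x hx θ (mem_of_mem_nhds ht)

/-- Each term of the process is centred and independent of `e 0`, so it contributes nothing;
geometric decay allows termwise integration. The factor `φ (e 0 ω)` need not be centred, which is
why the scores are centred for every `η`. -/
lemma IsNoise.integral_mul_linProc_eq_zero (he : IsNoise μ e) (h0 : 0 < ρ) (h1 : ρ < 1)
    (hmean : ∀ n, ∫ ω, e n ω ∂μ = 0) {φ : ℝ → ℂ} (hφ : Measurable φ) {b : ℝ}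
    (hφb : ∀ x, ‖φ x‖ ≤ b) {a : ℕ → ℝ} (ha0 : a 0 = 0) (ha : ∀ i, ‖a i‖ ≤ C * ρ ^ i) :
    ∫ ω, φ (e 0 ω) * ((linProc e a 0 ω : ℝ) : ℂ) ∂μ = 0 := by
  have hb : 0 ≤ b := (norm_nonneg _).trans (hφb 0)
  have hInt : ∀ n, Integrable (e n) μ := fun n =>
    he.moments.integrable (i := n) (he.measurable n).aestronglyMeasurable
  obtain ⟨K, hK, hbd⟩ := he.moments.integral_abs_le fun n => zero_le_one
  have hφe : Measurable fun ω => φ (e 0 ω) := hφ.comp (he.measurable 0)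
  have hFint : ∀ i : ℕ, Integrable (fun ω => φ (e 0 ω) * ((e (0 - i) ω * a i : ℝ) : ℂ)) μ :=
    fun i => (((hInt _).mul_const _).ofReal (𝕜 := ℂ)).bdd_mul hφe.aestronglyMeasurable
      (Eventually.of_forall fun ω => hφb _)
  have hnorm : ∀ i : ℕ, ∫ ω, ‖φ (e 0 ω) * ((e (0 - i) ω * a i : ℝ) : ℂ)‖ ∂μ ≤
      b * (K * (C * ρ ^ i)) := by
    intro i
    calc _ ≤ ∫ ω, b * (|e (0 - i) ω| * ‖a i‖) ∂μ := by
          refine integral_mono (hFint i).norm (((hInt _).abs.mul_const _).const_mul b) fun ω => ?_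
          simp only [norm_mul, Complex.norm_real]
          rw [Real.norm_eq_abs (e _ ω)]
          gcongr
          exact hφb _
      _ = b * ((∫ ω, |e (0 - i) ω| ∂μ) * ‖a i‖) := by
          rw [integral_const_mul, integral_mul_const]
      _ ≤ b * (K * (C * ρ ^ i)) := by
          have := hbd (0 - i)
          rw [mul_one] at this
          gcongr
          exact ha i
  have hsum := hasSum_integral_of_summable_integral_norm hFint
    (Summable.of_nonneg_of_le (fun i => integral_nonneg fun ω => norm_nonneg _) hnorm
      (((summable_geometric_of_lt_one h0.le h1).mul_left C).mul_left K |>.mul_left b))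
  have hzero : ∀ i : ℕ, ∫ ω, φ (e 0 ω) * ((e (0 - i) ω * a i : ℝ) : ℂ) ∂μ = 0 := by
    intro i
    -- Lag `0` is the one term not independent of `e 0`; its coefficient vanishes.
    rcases Nat.eq_zero_or_pos i with rfl | hi
    · simp [ha0]
    · have hne : (0 : ℤ) ≠ 0 - i := by omega
      have hind : IndepFun (fun ω => φ (e 0 ω)) (fun ω => ((e (0 - i) ω * a i : ℝ) : ℂ)) μ :=
        (he.indep.indepFun hne).comp (φ := φ) (ψ := fun x : ℝ => ((x * a i : ℝ) : ℂ)) hφ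
          (by fun_prop)
      have := hind.integral_fun_mul_eq_mul_integral hφe.aestronglyMeasurable
        (((hInt _).mul_const _).ofReal (𝕜 := ℂ)).aestronglyMeasurable
      rw [this]
      have h2 : ∫ ω, ((e (0 - i) ω * a i : ℝ) : ℂ) ∂μ = 0 := by
        rw [integral_complex_ofReal, integral_mul_const, hmean, zero_mul, Complex.ofReal_zero]
      rw [h2, mul_zero]
  simp only [hzero] at hsum
  have h3 := hsum.unique hasSum_zero
  rw [← h3]
  refine integral_congr_ae ?_
  filter_upwards with ω
  rw [linProc, tsum_mul_left, Complex.ofReal_tsum]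
  simp

lemma linProc_apply [CompleteSpace F] (hq : ∀ i, ‖q i‖ ≤ C * ρ ^ i) (h0 : 0 < ρ) {n : ℤ} {ω : Ω}
    (hs : Summable fun i : ℕ => |ρ ^ i * e (n - i) ω|) (x : F) :
    linProc e q n ω x = linProc e (fun i => q i x) n ω :=
  ((ContinuousLinearMap.apply ℝ ℝ x).hasSum (summable_linProc hq h0 hs).hasSum).tsum_eq.symm

/-- The scores are centred at a parameter whose innovation is the noise itself and whose
derivative depends only on the past. -/
lemma IsNoise.integral_scoreFun_eq_zero [CompleteSpace F] (he : IsNoise μ e) (h0 : 0 < ρ)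
    (h1 : ρ < 1) (hC : 0 ≤ C) (hq : ∀ i, ‖q i‖ ≤ C * ρ ^ i) (hmean : ∀ n, ∫ ω, e n ω ∂μ = 0)
    (hB : ∀ i, q i (B θ) = if i = 0 then 1 else 0) (hB' : ∀ i, q 0 (partialDeriv B i θ) = 0) :
    ∫ ω, scoreFun u c B (linProc e q 0 ω) θ ∂μ = 0 := by
  have hint := he.integrable_comp_linProc h0 h1 hC hq (polyLipschitz_scoreFun u c B θ) 0
  ext a
  have e1 : (∫ ω, scoreFun u c B (linProc e q 0 ω) θ ∂μ) a =
      ∫ ω, scoreFun u c B (linProc e q 0 ω) θ a ∂μ :=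
    ((ContinuousLinearMap.proj (R := ℝ) (φ := fun _ : Fin M × Fin p => ℂ) a).integral_comp_comm
      hint).symm
  rw [e1, Pi.zero_apply]
  have key := he.integral_mul_linProc_eq_zero h0 h1 hmean
    (φ := fun x => Complex.exp (Complex.I * u a.1 * x) - c a.1) (by fun_prop)
    (b := 1 + ‖c a.1‖)
    (fun x => (norm_sub_le _ _).trans (by rw [norm_exp_I_mul_mul]))
    (a := fun i => q i (partialDeriv B a.2 θ)) (hB' _) (C := C * ‖partialDeriv B a.2 θ‖)
    (fun i => ((q i).le_opNorm _).trans (by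
      calc _ ≤ C * ρ ^ i * ‖partialDeriv B a.2 θ‖ := by gcongr; exact hq i
        _ = _ := by ring))
  rw [← key]
  refine integral_congr_ae ?_
  filter_upwards [(he.moments.envelope h0 h1).1] with ω hs
  have h2 : linProc e q 0 ω (B θ) = e 0 ω := by
    rw [linProc_apply hq h0 (hs 0), linProc, tsum_eq_single 0]
    · simp [hB]
    · intro i hi; simp [hB, hi]
  rw [scoreFun, h2, linProc_apply hq h0 (hs 0)]

end ExpectedScore

/-! ### Inversion of the system at the true parameter -/

namespace InnovationSystem

variable {p d : ℕ} {S : InnovationSystem p d} {ξ : Fin d → ℝ} {r : ℝ}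
  {θ : EuclideanSpace ℝ (Fin p)}

/-- The sum telescopes, since `b ^ i * (a - b) * a ^ j = b ^ i * a ^ (j + 1) - b ^ (i + 1) * a ^ j`.
It is applied with `a = H` and `b = H - K L`, so that `a - b` is the rank-one matrix `K L`. -/
lemma sum_antidiagonal_pow_mul_sub_mul_pow {R : Type*} [Ring R] (a b : R) (m : ℕ) :
    ∑ q ∈ Finset.HasAntidiagonal.antidiagonal m, b ^ q.1 * (a - b) * a ^ q.2 =
      a ^ (m + 1) - b ^ (m + 1) := by
  induction m with
  | zero => simp
  | succ m ih =>
    rw [Finset.Nat.sum_antidiagonal_succ]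
    have : ∑ q ∈ Finset.HasAntidiagonal.antidiagonal m, b ^ (q.1 + 1) * (a - b) * a ^ q.2 =
        b * (a ^ (m + 1) - b ^ (m + 1)) := by
      rw [← ih, Finset.mul_sum]
      exact Finset.sum_congr rfl fun q _ => by rw [pow_succ']; simp only [mul_assoc]
    rw [this, pow_zero, one_mul, pow_succ' a (m + 1), pow_succ' b (m + 1)]
    noncomm_ring

/-- At the true parameter the inverse filter inverts the output filter. -/
lemma convCoeff_outputCoeff_filterPoint (hr : 0 < r)
    (h : GeomDecay (matrixCLM d (S.invH θ)) r) (i : ℕ) :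
    convCoeff (S.outputCoeff θ) (lagFunctional r) i (S.filterPoint ξ r θ) =
      if i = 0 then 1 else 0 := by
  have hl0 : lagFunctional r 0 (S.filterPoint ξ r θ) = 1 := rfl
  rw [convCoeff, _root_.sum_apply]
  simp only [_root_.smul_apply, smul_eq_mul]
  cases i with
  | zero => simp [hl0, outputCoeff]
  | succ m =>
    rw [Finset.Nat.sum_antidiagonal_succ]
    simp only [hl0, lagFunctional_filterPoint hr h, outputCoeff, mul_one]
    cases m with
    | zero => simp
    | succ m =>
      rw [Finset.Nat.sum_antidiagonal_succ']
      -- A product of two scalar coefficients becomes one expression with the rank-one matrix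
      -- between the powers. The middle of the convolution then telescopes and cancels its two end
      -- terms.
      have hKL : Matrix.vecMulVec (S.K θ) (S.L θ) = S.H θ - S.invH θ := by simp [invH]
      have hterm : ∀ j l : ℕ, (S.L θ ⬝ᵥ (S.H θ ^ l *ᵥ S.K θ)) * -(S.L θ ⬝ᵥ (S.invH θ ^ j *ᵥ S.K θ)) =
          -(S.L θ ⬝ᵥ ((S.invH θ ^ j * (S.H θ - S.invH θ) * S.H θ ^ l) *ᵥ S.K θ)) := by
        intro j l
        rw [← hKL, ← Matrix.mulVec_mulVec, ← Matrix.mulVec_mulVec, Matrix.vecMulVec_mulVec]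
        simp only [op_smul_eq_smul, Matrix.mulVec_smul, dotProduct_smul, smul_eq_mul]
        ring
      simp only [hterm, Finset.sum_neg_distrib]
      rw [← dotProduct_sum, ← Matrix.sum_mulVec, sum_antidiagonal_pow_mul_sub_mul_pow,
        Matrix.sub_mulVec, dotProduct_sub]
      simp only [Nat.add_eq_zero_iff, one_ne_zero, and_false, if_false]
      ring

/-- The leading coefficient of the inverse filter is constantly `1`, so the gradient of the
innovation involves only strictly past observations. -/
lemma lagFunctional_zero_partialDeriv (i : Fin p)
    (hB : DifferentiableAt ℝ (S.filterPoint ξ r) θ) :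
    lagFunctional r 0 (partialDeriv (S.filterPoint ξ r) i θ) = 0 := by
  have h1 : HasFDerivAt (fun θ => lagFunctional r 0 (S.filterPoint ξ r θ))
      (lagFunctional r 0 ∘L fderiv ℝ (S.filterPoint ξ r) θ) θ :=
    (lagFunctional r 0).hasFDerivAt.comp θ hB.hasFDerivAt
  have h2 : HasFDerivAt (fun θ => lagFunctional r 0 (S.filterPoint ξ r θ))
      (0 : EuclideanSpace ℝ (Fin p) →L[ℝ] ℝ) θ := hasFDerivAt_const (1 : ℝ) θ
  exact DFunLike.congr_fun (h1.unique h2) (EuclideanSpace.single i 1)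

end InnovationSystem

/-! ### The weighted quadratic form -/

section WeightedForm

variable {ι : Type*} [Fintype ι] [DecidableEq ι]

/-- The real bilinear form `Re (v^* Q⁻¹ w)`. -/
def weightedForm (Q : Matrix ι ι ℂ) : (ι → ℂ) →L[ℝ] (ι → ℂ) →L[ℝ] ℝ :=
  LinearMap.toContinuousLinearMap
    ((LinearMap.toContinuousLinearMap : ((ι → ℂ) →ₗ[ℝ] ℝ) ≃ₗ[ℝ] _).toLinearMap ∘ₗ
      LinearMap.mk₂ ℝ (fun v w : ι → ℂ => (star v ⬝ᵥ (Q⁻¹ *ᵥ w)).re)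
        (fun v v' w => by simp [add_dotProduct])
        (fun a v w => by
          have : star (a • v) = a • star v := by
            rw [star_smul]; simp
          rw [this, smul_dotProduct]; simp)
        (fun v w w' => by simp [Matrix.mulVec_add, dotProduct_add])
        (fun a v w => by rw [Matrix.mulVec_smul, dotProduct_smul]; simp))

lemma weightedForm_apply (Q : Matrix ι ι ℂ) (v w : ι → ℂ) :
    weightedForm Q v w = (star v ⬝ᵥ (Q⁻¹ *ᵥ w)).re := rfl

lemma weightedForm_comm {Q : Matrix ι ι ℂ} (hQ : Q.IsHermitian) (v w : ι → ℂ) :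
    weightedForm Q v w = weightedForm Q w v := by
  have h : star (star v ⬝ᵥ (Q⁻¹ *ᵥ w)) = star w ⬝ᵥ (Q⁻¹ *ᵥ v) := by
    rw [Matrix.star_dotProduct, Matrix.star_mulVec, hQ.inv.eq, star_star, Matrix.dotProduct_mulVec]
  rw [weightedForm_apply, weightedForm_apply, ← h]
  rfl

lemma hasFDerivAt_weightedSq {Q : Matrix ι ι ℂ} (hQ : Q.IsHermitian) {E : Type*}
    [NormedAddCommGroup E] [NormedSpace ℝ E] {f : E → ι → ℂ} {f' : E →L[ℝ] ι → ℂ} {x : E}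
    (hf : HasFDerivAt f f' x) :
    HasFDerivAt (fun x => weightedSq Q (f x)) (costDeriv (weightedForm Q) (f x) f') x := by
  have h := ((weightedForm Q).hasFDerivAt.comp x hf).clm_apply hf
  refine h.congr_fderiv ?_
  ext v
  simp only [costDeriv, _root_.add_apply, _root_.smul_apply, ContinuousLinearMap.comp_apply,
    ContinuousLinearMap.flip_apply, smul_eq_mul]
  change _ + weightedForm Q (f' v) (f x) = _
  rw [weightedForm_comm hQ (f' v)]
  simp only [Function.comp_apply]
  ring

end WeightedForm

/-! ### Gradient and Hessian of the weighted square -/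

section Gradients

variable {p : ℕ}

lemma gradient_eq_zero_iff (f : EuclideanSpace ℝ (Fin p) → ℝ) (θ : EuclideanSpace ℝ (Fin p)) :
    gradient f θ = 0 ↔ fderiv ℝ f θ = 0 := by
  rw [gradient]
  exact (InnerProductSpace.toDual ℝ (EuclideanSpace ℝ (Fin p))).symm.map_eq_zero_iff

/-- The product rule at a zero of one factor needs only continuity of the other one. -/
lemma HasFDerivAt.clm_apply_of_eq_zero {E W : Type*} [NormedAddCommGroup E] [NormedSpace ℝ E]
    [NormedAddCommGroup W] [NormedSpace ℝ W] (Q : W →L[ℝ] W →L[ℝ] ℝ) {g h : E → W} {g' : E →L[ℝ] W}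
    {x : E} (hg : HasFDerivAt g g' x) (h0 : g x = 0) (hh : ContinuousAt h x) :
    HasFDerivAt (fun y => Q (g y) (h y)) ((Q.flip (h x)) ∘L g') x := by
  rw [hasFDerivAt_iff_isLittleO_nhds_zero] at hg ⊢
  have e : ∀ v, Q (g (x + v)) (h (x + v)) - Q (g x) (h x) - ((Q.flip (h x)) ∘L g') v =
      Q (g (x + v) - g x - g' v) (h (x + v)) + Q (g' v) (h (x + v) - h x) := by
    intro v; simp [h0]
  simp only [e]
  have hcont : Tendsto (fun v => h (x + v)) (𝓝 0) (𝓝 (h x)) := by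
    have : Tendsto (fun v : E => x + v) (𝓝 0) (𝓝 x) := by
      have hc : Continuous fun v : E => x + v := by fun_prop
      simpa using hc.tendsto 0
    exact hh.tendsto.comp this
  refine Asymptotics.IsLittleO.add ?_ ?_
  · refine Asymptotics.IsBigO.trans_isLittleO ?_ hg
    refine Asymptotics.IsBigO.of_bound (‖Q‖ * (‖h x‖ + 1)) ?_
    filter_upwards [hcont.norm.eventually (gt_mem_nhds (lt_add_one ‖h x‖))] with v hv
    calc _ ≤ ‖Q‖ * ‖g (x + v) - g x - g' v‖ * ‖h (x + v)‖ := Q.le_opNorm₂ _ _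
      _ ≤ ‖Q‖ * ‖g (x + v) - g x - g' v‖ * (‖h x‖ + 1) := by gcongr
      _ = _ := by ring
  · have h1 : (fun v => h (x + v) - h x) =o[𝓝 0] fun _ => (1 : ℝ) := by
      rw [Asymptotics.isLittleO_one_iff]
      simpa using hcont.sub_const (h x)
    have h2 : (fun v => g' v) =O[𝓝 0] fun v : E => v := g'.isBigO_id _
    have h3 := h2.norm_norm.mul_isLittleO h1.norm_left
    simp only [mul_one] at h3
    refine Asymptotics.IsBigO.trans_isLittleO ?_ (Asymptotics.isLittleO_norm_right.1 h3)
    refine Asymptotics.IsBigO.of_bound ‖Q‖ (Eventually.of_forall fun v => ?_)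
    calc _ ≤ ‖Q‖ * ‖g' v‖ * ‖h (x + v) - h x‖ := Q.le_opNorm₂ _ _
      _ ≤ _ := by rw [mul_assoc, Real.norm_of_nonneg (by positivity)]

variable {ι : Type*} [Fintype ι] [DecidableEq ι] {Q : Matrix ι ι ℂ}
  {g : EuclideanSpace ℝ (Fin p) → ι → ℂ}
  {g' : EuclideanSpace ℝ (Fin p) → EuclideanSpace ℝ (Fin p) →L[ℝ] ι → ℂ}
  {θ : EuclideanSpace ℝ (Fin p)}

/-- The gradient is bilinear in `g` and `g'`. As `g θ = 0`, the term with the derivative of `g'` is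
absent, and continuity of `g'` at `θ` suffices. -/
lemma hessianMatrix_weightedSq_apply (hQ : Q.IsHermitian) (hg : ∀ᶠ x in 𝓝 θ, HasFDerivAt g (g' x) x)
    (hg' : ContinuousAt g' θ) (h0 : g θ = 0) (i j : Fin p) :
    hessianMatrix (fun x => weightedSq Q (g x)) θ i j =
      2 * weightedForm Q (g' θ (EuclideanSpace.single j 1)) (g' θ (EuclideanSpace.single i 1)) := by
  have h1 : (fun x => gradient (fun x => weightedSq Q (g x)) x i) =ᶠ[𝓝 θ] fun x =>
      (2 : ℝ) * weightedForm Q (g x) (g' x (EuclideanSpace.single i 1)) := by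
    filter_upwards [hg] with x hx
    rw [gradient_apply_eq, (hasFDerivAt_weightedSq hQ hx).fderiv]
    rfl
  have h2 := (hg.self_of_nhds.clm_apply_of_eq_zero (weightedForm Q) h0
    (h := fun x => g' x (EuclideanSpace.single i 1)) (hg'.clm_apply continuousAt_const)).const_mul
      (2 : ℝ)
  rw [hessianMatrix, Matrix.of_apply, h1.fderiv_eq, h2.fderiv]
  rfl

lemma hessianMatrix_weightedSq (hQ : Q.IsHermitian) (hg : ∀ᶠ x in 𝓝 θ, HasFDerivAt g (g' x) x)
    (hg' : ContinuousAt g' θ) (h0 : g θ = 0) :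
    hessianMatrix (fun x => weightedSq Q (g x)) θ =
      (2 : ℝ) • ((jacobianMatrix g θ)ᴴ * Q⁻¹ * jacobianMatrix g θ).map Complex.re := by
  ext i j
  rw [hessianMatrix_weightedSq_apply hQ hg hg' h0, weightedForm_comm hQ, weightedForm_apply]
  have hcol : ∀ j, g' θ (EuclideanSpace.single j 1) = (jacobianMatrix g θ).col j := by
    intro j
    ext a
    have h1 := (hasFDerivAt_pi'.1 hg.self_of_nhds a).fderiv
    simp only [Matrix.col_apply, jacobianMatrix, Matrix.of_apply, h1]
    rfl
  rw [hcol, hcol, Matrix.smul_apply, Matrix.map_apply, smul_eq_mul, Matrix.mul_assoc,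
    Matrix.mul_apply]
  rfl

/-- An invertible Hessian of `x ↦ weightedSq Q (g x)` as an isomorphism onto the dual space. -/
lemma exists_equiv_of_isUnit_hessianMatrix (hQ : Q.IsHermitian)
    (hg : ∀ᶠ x in 𝓝 θ, HasFDerivAt g (g' x) x) (hg' : ContinuousAt g' θ) (h0 : g θ = 0)
    (hunit : IsUnit (hessianMatrix (fun x => weightedSq Q (g x)) θ)) :
    ∃ R : EuclideanSpace ℝ (Fin p) ≃L[ℝ] (EuclideanSpace ℝ (Fin p) →L[ℝ] ℝ),
      (∀ v, R v = costDeriv (weightedForm Q) (g' θ v) (g' θ)) ∧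
      ∀ f : EuclideanSpace ℝ (Fin p) → ℝ, ∀ x,
        R.symm (fderiv ℝ f x) =
          WithLp.toLp 2 ((hessianMatrix (fun x => weightedSq Q (g x)) θ)⁻¹ *ᵥ
            WithLp.ofLp (gradient f x)) := by
  set A := hessianMatrix (fun x => weightedSq Q (g x)) θ with hA
  have hdet : IsUnit A.det := (Matrix.isUnit_iff_isUnit_det _).1 hunit
  have hbasis : ∀ v : EuclideanSpace ℝ (Fin p), v = ∑ i, v i • EuclideanSpace.single i (1 : ℝ) := by
    intro v
    ext k
    simp [Pi.single_apply]
  have hform : ∀ v w, inner ℝ (WithLp.toLp 2 (A *ᵥ WithLp.ofLp v) : EuclideanSpace ℝ (Fin p)) w =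
      costDeriv (weightedForm Q) (g' θ v) (g' θ) w := by
    intro v w
    have h1 : costDeriv (weightedForm Q) (g' θ v) (g' θ) w =
        ∑ i, w i * ∑ j, v j * A i j := by
      conv_lhs => rw [hbasis v, hbasis w]
      simp only [costDeriv, _root_.smul_apply, ContinuousLinearMap.comp_apply, map_sum, map_smul,
        _root_.sum_apply, smul_eq_mul, Finset.mul_sum]
      refine Finset.sum_congr rfl fun i _ => Finset.sum_congr rfl fun j _ => ?_
      rw [hA, hessianMatrix_weightedSq_apply hQ hg hg' h0]
      ring
    rw [h1]
    simp only [PiLp.inner_apply, Matrix.mulVec, dotProduct]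
    refine Finset.sum_congr rfl fun i _ => ?_
    simp [mul_comm]
  let R₀ : EuclideanSpace ℝ (Fin p) ≃ₗ[ℝ] (EuclideanSpace ℝ (Fin p) →L[ℝ] ℝ) :=
    { toFun := fun v => InnerProductSpace.toDual ℝ _ (WithLp.toLp 2 (A *ᵥ WithLp.ofLp v))
      map_add' := fun v w => by simp [Matrix.mulVec_add]
      map_smul' := fun a v => by simp [Matrix.mulVec_smul]
      invFun := fun l => WithLp.toLp 2
        (A⁻¹ *ᵥ WithLp.ofLp ((InnerProductSpace.toDual ℝ (EuclideanSpace ℝ (Fin p))).symm l))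
      left_inv := fun v => by
        simp [Matrix.mulVec_mulVec, Matrix.nonsing_inv_mul _ hdet]
      right_inv := fun l => by
        simp [Matrix.mulVec_mulVec, Matrix.mul_nonsing_inv _ hdet] }
  refine ⟨R₀.toContinuousLinearEquiv, fun v => ?_, fun f x => rfl⟩
  ext w
  rw [← hform]
  rfl

end Gradients

/-! ### The quadratic error bound for the sample equation -/

section QuadraticBound

lemma BddLipOn.sum {E W ι : Type*} [NormedAddCommGroup E] [NormedAddCommGroup W] {t : Set E}
    {f : ι → E → W} {a : ι → ℝ} (s : Finset ι) (h : ∀ i ∈ s, BddLipOn (f i) t (a i)) :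
    BddLipOn (fun x => ∑ i ∈ s, f i x) t (∑ i ∈ s, a i) := by
  refine ⟨fun x hx => (norm_sum_le _ _).trans (Finset.sum_le_sum fun i hi => (h i hi).1 x hx),
    fun x hx y hy => ?_⟩
  rw [← Finset.sum_sub_distrib, Finset.sum_mul]
  exact (norm_sum_le _ _).trans (Finset.sum_le_sum fun i hi => (h i hi).2 x hx y hy)

lemma BddLipOn.const_smul {E W : Type*} [NormedAddCommGroup E] [NormedAddCommGroup W]
    [NormedSpace ℝ W] {t : Set E} {f : E → W} {a : ℝ} (h : BddLipOn f t a) (c : ℝ) :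
    BddLipOn (fun x => c • f x) t (|c| * a) := by
  refine ⟨fun x hx => ?_, fun x hx y hy => ?_⟩
  · rw [norm_smul, Real.norm_eq_abs]
    exact mul_le_mul_of_nonneg_left (h.1 x hx) (abs_nonneg c)
  · rw [← smul_sub, norm_smul, Real.norm_eq_abs, mul_assoc]
    exact mul_le_mul_of_nonneg_left (h.2 x hx y hy) (abs_nonneg c)

lemma MomentBounded.finset_sum {Ω ι κ : Type*} {mΩ : MeasurableSpace Ω} {μ : Measure Ω}
    {X : κ → ι → Ω → ℝ} {f : ι → ℝ} (s : Finset κ) (h : ∀ j ∈ s, MomentBounded μ (X j) f)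
    (hf : ∀ i, 0 ≤ f i) (h0 : MomentBounded μ (fun (_ : ι) (_ : Ω) => (0 : ℝ)) f) :
    MomentBounded μ (fun i ω => ∑ j ∈ s, X j i ω) f := by
  classical
  induction s using Finset.induction_on with
  | empty => simpa using h0
  | insert j s hj ih =>
    simp only [Finset.sum_insert hj]
    exact (h j (Finset.mem_insert_self _ _)).add
      (ih fun i hi => h i (Finset.mem_insert_of_mem hi)) hf

variable {Ω : Type*} {mΩ : MeasurableSpace Ω} {μ : Measure Ω} [IsProbabilityMeasure μ]

/-- Real orders are rounded up to integers, which is allowed because norms over a probability space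
increase with the order. -/
lemma MomentBounded.isOM {E : Type*} [NormedAddCommGroup E] {X : ℕ → Ω → ℝ} {f : ℕ → ℝ}
    (h : MomentBounded μ X f) {Z : ℕ → Ω → E} (hle : ∀ N, 1 ≤ N → ∀ᵐ ω ∂μ, ‖Z N ω‖ ≤ |X N ω|) :
    IsOM μ Z f := by
  intro q hq
  obtain ⟨C, hC, H⟩ := h ⌈q⌉₊ (Nat.one_le_iff_ne_zero.2 (Nat.ceil_pos.2 (by linarith)).ne')
  refine ⟨C, fun N hN => ?_⟩
  obtain ⟨g, hm, hg, hn⟩ := H N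
  have h1 : eLpNorm (Z N) (ENNReal.ofReal q) μ ≤ eLpNorm g (ENNReal.ofReal q) μ := by
    refine eLpNorm_mono_ae ?_
    filter_upwards [hg, hle N hN] with ω h1 h2
    exact (h2.trans h1).trans (le_abs_self _)
  refine h1.trans ((eLpNorm_le_eLpNorm_of_exponent_le ?_ hm).trans hn)
  rw [← ENNReal.ofReal_natCast]
  exact ENNReal.ofReal_le_ofReal (Nat.le_ceil q)

variable {e y : ℤ → Ω → ℝ} {k : ℕ → ℝ} {A A₁ A₂ ρ : ℝ} {p M : ℕ}
  {F : Type*} [NormedAddCommGroup F] [NormedSpace ℝ F]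
  {c a : ℕ → F →L[ℝ] ℝ} (u : Fin M → ℝ) (φ : Fin M → ℂ)
  {B : EuclideanSpace ℝ (Fin p) → F} {θ : EuclideanSpace ℝ (Fin p)}
  {D U : Set (EuclideanSpace ℝ (Fin p))}

/-- The sample mean of the scores. -/
def meanScore (B : EuclideanSpace ℝ (Fin p) → F) (Λ : ℕ → F →L[ℝ] ℝ) (N : ℕ)
    (x : EuclideanSpace ℝ (Fin p)) : Fin M × Fin p → ℂ :=
  (N : ℝ)⁻¹ • ∑ n ∈ Finset.Icc 1 N, scoreFun u φ B (Λ n) x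

/-- The sample mean of the derivatives of the scores. -/
def meanScoreDeriv (B : EuclideanSpace ℝ (Fin p) → F) (Λ : ℕ → F →L[ℝ] ℝ) (N : ℕ)
    (x : EuclideanSpace ℝ (Fin p)) : EuclideanSpace ℝ (Fin p) →L[ℝ] (Fin M × Fin p → ℂ) :=
  (N : ℝ)⁻¹ • ∑ n ∈ Finset.Icc 1 N, scoreDeriv u φ B (Λ n) x

lemma hasFDerivAt_meanScore (hB : ContDiffAt ℝ 2 B θ) (Λ : ℕ → F →L[ℝ] ℝ) (N : ℕ) :
    HasFDerivAt (meanScore u φ B Λ N) (meanScoreDeriv u φ B Λ N θ) θ :=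
  (HasFDerivAt.fun_sum (u := Finset.Icc 1 N)
    fun n _ => hasFDerivAt_scoreFun u φ hB (Λ n)).const_smul (N : ℝ)⁻¹

/-- Solutions of the sample equation, compared with one Newton step from the true parameter: the
error is quadratic in a fluctuation of the order `N^{-1/2}`. -/
theorem IsNoise.exists_quadratic_bound (he : IsNoise μ e) (h0 : 0 < ρ) (h1 : ρ < 1)
    (hA : 0 ≤ A) (hk : ∀ l, ‖k l‖ ≤ A * (ρ ^ 2) ^ l)
    (hy : ∀ᵐ ω ∂μ, ∀ n, y n ω = linProc e k n ω)
    (hA₁ : 0 ≤ A₁) (hc : ∀ j, ‖c j‖ ≤ A₁ * (ρ ^ 2) ^ j) (hA₂ : 0 ≤ A₂)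
    (ha : ∀ j, ‖a j‖ ≤ A₂ * (ρ ^ 2) ^ j)
    (hU : IsOpen U) (hDU : D ⊆ U) (hD : IsCompact D) (hθ : D ∈ 𝓝 θ) (hB : ContDiffOn ℝ 3 B U)
    (Q : (Fin M × Fin p → ℂ) →L[ℝ] (Fin M × Fin p → ℂ) →L[ℝ] ℝ)
    (g : EuclideanSpace ℝ (Fin p) → Fin M × Fin p → ℂ)
    (g' : EuclideanSpace ℝ (Fin p) → EuclideanSpace ℝ (Fin p) →L[ℝ] (Fin M × Fin p → ℂ))
    (hg : ∀ x, g x = ∫ ω, scoreFun u φ B (linProc e (convCoeff k c) 0 ω) x ∂μ)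
    (hg' : ∀ x, g' x = ∫ ω, scoreDeriv u φ B (linProc e (convCoeff k c) 0 ω) x ∂μ)
    (hg0 : g θ = 0)
    (R : EuclideanSpace ℝ (Fin p) ≃L[ℝ] (EuclideanSpace ℝ (Fin p) →L[ℝ] ℝ))
    (hR : ∀ v, R v = costDeriv Q (g' θ v) (g' θ))
    (hne : ∀ x ∈ D, x ≠ θ → costDeriv Q (g x) (g' x) ≠ 0)
    (Λ : ℕ → Ω → F →L[ℝ] ℝ) (hΛ : ∀ n ω, Λ n ω = linProcCut y c n n ω - a n) :
    ∃ Y : ℕ → Ω → ℝ, MomentBounded μ Y (fun N => (√(N + 1))⁻¹) ∧ ∃ C, 0 ≤ C ∧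
      ∀ N ω, ∀ x ∈ D,
        ((∃! z, z ∈ D ∧ costDeriv Q (meanScore u φ B (fun n => Λ n ω) N z)
          (meanScoreDeriv u φ B (fun n => Λ n ω) N z) = 0) →
          costDeriv Q (meanScore u φ B (fun n => Λ n ω) N x)
            (meanScoreDeriv u φ B (fun n => Λ n ω) N x) = 0) →
        ‖x - θ + R.symm (costDeriv Q (meanScore u φ B (fun n => Λ n ω) N θ)
          (meanScoreDeriv u φ B (fun n => Λ n ω) N θ))‖ ≤ C * Y N ω ^ 2 := by
  have hθD : θ ∈ D := mem_of_mem_nhds hθ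
  have hBat : ∀ x ∈ U, ContDiffAt ℝ 3 B x := fun x hx => hB.contDiffAt (hU.mem_nhds hx)
  have hloc : ∀ x ∈ D, ∃ r > 0, ∃ b, 0 ≤ b ∧ Metric.ball x r ⊆ U ∧ ∀ Λ : F →L[ℝ] ℝ,
      BddLipOn (scoreDeriv u φ B Λ) (Metric.ball x r) (b * (1 + ‖Λ‖) ^ 3) := by
    intro x hx
    obtain ⟨b, hb, t, ht, hlip⟩ := exists_bddLipOn_scoreDeriv u φ (hBat x (hDU hx))
    obtain ⟨r, hr, hrt⟩ := Metric.mem_nhds_iff.1 (Filter.inter_mem ht (hU.mem_nhds (hDU hx)))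
    exact ⟨r, hr, b, hb, fun z hz => (hrt hz).2, fun Λ => (hlip Λ).mono_set fun z hz => (hrt hz).1⟩
  choose! rad hrad b hb hradU hlip using hloc
  -- The sample mean of `(1 + ‖Λ n ω‖) ^ 3` controls the Lipschitz constants of the sample
  -- derivatives, and it is at most `I + 1` once `Y ≤ 1`. This replaces a uniform law of large
  -- numbers over `D`.
  set I : ℝ := ∫ ω, (1 + ‖linProc e (convCoeff k c) 0 ω‖) ^ 3 ∂μ with hI
  have hI0 : 0 ≤ I := integral_nonneg fun ω => by positivity
  obtain ⟨s, hθs, hsD, δ, hδ, C, hC, H⟩ := exists_finset_unique_costDeriv_eq_zero Q hD hθ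
    (rad := rad) (ℓ := fun x => b x * (I + 1)) hrad (fun x hx => mul_nonneg (hb x hx) (by linarith))
    g g' hg0 R hR hne
  let T : ℕ → Ω → ℝ := fun N ω => (N : ℝ)⁻¹ • ∑ n ∈ Finset.Icc 1 N, (1 + ‖Λ n ω‖) ^ 3
  let f : ℕ → Ω → EuclideanSpace ℝ (Fin p) → Fin M × Fin p → ℂ :=
    fun N ω => meanScore u φ B (fun n => Λ n ω) N
  let f' : ℕ → Ω → EuclideanSpace ℝ (Fin p) →
      EuclideanSpace ℝ (Fin p) →L[ℝ] (Fin M × Fin p → ℂ) :=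
    fun N ω => meanScoreDeriv u φ B (fun n => Λ n ω) N
  let Y : ℕ → Ω → ℝ := fun N ω => ‖T N ω - I‖ + ∑ x ∈ s, (‖f N ω x - g x‖ + ‖f' N ω x - g' x‖)
  have hw : ∀ N : ℕ, 0 ≤ (√((N : ℝ) + 1))⁻¹ := fun N => by positivity
  have hYm : MomentBounded μ Y (fun N => (√((N : ℝ) + 1))⁻¹) := by
    have hT := he.momentBounded_sampleMean h0 h1 hA hk hy hA₁ hc hA₂ ha
      (polyLipschitz_one_add_norm_pow (F := F) 3)
    simp only [← hΛ] at hT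
    refine hT.add (MomentBounded.finset_sum s (fun x hx => ?_) hw
      (MomentBounded.of_const_le zero_le_one fun N => by simp only [abs_zero]; positivity)) hw
    have hf := he.momentBounded_sampleMean h0 h1 hA hk hy hA₁ hc hA₂ ha
      (polyLipschitz_scoreFun u φ B x)
    have hf' := he.momentBounded_sampleMean h0 h1 hA hk hy hA₁ hc hA₂ ha
      (polyLipschitz_scoreDeriv u φ B x)
    simp only [← hΛ, ← hg, ← hg'] at hf hf'
    exact hf.add hf' hw
  have hY0 : ∀ N ω, 0 ≤ Y N ω := fun N ω => by positivity
  have hYT : ∀ N ω, ‖T N ω - I‖ ≤ Y N ω := fun N ω =>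
    le_add_of_nonneg_right (Finset.sum_nonneg fun x _ => by positivity)
  have hYx : ∀ N ω, ∀ x ∈ s, ‖f N ω x - g x‖ ≤ Y N ω ∧ ‖f' N ω x - g' x‖ ≤ Y N ω := by
    intro N ω x hx
    have h2 := Finset.single_le_sum (f := fun x => ‖f N ω x - g x‖ + ‖f' N ω x - g' x‖)
      (fun x _ => by positivity) hx
    have h3 : ‖f N ω x - g x‖ + ‖f' N ω x - g' x‖ ≤ Y N ω :=
      h2.trans (le_add_of_nonneg_left (norm_nonneg _))
    exact ⟨(le_add_of_nonneg_right (norm_nonneg _)).trans h3,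
      (le_add_of_nonneg_left (norm_nonneg _)).trans h3⟩
  have hfd : ∀ N ω, ∀ x ∈ D, ∀ z ∈ Metric.ball x (rad x), HasFDerivAt (f N ω) (f' N ω z) z :=
    fun N ω x hx z hz => hasFDerivAt_meanScore u φ
      ((hBat z (hradU x hx hz)).of_le (by norm_num : (2 : WithTop ℕ∞) ≤ 3)) _ N
  have hfl : ∀ N ω, Y N ω ≤ 1 → ∀ x ∈ D,
      BddLipOn (f' N ω) (Metric.ball x (rad x)) (b x * (I + 1)) := by
    intro N ω hY1 x hx
    refine ((BddLipOn.sum (Finset.Icc 1 N) fun n _ => hlip x hx (Λ n ω)).const_smul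
      ((N : ℝ)⁻¹)).mono ?_
    rw [← Finset.mul_sum, abs_of_nonneg (by positivity)]
    have hT1 : T N ω ≤ I + 1 := by
      have := (le_abs_self _).trans ((hYT N ω).trans hY1)
      linarith
    calc _ = b x * T N ω := by simp only [T, smul_eq_mul]; ring
      _ ≤ _ := mul_le_mul_of_nonneg_left hT1 (hb x hx)
  obtain ⟨d, hd⟩ := hD.isBounded.exists_norm_le
  have hd0 : 0 ≤ d := (norm_nonneg _).trans (hd θ hθD)
  set κ : ℝ := ‖(R.symm : (EuclideanSpace ℝ (Fin p) →L[ℝ] ℝ) →L[ℝ] EuclideanSpace ℝ (Fin p))‖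
  have hκ0 : 0 ≤ κ := by positivity
  set δ' : ℝ := min δ 1
  have hδ' : 0 < δ' := lt_min hδ one_pos
  -- The second entry is for `Y > δ'`. There `1 ≤ δ'⁻¹ * Y`, so the crude bound by the size of `D`
  -- and of the Newton step is also quadratic in `Y`, and uniqueness of the root is not needed.
  refine ⟨Y, hYm, max C (2 * d * (δ'⁻¹) ^ 2 + κ * (2 * ‖Q‖ * (‖g' θ‖ * δ'⁻¹ + 1))),
    le_max_of_le_left hC, fun N ω x hx hroot => ?_⟩
  have hYN := hY0 N ω
  rcases le_or_gt (Y N ω) δ' with hle | hgt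
  · obtain ⟨hex, hquad⟩ := H (f N ω) (f' N ω) (Y N ω) (hfd N ω)
      (hfl N ω (hle.trans (min_le_right _ _))) (hle.trans (min_le_left _ _)) (hYx N ω)
    exact (hquad x hx (hroot hex)).trans (by gcongr; exact le_max_left _ _)
  · have hYδ : 1 ≤ δ'⁻¹ * Y N ω := by
      rw [← inv_mul_cancel₀ hδ'.ne']; gcongr
    obtain ⟨hf1, hf2⟩ := hYx N ω θ hθs
    rw [hg0, sub_zero] at hf1
    have hf3 : ‖f' N ω θ‖ ≤ ‖g' θ‖ + Y N ω := by
      calc _ = ‖g' θ + (f' N ω θ - g' θ)‖ := by congr 1; abel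
        _ ≤ _ := (norm_add_le _ _).trans (by gcongr)
    have hΓ₀ : ‖costDeriv Q (f N ω θ) (f' N ω θ)‖ ≤
        2 * ‖Q‖ * Y N ω * (‖g' θ‖ + Y N ω) := by
      refine (norm_costDeriv_le Q (f N ω θ) (f' N ω θ)).trans ?_
      have h3 : 2 * ‖Q‖ * ‖f N ω θ‖ ≤ 2 * ‖Q‖ * Y N ω :=
        mul_le_mul_of_nonneg_left hf1 (by positivity)
      exact mul_le_mul h3 hf3 (norm_nonneg _) (by positivity)
    have hΓ : ‖R.symm (costDeriv Q (f N ω θ) (f' N ω θ))‖ ≤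
        κ * (2 * ‖Q‖ * Y N ω * (‖g' θ‖ + Y N ω)) :=
      ((R.symm : (EuclideanSpace ℝ (Fin p) →L[ℝ] ℝ) →L[ℝ] EuclideanSpace ℝ (Fin p)).le_opNorm
        _).trans (mul_le_mul_of_nonneg_left hΓ₀ hκ0)
    have hxd : ‖x - θ‖ ≤ 2 * d := (norm_sub_le _ _).trans (by linarith [hd x hx, hd θ hθD])
    have h2 : (1 : ℝ) ≤ (δ'⁻¹ * Y N ω) ^ 2 := one_le_pow₀ hYδ
    calc ‖x - θ + R.symm (costDeriv Q (f N ω θ) (f' N ω θ))‖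
        ≤ 2 * d + κ * (2 * ‖Q‖ * Y N ω * (‖g' θ‖ + Y N ω)) :=
          (norm_add_le _ _).trans (add_le_add hxd hΓ)
      _ ≤ 2 * d * (δ'⁻¹ * Y N ω) ^ 2 +
          κ * (2 * ‖Q‖ * Y N ω * (‖g' θ‖ * (δ'⁻¹ * Y N ω) + Y N ω)) := by
          refine add_le_add (le_mul_of_one_le_right (by positivity) h2)
            (mul_le_mul_of_nonneg_left (mul_le_mul_of_nonneg_left ?_ (by positivity)) hκ0)
          exact add_le_add (le_mul_of_one_le_right (norm_nonneg _) hYδ) le_rfl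
      _ = (2 * d * (δ'⁻¹) ^ 2 + κ * (2 * ‖Q‖ * (‖g' θ‖ * δ'⁻¹ + 1))) * Y N ω ^ 2 := by ring
      _ ≤ _ := by gcongr; exact le_max_right _ _

end QuadraticBound

/-! ### Dependence of derivatives on germs only -/

section Germs

variable {p : ℕ} {f f₁ : EuclideanSpace ℝ (Fin p) → ℝ} {θ : EuclideanSpace ℝ (Fin p)}

lemma Filter.EventuallyEq.gradient_eq_of_nhds (h : f =ᶠ[𝓝 θ] f₁) :
    gradient f θ = gradient f₁ θ := by
  rw [gradient, gradient, h.fderiv_eq]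

lemma Filter.EventuallyEq.hessianMatrix_eq (h : f =ᶠ[𝓝 θ] f₁) :
    hessianMatrix f θ = hessianMatrix f₁ θ := by
  ext i j
  have h1 : (fun x => gradient f x i) =ᶠ[𝓝 θ] fun x => gradient f₁ x i := by
    filter_upwards [h.eventuallyEq_nhds] with x hx
    rw [hx.gradient_eq_of_nhds]
  simp only [hessianMatrix, Matrix.of_apply, h1.fderiv_eq]

lemma Filter.EventuallyEq.jacobianMatrix_eq {ι : Type*} {g g₁ : EuclideanSpace ℝ (Fin p) → ι → ℂ}
    (h : g =ᶠ[𝓝 θ] g₁) : jacobianMatrix g θ = jacobianMatrix g₁ θ := by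
  ext a j
  have h1 : (fun x => g x a) =ᶠ[𝓝 θ] fun x => g₁ x a := h.fun_comp fun v => v a
  simp only [jacobianMatrix, Matrix.of_apply, h1.fderiv_eq]

end Germs

/-! ### The expansion for a system driven by centred noise -/

namespace InnovationSystem

variable {p d M : ℕ} {Ω : Type*} {mΩ : MeasurableSpace Ω} {μ : Measure Ω} [IsProbabilityMeasure μ]
  {S : InnovationSystem p d} {ξ : Fin d → ℝ} {e y : ℤ → Ω → ℝ} (u : Fin M → ℝ) (φ : Fin M → ℂ)
  {r ρ A : ℝ} {k : ℕ → ℝ} {U : Set (EuclideanSpace ℝ (Fin p))} {θ : EuclideanSpace ℝ (Fin p)}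

lemma scoreMean_eq_meanScore (hr : 0 < r) (hU : IsOpen U)
    (hdec : ∀ x ∈ U, GeomDecay (matrixCLM d (S.invH x)) r)
    (hB : ContDiffOn ℝ 3 (S.filterPoint ξ r) U) (y : ℤ → Ω → ℝ) (N : ℕ) (ω : Ω) (hθ : θ ∈ U) :
    scoreMean S ξ y u φ N ω θ =
      meanScore u φ (S.filterPoint ξ r) (fun n => innovFunctional r y n ω) N θ := by
  have hnhds := hU.mem_nhds hθ
  have hdiff : DifferentiableAt ℝ (S.filterPoint ξ r) θ :=
    (hB.contDiffAt hnhds).differentiableAt (by norm_num)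
  rw [scoreMean, meanScore]
  have h1 : ∑ n ∈ Finset.Icc 1 N, scoreVec u φ (S.innovation ξ y ω n) θ =
      ∑ n ∈ Finset.Icc 1 N, scoreFun u φ (S.filterPoint ξ r) (innovFunctional r y n ω) θ := by
    refine Finset.sum_congr rfl fun n hn => scoreVec_eq_scoreFun u φ hdiff ?_
    filter_upwards [hnhds] with x hx
    exact innovation_eq hr (hdec x hx) y ω (Finset.mem_Icc.1 hn).1
  rw [h1]
  ext a
  simp

/-- The inverse filter applied to the output is one linear process in the noise, with convolved
coefficients, so the results on functions of linear processes apply to it. -/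
lemma asymScore_eq_integral (he : IsNoise μ e) (h0 : 0 < ρ) (h1 : ρ < 1)
    (hA : 0 ≤ A) (hk : ∀ l, ‖k l‖ ≤ A * (ρ ^ 2) ^ l)
    (hy : ∀ᵐ ω ∂μ, ∀ n, y n ω = linProc e k n ω) (hU : IsOpen U)
    (hdec : ∀ x ∈ U, GeomDecay (matrixCLM d (S.invH x)) (ρ ^ 2))
    (hB : ContDiffOn ℝ 3 (S.filterPoint ξ (ρ ^ 2)) U) (hθ : θ ∈ U) :
    asymScore μ S y u φ θ = ∫ ω, scoreFun u φ (S.filterPoint ξ (ρ ^ 2))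
      (linProc e (convCoeff k (lagFunctional (ρ ^ 2))) 0 ω) θ ∂μ := by
  have hr0 : 0 < ρ ^ 2 := by positivity
  have hr1 : ρ ^ 2 < 1 := pow_lt_one₀ h0.le h1 (by norm_num)
  have hnhds := hU.mem_nhds hθ
  have hdiff : DifferentiableAt ℝ (S.filterPoint ξ (ρ ^ 2)) θ :=
    (hB.contDiffAt hnhds).differentiableAt (by norm_num)
  have hlag := norm_lagFunctional_le hr0 hr1
  have hq := norm_convCoeff_le (F := FilterSpace →L[ℝ] ℝ) (c := lagFunctional (ρ ^ 2))
    (inv_nonneg.2 hr0.le) h0 h1 hk hlag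
  have hpos : 0 < 1 - ρ := by linarith
  have hint := he.integrable_comp_linProc h0 h1 (by positivity) hq
    (polyLipschitz_scoreFun u φ (S.filterPoint ξ (ρ ^ 2)) θ) 0
  ext a
  have e1 : (∫ ω, scoreFun u φ (S.filterPoint ξ (ρ ^ 2))
      (linProc e (convCoeff k (lagFunctional (ρ ^ 2))) 0 ω) θ ∂μ) a =
      ∫ ω, scoreFun u φ (S.filterPoint ξ (ρ ^ 2))
        (linProc e (convCoeff k (lagFunctional (ρ ^ 2))) 0 ω) θ a ∂μ :=
    ((ContinuousLinearMap.proj (R := ℝ) (φ := fun _ : Fin M × Fin p => ℂ) a).integral_comp_comm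
      hint).symm
  rw [e1, asymScore]
  refine integral_congr_ae ?_
  filter_upwards [hy, (he.moments.envelope h0 h1).1,
    ((he.momentBounded_filtered hr0 hr1 hA hk hy).envelope hr0 hr1).1] with ω hω hs hs'
  have h2 : linProc y (lagFunctional (ρ ^ 2)) 0 ω =
      linProc e (convCoeff k (lagFunctional (ρ ^ 2))) 0 ω := by
    rw [← linProc_linProc (F := FilterSpace →L[ℝ] ℝ) (c := lagFunctional (ρ ^ 2))
      (inv_nonneg.2 hr0.le) h0 h1 hk hlag hs]
    simp only [linProc, hω]
  rw [scoreVec_eq_scoreFun u φ hdiff]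
  filter_upwards [hnhds] with x hx
  rw [← h2]
  exact statInnovation_eq hr0 hr1 (hdec x hx) (hs' 0)

/-- The asymptotic expansion of the estimator for a system driven by an arbitrary centred noise. -/
theorem hessianMatrix_costW_and_isOM (he : IsNoise μ e) (hmean : ∀ n, ∫ ω, e n ω ∂μ = 0)
    {G D Ds : Set (EuclideanSpace ℝ (Fin p))} (hG : IsOpen G) (hDG : D ⊆ G) (hD : IsCompact D)
    (hDsD : Ds ⊆ interior D) {θs : EuclideanSpace ℝ (Fin p)} (hθs : θs ∈ Ds)
    (hsmooth : S.IsSmoothOn G) (hstable : S.IsStableOn G) (hy : y = S.output θs e)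
    {K : Matrix (Fin M × Fin p) (Fin M × Fin p) ℂ} (hK : K.IsHermitian)
    (huniq : ∃ θ ∈ Ds, gradient (costW μ S y u φ K) θ = 0 ∧
      ∀ θ' ∈ D, gradient (costW μ S y u φ K) θ' = 0 → θ' = θ)
    (hR : IsUnit (hessianMatrix (costW μ S y u φ K) θs)) :
    hessianMatrix (costW μ S y u φ K) θs =
        (2 : ℝ) • ((jacobianMatrix (asymScore μ S y u φ) θs)ᴴ * K⁻¹ *
          jacobianMatrix (asymScore μ S y u φ) θs).map Complex.re ∧
      ∀ θhat : ℕ → Ω → EuclideanSpace ℝ (Fin p),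
        (∀ N, IsScoreRoot μ D (fun ω => costV S ξ y u φ K N ω) (θhat N)) →
        IsOM μ
          (fun N ω => (θhat N ω - θs) -
            -(WithLp.toLp 2 ((hessianMatrix (costW μ S y u φ K) θs)⁻¹ *ᵥ
              WithLp.ofLp (gradient (costV S ξ y u φ K N ω) θs))))
          (fun N => (N : ℝ)⁻¹) := by
  have hθD : D ∈ 𝓝 θs := mem_interior_iff_mem_nhds.1 (hDsD hθs)
  have hθG : θs ∈ G := hDG (mem_of_mem_nhds hθD)
  obtain ⟨ρ, h0, h1, hH, U, hU, hDU, hUG, hdec⟩ :=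
    exists_decay_rate hG hDG hD hsmooth hstable hθG
  have hr0 : 0 < ρ ^ 2 := by positivity
  have hr1 : ρ ^ 2 < 1 := pow_lt_one₀ h0.le h1 (by norm_num)
  have hθU : θs ∈ U := hDU (mem_of_mem_nhds hθD)
  have hUθ : U ∈ 𝓝 θs := hU.mem_nhds hθU
  have hB : ContDiffOn ℝ 3 (S.filterPoint ξ (ρ ^ 2)) U := contDiffOn_filterPoint hr0
    ⟨fun i j => (hsmooth.1 i j).mono hUG, fun i => (hsmooth.2.1 i).mono hUG,
      fun i => (hsmooth.2.2 i).mono hUG⟩ hdec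
  have hBat : ∀ x ∈ U, ContDiffAt ℝ 3 (S.filterPoint ξ (ρ ^ 2)) x :=
    fun x hx => hB.contDiffAt (hU.mem_nhds hx)
  obtain ⟨A, hA, hk⟩ := exists_norm_outputCoeff_le hr0 hH
  have hyk : ∀ᵐ ω ∂μ, ∀ n, y n ω = linProc e (S.outputCoeff θs) n ω := by
    filter_upwards [(he.moments.envelope hr0 hr1).1] with ω hs n
    rw [hy]
    exact output_eq hr0 hk (hs n)
  have hlag := norm_lagFunctional_le hr0 hr1
  have hpos : 0 < 1 - ρ := by linarith
  set q : ℕ → FilterSpace →L[ℝ] ℝ := convCoeff (S.outputCoeff θs) (lagFunctional (ρ ^ 2)) with hqdef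
  set Cq : ℝ := A * (ρ ^ 2)⁻¹ * (1 - ρ)⁻¹
  have hCq : 0 ≤ Cq := by positivity
  have hq : ∀ i, ‖q i‖ ≤ Cq * ρ ^ i := norm_convCoeff_le (F := FilterSpace →L[ℝ] ℝ)
    (c := lagFunctional (ρ ^ 2)) (inv_nonneg.2 hr0.le) h0 h1 hk hlag
  let B := S.filterPoint ξ (ρ ^ 2)
  let g : EuclideanSpace ℝ (Fin p) → Fin M × Fin p → ℂ :=
    fun x => ∫ ω, scoreFun u φ B (linProc e q 0 ω) x ∂μ
  let g' : EuclideanSpace ℝ (Fin p) → EuclideanSpace ℝ (Fin p) →L[ℝ] (Fin M × Fin p → ℂ) :=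
    fun x => ∫ ω, scoreDeriv u φ B (linProc e q 0 ω) x ∂μ
  have hgd : ∀ x ∈ U, HasFDerivAt g (g' x) x := fun x hx =>
    he.hasFDerivAt_integral_scoreFun u φ h0 h1 hCq hq (hBat x hx)
  have hg'c : ContinuousAt g' θs :=
    he.continuousAt_integral_scoreDeriv u φ h0 h1 hCq hq (hBat θs hθU)
  have hg0 : g θs = 0 := by
    refine he.integral_scoreFun_eq_zero u φ h0 h1 hCq hq hmean
      (convCoeff_outputCoeff_filterPoint hr0 (hdec θs hθU)) fun i => ?_
    have hq0 : q 0 = lagFunctional (ρ ^ 2) 0 := by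
      simp [hqdef, convCoeff, outputCoeff]
    rw [hq0]
    exact lagFunctional_zero_partialDeriv i ((hBat θs hθU).differentiableAt (by norm_num))
  have hscore : ∀ x ∈ U, asymScore μ S y u φ x = g x := fun x hx =>
    asymScore_eq_integral u φ he h0 h1 hA hk hyk hU hdec hB hx
  have hcost : ∀ x ∈ U, costW μ S y u φ K =ᶠ[𝓝 x] fun x => weightedSq K (g x) := by
    intro x hx
    filter_upwards [hU.mem_nhds hx] with z hz
    rw [costW, hscore z hz]
  have hgev : ∀ᶠ x in 𝓝 θs, HasFDerivAt g (g' x) x := by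
    filter_upwards [hUθ] with x hx using hgd x hx
  have hess : hessianMatrix (costW μ S y u φ K) θs =
      hessianMatrix (fun x => weightedSq K (g x)) θs := (hcost θs hθU).hessianMatrix_eq
  have hjac : jacobianMatrix (asymScore μ S y u φ) θs = jacobianMatrix g θs := by
    refine Filter.EventuallyEq.jacobianMatrix_eq ?_
    filter_upwards [hUθ] with x hx using hscore x hx
  refine ⟨by rw [hess, hjac]; exact hessianMatrix_weightedSq hK hgev hg'c hg0,
    fun θhat hθhat => ?_⟩
  rw [hess] at hR ⊢
  obtain ⟨R, hRc, hRs⟩ := exists_equiv_of_isUnit_hessianMatrix hK hgev hg'c hg0 hR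
  have hgradW : ∀ x ∈ U, gradient (costW μ S y u φ K) x = 0 ↔
      costDeriv (weightedForm K) (g x) (g' x) = 0 := by
    intro x hx
    rw [gradient_eq_zero_iff, (hcost x hx).fderiv_eq, (hasFDerivAt_weightedSq hK (hgd x hx)).fderiv]
  -- Since `g` vanishes at `θs`, this point is itself critical, so the unique critical point in `D`
  -- must be `θs`.
  have hne : ∀ x ∈ D, x ≠ θs → costDeriv (weightedForm K) (g x) (g' x) ≠ 0 := by
    intro x hx hxne h
    obtain ⟨θ₀, -, -, hun⟩ := huniq
    refine hxne ((hun x hx ((hgradW x (hDU hx)).2 h)).trans (hun θs (mem_of_mem_nhds hθD)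
      ((hgradW θs hθU).2 ?_)).symm)
    rw [hg0]
    ext v
    simp [costDeriv]
  -- The initial state has been propagated `n - 1` steps at time `n`, which costs a factor `(ρ ^
  -- 2)⁻¹`. At `n = 0` natural subtraction gives index `0`, and the same bound holds.
  obtain ⟨Y, hY, C, hC, hquad⟩ := he.exists_quadratic_bound (c := lagFunctional (ρ ^ 2))
    (a := fun n => initFunctional (ρ ^ 2) (n - 1)) u φ h0 h1 hA hk hyk (inv_nonneg.2 hr0.le) hlag
    (inv_nonneg.2 hr0.le) (fun n => (norm_initFunctional_le hr0 _).trans (by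
      cases n with
      | zero => simpa using (one_le_inv₀ hr0).2 hr1.le
      | succ n => rw [Nat.add_sub_cancel, pow_succ' (ρ ^ 2) n, inv_mul_cancel_left₀ hr0.ne']))
    hU hDU hD hθD hB (weightedForm K) g g' (fun x => rfl) (fun x => rfl) hg0 R hRc hne
    (innovFunctional (ρ ^ 2) y) (fun n ω => rfl)
  have hfd : ∀ N ω, ∀ x ∈ U, fderiv ℝ (costV S ξ y u φ K N ω) x =
      costDeriv (weightedForm K)
        (meanScore u φ B (fun n => innovFunctional (ρ ^ 2) y n ω) N x)
        (meanScoreDeriv u φ B (fun n => innovFunctional (ρ ^ 2) y n ω) N x) := by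
    intro N ω x hx
    have h2 : costV S ξ y u φ K N ω =ᶠ[𝓝 x] fun x => weightedSq K
        (meanScore u φ B (fun n => innovFunctional (ρ ^ 2) y n ω) N x) := by
      filter_upwards [hU.mem_nhds hx] with z hz
      rw [costV, scoreMean_eq_meanScore u φ hr0 hU hdec hB y N ω hz]
    rw [h2.fderiv_eq]
    exact (hasFDerivAt_weightedSq hK (hasFDerivAt_meanScore u φ
      ((hBat x hx).of_le (by norm_num : (2 : WithTop ℕ∞) ≤ 3)) _ N)).fderiv
  have hY2 := ((hY.pow (fun N => by positivity) 2).const_mul C).mono_right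
    (g := fun N : ℕ => ((N : ℝ) + 1)⁻¹) zero_le_one fun N => by
      rw [inv_pow, Real.sq_sqrt (by positivity), one_mul]
  have hOM : IsOM μ (fun N ω => (θhat N ω - θs) -
      -(WithLp.toLp 2 ((hessianMatrix (fun x => weightedSq K (g x)) θs)⁻¹ *ᵥ
        WithLp.ofLp (gradient (costV S ξ y u φ K N ω) θs)))) (fun N => ((N : ℝ) + 1)⁻¹) := by
    refine hY2.isOM fun N _ => ?_
    obtain ⟨-, hmem, hroot⟩ := hθhat N
    filter_upwards [hroot] with ω hω
    rw [← hRs, sub_neg_eq_add, hfd N ω θs hθU]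
    refine (hquad N ω (θhat N ω) (hmem ω) fun hex => ?_).trans (le_abs_self _)
    rw [← hfd N ω _ (hDU (hmem ω)), ← gradient_eq_zero_iff]
    refine hω ?_
    obtain ⟨z, ⟨hzD, hz0⟩, hzu⟩ := hex
    refine ⟨z, ⟨hzD, ?_⟩, fun z' hz' => hzu z' ⟨hz'.1, ?_⟩⟩
    · rw [gradient_eq_zero_iff, hfd N ω z (hDU hzD)]
      exact hz0
    · rw [← hfd N ω z' (hDU hz'.1), ← gradient_eq_zero_iff]
      exact hz'.2
  -- Pass from `(N + 1)⁻¹` to `N⁻¹`; the absolute value is taken because `C'` carries no sign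
  -- information.
  intro q' hq'
  obtain ⟨C', hC'⟩ := hOM q' hq'
  refine ⟨|C'|, fun N hN => (hC' N hN).trans (ENNReal.ofReal_le_ofReal ?_)⟩
  have hN' : (0 : ℝ) < N := by exact_mod_cast hN
  exact mul_le_mul (le_abs_self _) (inv_anti₀ hN' (by linarith)) (by positivity) (abs_nonneg _)

end InnovationSystem

/-! ### Iterated forward differences -/

section ForwardDifferences

/-- The first difference costs one derivative by the mean value inequality; induction is applied to
that difference on the shortened interval `[a, b - u]`. -/
lemma norm_fwdDiff_iter_le {E : Type*} [NormedAddCommGroup E] [NormedSpace ℝ E] {a u : ℝ}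
    (hu : 0 ≤ u) (n : ℕ) : ∀ {f : ℝ → E} {b C : ℝ}, ContDiff ℝ n f →
      (∀ x ∈ Set.Icc a b, ‖iteratedDeriv n f x‖ ≤ C) →
      ∀ x, a ≤ x → x + n * u ≤ b → ‖(fwdDiff u)^[n] f x‖ ≤ C * u ^ n := by
  induction n with
  | zero =>
    intro f b C _ hC x hx hxb
    simpa using hC x ⟨hx, by simpa using hxb⟩
  | succ n ih =>
    intro f b C hf hC x hx hxb
    have hfn : ContDiff ℝ n f := hf.of_le (by exact_mod_cast Nat.le_succ n)
    have hshift : ContDiff ℝ n fun z => f (z + u) := hfn.comp (contDiff_id.add contDiff_const)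
    rw [Function.iterate_succ_apply, pow_succ', ← mul_assoc]
    refine ih (b := b - u) (hshift.sub hfn) (fun z hz => ?_) x hx (by push_cast at hxb; linarith)
    have h1 : iteratedDeriv n (fwdDiff u f) z = iteratedDeriv n f (z + u) - iteratedDeriv n f z := by
      rw [show fwdDiff u f = (fun z => f (z + u)) - f from rfl,
        iteratedDeriv_sub hshift.contDiffAt hfn.contDiffAt, iteratedDeriv_comp_add_const]
    have hd : Differentiable ℝ (iteratedDeriv n f) :=
      hf.differentiable_iteratedDeriv n (by exact_mod_cast Nat.lt_succ_self n)
    have h2 := (convex_Icc a b).norm_image_sub_le_of_norm_deriv_le (fun y _ => hd y)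
      (fun y hy => by rw [← iteratedDeriv_succ]; exact hC y hy)
      (⟨hz.1, by linarith [hz.2]⟩ : z ∈ Set.Icc a b)
      (⟨by linarith [hz.1], by linarith [hz.2]⟩ : z + u ∈ Set.Icc a b)
    rw [add_sub_cancel_left, Real.norm_of_nonneg hu] at h2
    exact h1 ▸ h2

end ForwardDifferences

/-! ### Moments from smoothness of the characteristic function -/

section CharacteristicFunctions

variable {Ω : Type*} {mΩ : MeasurableSpace Ω} {μ : Measure Ω} [IsProbabilityMeasure μ]
  {X : Ω → ℝ} {ψ : ℝ → ℂ}

/-- Shifting the argument by `u` multiplies the integrand by `e^{iuX}`, so each difference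
contributes a factor `e^{iuX} - 1`. -/
lemma fwdDiff_iter_charFun (hX : Measurable X)
    (hψ : ∀ u : ℝ, ∫ ω, Complex.exp (Complex.I * u * X ω) ∂μ = ψ u) (u : ℝ) (n : ℕ) :
    ∀ v : ℝ, (fwdDiff u)^[n] ψ v = ∫ ω, Complex.exp (Complex.I * v * X ω) *
      (Complex.exp (Complex.I * u * X ω) - 1) ^ n ∂μ := by
  have hint : ∀ (n : ℕ) (v : ℝ), Integrable (fun ω => Complex.exp (Complex.I * v * X ω) *
      (Complex.exp (Complex.I * u * X ω) - 1) ^ n) μ := by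
    intro n v
    refine Integrable.of_bound (C := 2 ^ n) (by fun_prop) (Eventually.of_forall fun ω => ?_)
    rw [norm_mul, norm_exp_I_mul_mul, one_mul, norm_pow]
    gcongr
    refine (norm_sub_le _ _).trans ?_
    rw [norm_exp_I_mul_mul, norm_one]
    norm_num
  induction n with
  | zero => intro v; simp [hψ]
  | succ n ih =>
    intro v
    rw [Function.iterate_succ_apply', fwdDiff, ih, ih, ← integral_sub (hint n _) (hint n _)]
    refine integral_congr_ae (Eventually.of_forall fun ω => ?_)
    have : Complex.exp (Complex.I * ((v + u : ℝ) : ℂ) * X ω) =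
        Complex.exp (Complex.I * v * X ω) * Complex.exp (Complex.I * u * X ω) := by
      rw [← Complex.exp_add]; congr 1; push_cast; ring
    simp only [this]
    ring

/-- On the unit circle `|z - 1|² = -z⁻¹ (z - 1)²`, so `|z - 1|^{2k}` is `(z - 1)^{2k}` times `(-1)^k
z^{-k}`. The factor `z^{-k}` moves the base point of the difference to `-k u`. -/
lemma integral_norm_exp_sub_one_pow (hX : Measurable X)
    (hψ : ∀ u : ℝ, ∫ ω, Complex.exp (Complex.I * u * X ω) ∂μ = ψ u) (u : ℝ) (k : ℕ) :
    ∫ ω, ‖Complex.exp (Complex.I * u * X ω) - 1‖ ^ (2 * k) ∂μ =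
      ‖(fwdDiff u)^[2 * k] ψ (-(k * u))‖ := by
  have hpt : ∀ ω, ((‖Complex.exp (Complex.I * u * X ω) - 1‖ ^ (2 * k) : ℝ) : ℂ) =
      (-1) ^ k * (Complex.exp (Complex.I * ((-(k * u) : ℝ) : ℂ) * X ω) *
        (Complex.exp (Complex.I * u * X ω) - 1) ^ (2 * k)) := by
    intro ω
    set z := Complex.exp (Complex.I * u * X ω) with hz
    have hz1 : ‖z‖ = 1 := norm_exp_I_mul_mul u (X ω)
    have hz0 : z ≠ 0 := Complex.exp_ne_zero _
    have hconj : (starRingEnd ℂ) z = z⁻¹ := by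
      rw [Complex.inv_def, Complex.normSq_eq_norm_sq, hz1]; simp
    have h1 : ((‖z - 1‖ ^ 2 : ℝ) : ℂ) = -(z⁻¹ * (z - 1) ^ 2) := by
      rw [← Complex.normSq_eq_norm_sq, ← Complex.mul_conj, map_sub, hconj, map_one]
      field_simp
      ring
    have h2 : Complex.exp (Complex.I * ((-(k * u) : ℝ) : ℂ) * X ω) = (z⁻¹) ^ k := by
      rw [hz, ← Complex.exp_neg, ← Complex.exp_nat_mul]
      congr 1; push_cast; ring
    rw [h2, pow_mul, Complex.ofReal_pow, h1, neg_pow, mul_pow, ← pow_mul]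
  have h1 : ((∫ ω, ‖Complex.exp (Complex.I * u * X ω) - 1‖ ^ (2 * k) ∂μ : ℝ) : ℂ) =
      (-1) ^ k * (fwdDiff u)^[2 * k] ψ (-(k * u)) := by
    rw [← integral_complex_ofReal, fwdDiff_iter_charFun hX hψ, ← integral_const_mul]
    exact integral_congr_ae (Eventually.of_forall hpt)
  have h2 := congrArg norm h1
  rw [Complex.norm_real, norm_mul, norm_pow, norm_neg, norm_one, one_pow, one_mul,
    Real.norm_of_nonneg (integral_nonneg fun ω => by positivity)] at h2
  exact h2

/-- A variable with a smooth characteristic function has moments of all orders. -/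
lemma memLp_of_contDiff_charFun (hX : Measurable X)
    (hψ : ∀ u : ℝ, ∫ ω, Complex.exp (Complex.I * u * X ω) ∂μ = ψ u)
    (hsm : ∀ n : ℕ, ContDiff ℝ n ψ) (k : ℕ) (hk : 1 ≤ k) : MemLp X k μ := by
  -- For `0 ≤ u ≤ 1` all nodes from `-k u` to `k u` of the symmetric difference lie in `[-k, k]`.
  obtain ⟨C, hC⟩ := (isCompact_Icc (a := -(k : ℝ)) (b := k)).exists_bound_of_continuousOn
    ((hsm (2 * k)).continuous_iteratedDeriv' (2 * k)).continuousOn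
  have hC0 : 0 ≤ C := (norm_nonneg _).trans (hC 0 ⟨by simp, by simp⟩)
  have hbound : ∀ u : ℝ, 0 ≤ u → u ≤ 1 →
      ∫ ω, ‖Complex.exp (Complex.I * u * X ω) - 1‖ ^ (2 * k) ∂μ ≤ C * u ^ (2 * k) := by
    intro u hu hu1
    rw [integral_norm_exp_sub_one_pow hX hψ]
    have hk0 : (0 : ℝ) ≤ k := Nat.cast_nonneg k
    refine norm_fwdDiff_iter_le hu (2 * k) (hsm _) hC _ ?_ ?_
    · nlinarith
    · push_cast; nlinarith
  let w : ℕ → ℝ := fun m => 1 / ((m : ℝ) + 1)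
  have hw : ∀ m, 0 < w m := fun m => by positivity
  have hw1 : ∀ m, w m ≤ 1 := fun m => by
    rw [div_le_one (by positivity)]; linarith [(Nat.cast_nonneg m : (0 : ℝ) ≤ m)]
  have hlim : ∀ ω, Tendsto (fun m => ENNReal.ofReal
      ((‖Complex.exp (Complex.I * w m * X ω) - 1‖ / w m) ^ (2 * k))) atTop
      (𝓝 (ENNReal.ofReal (|X ω| ^ (2 * k)))) := by
    intro ω
    refine (ENNReal.continuous_ofReal.tendsto _).comp (Tendsto.pow ?_ _)
    have hd : HasDerivAt (fun t : ℝ => Complex.exp (Complex.I * t * X ω)) (Complex.I * X ω) 0 := by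
      have h1 : HasDerivAt (fun t : ℝ => Complex.I * (t : ℂ) * X ω) (Complex.I * X ω) 0 := by
        simpa using ((Complex.ofRealCLM.hasDerivAt (x := (0 : ℝ))).const_mul
          Complex.I).mul_const (X ω : ℂ)
      simpa using h1.cexp
    have h2 := (hasDerivAt_iff_tendsto_slope_zero.1 hd).norm
    have hw0 : Tendsto w atTop (𝓝[≠] 0) := tendsto_nhdsWithin_iff.2
      ⟨tendsto_one_div_add_atTop_nhds_zero_nat, Eventually.of_forall fun m => (hw m).ne'⟩
    have h3 := h2.comp hw0
    rw [norm_mul, Complex.norm_I, one_mul, Complex.norm_real, Real.norm_eq_abs] at h3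
    refine h3.congr fun m => ?_
    simp only [Function.comp_apply, zero_add, Complex.ofReal_zero, mul_zero, zero_mul,
      Complex.exp_zero]
    rw [norm_smul, norm_inv, Real.norm_of_nonneg (hw m).le]
    ring
  -- As `u → 0`, `|e^{iuX} - 1| / u` tends to `|X|`. The even moments of these quotients are bounded
  -- uniformly in `u`, so Fatou's lemma bounds the moment of `X`.
  have hfatou : ∫⁻ ω, ENNReal.ofReal (|X ω| ^ (2 * k)) ∂μ ≤ ENNReal.ofReal C := by
    calc _ = ∫⁻ ω, liminf (fun m => ENNReal.ofReal
          ((‖Complex.exp (Complex.I * w m * X ω) - 1‖ / w m) ^ (2 * k))) atTop ∂μ :=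
          lintegral_congr fun ω => (hlim ω).liminf_eq.symm
      _ ≤ liminf (fun m => ∫⁻ ω, ENNReal.ofReal
          ((‖Complex.exp (Complex.I * w m * X ω) - 1‖ / w m) ^ (2 * k)) ∂μ) atTop :=
          lintegral_liminf_le fun m => by fun_prop
      _ ≤ ENNReal.ofReal C := by
          refine liminf_le_of_le (by isBoundedDefault) fun b hb => ?_
          obtain ⟨m, hm⟩ := hb.exists
          refine hm.trans ?_
          rw [← ofReal_integral_eq_lintegral_ofReal]
          · refine ENNReal.ofReal_le_ofReal ?_
            simp only [div_pow]
            rw [integral_div, div_le_iff₀ (pow_pos (hw m) _)]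
            exact hbound _ (hw m).le (hw1 m)
          · refine Integrable.of_bound (C := (2 / w m) ^ (2 * k)) (by fun_prop)
              (Eventually.of_forall fun ω => ?_)
            rw [Real.norm_of_nonneg (by have := hw m; positivity)]
            have := hw m
            gcongr
            refine (norm_sub_le _ _).trans ?_
            rw [norm_exp_I_mul_mul, norm_one]
            norm_num
          · exact Eventually.of_forall fun ω => by have := hw m; positivity
  have h2k : MemLp X ((2 * k : ℕ) : ℝ≥0∞) μ := by
    refine ⟨hX.aestronglyMeasurable, ?_⟩
    rw [eLpNorm_lt_top_iff_lintegral_rpow_enorm_lt_top (by simp; omega)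
      (ENNReal.natCast_ne_top _)]
    refine lt_of_le_of_lt (le_of_eq ?_) (hfatou.trans_lt ENNReal.ofReal_lt_top)
    refine lintegral_congr fun ω => ?_
    rw [ENNReal.toReal_natCast, ENNReal.rpow_natCast, Real.enorm_eq_ofReal_abs,
      ENNReal.ofReal_pow (abs_nonneg _)]
  exact h2k.mono_exponent (by exact_mod_cast (by omega : k ≤ 2 * k))

end CharacteristicFunctions

/-! ### Smoothness of the characteristic exponent -/

section LevyExponent

variable {ν : Measure ℝ}

/-- Large jumps are covered by the moment hypothesis. For small ones `|x| ^ n ≤ |x| = min |x| 1`,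
which needs `n ≥ 1` as the measure may be infinite near the origin. -/
lemma integrable_abs_pow_levyMeasure (hν : IsFiniteVariationLevyMeasure ν)
    (hmom : HasLargeJumpMoments ν) {n : ℕ} (hn : 1 ≤ n) : Integrable (fun x => |x| ^ n) ν := by
  refine ⟨by fun_prop, ?_⟩
  rw [hasFiniteIntegral_iff_ofReal (Eventually.of_forall fun x => by positivity)]
  have hm : MeasurableSet {x : ℝ | 1 ≤ |x|} := measurableSet_le measurable_const measurable_norm
  rw [← lintegral_add_compl _ hm]
  refine ENNReal.add_lt_top.2 ⟨?_, ?_⟩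
  · have := hmom n (by exact_mod_cast hn)
    simpa using this
  · refine lt_of_le_of_lt ?_ hν.2
    refine (setLIntegral_mono' hm.compl fun x hx => ENNReal.ofReal_le_ofReal ?_).trans
      (setLIntegral_le_lintegral _ _)
    have hx1 : |x| < 1 := not_le.1 hx
    rw [min_eq_left hx1.le]
    exact pow_le_of_le_one (abs_nonneg _) hx1.le (by omega)

/-- The derivatives of the characteristic exponent. -/
def levyExponentDeriv (ν : Measure ℝ) (n : ℕ) (u : ℝ) : ℂ :=
  ∫ x, (Complex.I * x) ^ n * Complex.exp (Complex.I * u * x) ∂ν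

lemma hasDerivAt_exp_I_mul (x u : ℝ) : HasDerivAt (fun u : ℝ => Complex.exp (Complex.I * u * x))
    (Complex.I * x * Complex.exp (Complex.I * u * x)) u := by
  have h1 : HasDerivAt (fun t : ℝ => Complex.I * (t : ℂ) * x) (Complex.I * x) u := by
    simpa using ((Complex.ofRealCLM.hasDerivAt (x := u)).const_mul Complex.I).mul_const (x : ℂ)
  exact h1.cexp.congr_deriv (mul_comm _ _)

lemma norm_pow_mul_exp (n : ℕ) (u x : ℝ) :
    ‖(Complex.I * x) ^ n * Complex.exp (Complex.I * u * x)‖ = |x| ^ n := by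
  rw [norm_mul, norm_exp_I_mul_mul, mul_one, norm_pow, norm_mul, Complex.norm_I, one_mul,
    Complex.norm_real, Real.norm_eq_abs]

lemma hasDerivAt_levyExponentDeriv (hν : IsFiniteVariationLevyMeasure ν)
    (hmom : HasLargeJumpMoments ν) {n : ℕ} (hn : 1 ≤ n) (u : ℝ) :
    HasDerivAt (levyExponentDeriv ν n) (levyExponentDeriv ν (n + 1) u) u := by
  refine (hasDerivAt_integral_of_dominated_loc_of_deriv_le (s := Set.univ)
    (F := fun (u : ℝ) (x : ℝ) => (Complex.I * x) ^ n * Complex.exp (Complex.I * u * x))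
    (F' := fun (u : ℝ) (x : ℝ) => (Complex.I * x) ^ (n + 1) * Complex.exp (Complex.I * u * x))
    (bound := fun x => |x| ^ (n + 1)) Filter.univ_mem
    (Eventually.of_forall fun v => by fun_prop) ?_ (by fun_prop) ?_
    (integrable_abs_pow_levyMeasure hν hmom (by omega)) ?_).2
  · exact (integrable_abs_pow_levyMeasure hν hmom hn).mono' (by fun_prop)
      (Eventually.of_forall fun x => (norm_pow_mul_exp n u x).le)
  · exact Eventually.of_forall fun x v _ => (norm_pow_mul_exp (n + 1) v x).le
  · refine Eventually.of_forall fun x v _ =>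
      ((hasDerivAt_exp_I_mul x v).const_mul ((Complex.I * x) ^ n)).congr_deriv (by ring)

lemma hasDerivAt_levyExponent (b : ℝ) (hν : IsFiniteVariationLevyMeasure ν)
    (hmom : HasLargeJumpMoments ν) (u : ℝ) :
    HasDerivAt (levyExponent b ν) (Complex.I * b + levyExponentDeriv ν 1 u) u := by
  have h1 : HasDerivAt (fun t : ℝ => Complex.I * b * (t : ℂ)) (Complex.I * b) u := by
    simpa using (Complex.ofRealCLM.hasDerivAt (x := u)).const_mul (Complex.I * b)
  refine h1.add ?_
  have hI := integrable_abs_pow_levyMeasure hν hmom le_rfl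
  refine (hasDerivAt_integral_of_dominated_loc_of_deriv_le (s := Set.univ)
    (F := fun (u : ℝ) (x : ℝ) => Complex.exp (Complex.I * u * x) - 1)
    (F' := fun (u : ℝ) (x : ℝ) => (Complex.I * x) ^ 1 * Complex.exp (Complex.I * u * x))
    (bound := fun x => |x| ^ 1) Filter.univ_mem
    (Eventually.of_forall fun v => by fun_prop) ?_ (by fun_prop) ?_ hI ?_).2
  · refine (hI.const_mul |u|).mono' (by fun_prop) (Eventually.of_forall fun x => ?_)
    have h2 : Complex.I * u * x = Complex.I * ((u * x : ℝ) : ℂ) := by push_cast; ring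
    rw [h2, pow_one, ← abs_mul]
    exact Real.norm_exp_I_mul_ofReal_sub_one_le
  · exact Eventually.of_forall fun x v _ => (norm_pow_mul_exp 1 v x).le
  · refine Eventually.of_forall fun x v _ =>
      ((hasDerivAt_exp_I_mul x v).sub_const 1).congr_deriv (by ring)

lemma contDiff_levyExponentDeriv (hν : IsFiniteVariationLevyMeasure ν)
    (hmom : HasLargeJumpMoments ν) (k : ℕ) :
    ∀ {n : ℕ}, 1 ≤ n → ContDiff ℝ k (levyExponentDeriv ν n) := by
  induction k with
  | zero =>
    intro n hn
    exact contDiff_zero.2 (continuous_iff_continuousAt.2 fun u =>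
      (hasDerivAt_levyExponentDeriv hν hmom hn u).continuousAt)
  | succ k ih =>
    intro n hn
    push_cast
    refine contDiff_succ_iff_deriv.2 ⟨fun u =>
      (hasDerivAt_levyExponentDeriv hν hmom hn u).differentiableAt, by simp, ?_⟩
    rw [show deriv (levyExponentDeriv ν n) = levyExponentDeriv ν (n + 1) from
      funext fun u => (hasDerivAt_levyExponentDeriv hν hmom hn u).deriv]
    exact ih (by omega)

lemma contDiff_levyCharFun (b t : ℝ) (hν : IsFiniteVariationLevyMeasure ν)
    (hmom : HasLargeJumpMoments ν) (k : ℕ) : ContDiff ℝ k (levyCharFun b ν t) := by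
  have h1 : ContDiff ℝ ((k : ℕ) + 1) (levyExponent b ν) := by
    refine contDiff_succ_iff_deriv.2 ⟨fun u =>
      (hasDerivAt_levyExponent b hν hmom u).differentiableAt, by simp, ?_⟩
    rw [show deriv (levyExponent b ν) = fun u => Complex.I * b + levyExponentDeriv ν 1 u from
      funext fun u => (hasDerivAt_levyExponent b hν hmom u).deriv]
    exact contDiff_const.add (contDiff_levyExponentDeriv hν hmom k le_rfl)
  exact (contDiff_const.mul (h1.of_le (by exact_mod_cast Nat.le_succ k))).cexp

end LevyExponent

/-! ### The increments of the Lévy process as a noise sequence -/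

section Increments

variable {Ω : Type*} {mΩ : MeasurableSpace Ω} {μ : Measure Ω} [IsProbabilityMeasure μ]

/-- The increments of a Levy process over a regular grid form a noise sequence. -/
theorem IsLevyProcess.isNoise {b : ℝ} {ν : Measure ℝ} {Z : ℝ → Ω → ℝ} (hZ : IsLevyProcess μ b ν Z)
    (hν : IsFiniteVariationLevyMeasure ν) (hmom : HasLargeJumpMoments ν) {h : ℝ} (hh : 0 < h)
    {e : ℤ → Ω → ℝ} (he : ∀ n ω, e n ω = Z (n * h) ω - Z ((n - 1) * h) ω) : IsNoise μ e := by
  have hmeas : ∀ n, Measurable (e n) := fun n => by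
    rw [show e n = fun ω => Z (n * h) ω - Z ((n - 1) * h) ω from funext (he n)]
    exact (hZ.measurable _).sub (hZ.measurable _)
  have hchar : ∀ (n : ℤ) (u : ℝ),
      ∫ ω, Complex.exp (Complex.I * u * (e n ω : ℂ)) ∂μ = levyCharFun b ν h u := by
    intro n u
    have h1 := hZ.charFun_increment ((n - 1) * h) (n * h) (by nlinarith) u
    rw [show (n : ℝ) * h - (n - 1) * h = h by ring] at h1
    rw [← h1]
    simp only [he]
  have hident : ∀ n, IdentDistrib (e n) (e 0) μ μ := fun n => by
    refine ⟨(hmeas n).aemeasurable, (hmeas 0).aemeasurable, ?_⟩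
    have := Measure.isProbabilityMeasure_map (μ := μ) (hmeas n).aemeasurable
    have := Measure.isProbabilityMeasure_map (μ := μ) (hmeas 0).aemeasurable
    refine Measure.ext_of_charFun (funext fun u => ?_)
    have key : ∀ n, charFun (μ.map (e n)) u = levyCharFun b ν h u := fun n => by
      rw [charFun_apply_real, integral_map (hmeas n).aemeasurable (by fun_prop), ← hchar n]
      refine integral_congr_ae (Eventually.of_forall fun ω => ?_)
      simp only []
      congr 1; ring
    rw [key, key]
  refine ⟨hmeas, ?_, hident, ?_⟩
  -- Independence concerns finitely many indices, which are bounded below. A shift by `N` makes them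
  -- natural numbers, to which independence of increments along a monotone sequence of times
  -- applies.
  · refine iIndepFun_iff_finset.2 fun s => ?_
    obtain ⟨N, hN⟩ : ∃ N : ℕ, ∀ n ∈ s, -(N : ℤ) ≤ n := by
      refine ⟨s.sup Int.natAbs, fun n hn => ?_⟩
      have := Finset.le_sup (f := Int.natAbs) hn
      omega
    have hmono : Monotone fun j : ℕ => ((j : ℝ) - N - 1) * h := fun i j hij => by
      have : (i : ℝ) ≤ j := by exact_mod_cast hij
      dsimp only
      gcongr
    have hind := hZ.indep.nat hmono
    have hinj : Function.Injective fun n : s => ((n : ℤ) + N).toNat := by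
      intro n m hnm
      have h1 := hN n n.2
      have h2 := hN m m.2
      simp only at hnm
      exact Subtype.ext (by omega)
    have h3 := hind.precomp hinj
    refine (iIndepFun_congr fun n => Eventually.of_forall fun ω => ?_).1 h3
    have h4 : (((((n : ℤ) + N).toNat : ℕ) : ℤ) : ℝ) = n + N := by
      rw [Int.toNat_of_nonneg (by have := hN n n.2; omega)]; push_cast; ring
    rw [Int.cast_natCast] at h4
    simp only [Finset.restrict, he]
    push_cast
    rw [h4]
    congr 2 <;> ring_nf
  · refine MomentBounded.of_eLpNorm_le (fun n => (hmeas n).aestronglyMeasurable) fun k hk => ?_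
    have hL := memLp_of_contDiff_charFun (hmeas 0) (hchar 0)
      (fun n => contDiff_levyCharFun b h hν hmom n) k hk
    refine ⟨(eLpNorm (e 0) k μ).toReal, ENNReal.toReal_nonneg, fun n => ?_⟩
    rw [mul_one, ENNReal.ofReal_toReal hL.eLpNorm_ne_top, (hident n).eLpNorm_eq]

end Increments

end

/-! ### The theorem -/

theorem mainTheorem2
    {p r d M : ℕ} {Ω : Type*} [MeasurableSpace Ω] (μ : Measure Ω) [IsProbabilityMeasure μ]
    -- the noise: sampling interval, parametric family of drifts and Levy measures, true parameter
    (h : ℝ) (hh : 0 < h)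
    (b : EuclideanSpace ℝ (Fin r) → ℝ) (ν : EuclideanSpace ℝ (Fin r) → Measure ℝ)
    (Dη : Set (EuclideanSpace ℝ (Fin r))) (hν : ∀ η ∈ Dη, IsFiniteVariationLevyMeasure (ν η))
    (ηs : EuclideanSpace ℝ (Fin r)) (hηs : ηs ∈ Dη)
    (Z : ℝ → Ω → ℝ) (hZ : IsLevyProcess μ (b ηs) (ν ηs) Z)
    (ΔZ : ℤ → Ω → ℝ) (hΔZ : ∀ n ω, ΔZ n ω = Z (n * h) ω - Z ((n - 1) * h) ω)
    -- the moment condition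
    (hmom : HasLargeJumpMoments (ν ηs)) (hmean : ∀ n, ∫ ω, ΔZ n ω ∂μ = 0)
    -- the parameter domains and the system, with the stability condition
    (G D Ds : Set (EuclideanSpace ℝ (Fin p))) (hG : IsOpen G) (hDG : D ⊆ G)
    (hD : IsCompact D) (hDs : IsCompact Ds) (hDsD : Ds ⊆ interior D)
    (θs : EuclideanSpace ℝ (Fin p)) (hθs : θs ∈ Ds)
    (S : InnovationSystem p d) (hsmooth : S.IsSmoothOn G) (hstable : S.IsStableOn G)
    -- the observed output and the initial state of the inverse filter
    (Δy : ℤ → Ω → ℝ) (hΔy : Δy = S.output θs ΔZ) (ξ : Fin d → ℝ)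
    -- the points `u_k`, the weighting matrix, and the values `φ(u_k, η)`
    (u : Fin M → ℝ) (K : Matrix (Fin M × Fin p) (Fin M × Fin p) ℂ) (hK : K.PosDef)
    (φ : EuclideanSpace ℝ (Fin r) → Fin M → ℂ)
    (hφ : ∀ η k, φ η k = levyCharFun (b η) (ν η) h (u k))
    -- for each `η`, the equation `W_θ(θ, η) = 0` has a unique solution in `D`, which lies in `Ds`
    (huniq : ∀ η ∈ Dη, ∃ θ ∈ Ds, gradient (costW μ S Δy u (φ η) K) θ = 0 ∧
      ∀ θ' ∈ D, gradient (costW μ S Δy u (φ η) K) θ' = 0 → θ' = θ)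
    -- the Hessian `R*(η)` is invertible
    (hR : ∀ η ∈ Dη, IsUnit (hessianMatrix (costW μ S Δy u (φ η) K) θs)) :
    ∀ η ∈ Dη,
      hessianMatrix (costW μ S Δy u (φ η) K) θs =
        (2 : ℝ) • ((jacobianMatrix (asymScore μ S Δy u (φ η)) θs)ᴴ * K⁻¹ *
          jacobianMatrix (asymScore μ S Δy u (φ η)) θs).map Complex.re ∧
      ∀ θhat : ℕ → Ω → EuclideanSpace ℝ (Fin p),
        (∀ N, IsScoreRoot μ D (fun ω => costV S ξ Δy u (φ η) K N ω) (θhat N)) →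
        IsOM μ
          (fun N ω => (θhat N ω - θs) -
            -(WithLp.toLp 2 ((hessianMatrix (costW μ S Δy u (φ η) K) θs)⁻¹ *ᵥ
              WithLp.ofLp (gradient (costV S ξ Δy u (φ η) K N ω) θs))))
          (fun N => (N : ℝ)⁻¹) := by
  intro η hη
  -- The law of the data is governed by `ηs` alone; `η` enters the scores only through the constants
  -- `φ η`.
  have hnoise := hZ.isNoise (hν ηs hηs) hmom hh hΔZ
  exact InnovationSystem.hessianMatrix_costW_and_isOM u (φ η) hnoise hmean hG hDG hD hDsD hθs
    hsmooth hstable hΔy hK.isHermitian (huniq η hη) (hR η hη)
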